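/- Let $\mathcal{C}=\{\mathcal{C}_n\}_{n\in\mathbb{N}}$ be a family of concept classes, where $\mathcal{C}_n$ is a set of functions $\{0,1\}^n\to\{0,1\}$ (concepts), and let $\mathcal{D}=\{\mathcal{D}_n\}_{n\in\mathbb{N}}$ be a family of probability distributions, $\mathcal{D}_n$ on $\{0,1\}^n$. Suppose that: (a) The concepts can be evaluated in polynomial time on a quantum computer: there are finite lists $c_{n,0},\dots,c_{n,m(n)-1}$ of exactly the elements of $\mathcal{C}_n$ (repetitions are allowed, with $m(n)$ at most polynomial in $n$ and $|\mathcal{C}_n|$) and one polynomial-time quantum algorithm that, for all $n$, all $x\in\{0,1\}^n$ and all $i<m(n)$, outputs $c_{n,i}(x)$ with probability at least $2/3$ on input $(x,0^i)$. (b) There is a polynomial $p$ such that $|\mathcal{C}_n|\le p(n)$ for every $n$. (c) There is a family $\{c_n\}_{n\in\mathbb{N}}$ with $c_n\in\mathcal{C}_n$ such that $(\{c_n\}_n,\{\mathcal{D}_n\}_n)\notin\mathsf{HeurP/poly}$. That is, there is no deterministic polynomial-time classical algorithm $\mathcal{A}$ such that for every $n$ and every $\epsilon>0$ there is an advice string $\alpha_{n,\epsilon}$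 of length at most polynomial in $n$ and $1/\epsilon$ with $\Pr_{x\sim\mathcal{D}_n}[\mathcal{A}(x,0^{\lfloor 1/\epsilon\rfloor},\alpha_{n,\epsilon})=c_n(x)]\ge 1-\epsilon$. Then $(\mathcal{C},\mathcal{D})$ exhibits a $\mathsf{CC}/\mathsf{QQ}$ learning separation, i.e. $(\mathcal{C},\mathcal{D})\in\mathsf{QQ}$ and $(\mathcal{C},\mathcal{D})\notin\mathsf{CC}$. Here $\mathsf{QQ}$ (respectively $\mathsf{CC}$) is the set of all $(\mathcal{C},\mathcal{D})$ for which there are a class of hypotheses $h:\{0,1\}^n\to\{0,1\}$ specified by strings, a polynomial-time quantum (respectively classical randomized) algorithm that, given $x\in\{0,1\}^n$ and a specification of a hypothesis $h$ on $\{0,1\}^n$, outputs $h(x)$ with probability at least $2/3$, and a quantum (respectively classical randomized) learning algorithm with the following property. For all $n$, all $c\in\mathcal{C}_n$ and all $0<\epsilon,\delta<1/2$, given $0^n$, $0^{\lfloor1/\epsilon\rfloor}$, $0^{\lfloor1/\delta\rfloor}$ and an oracle that on each call returns in unit time a pair $(x,c(x))$ with $x$ drawn independently from $\mathcal{D}_n$,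 it runs in time polynomial in $n$, $1/\epsilon$, $1/\delta$ and, with probability at least $1-\delta$, outputs a specification of a hypothesis $h$ on $\{0,1\}^n$ with $\Pr_{x\sim\mathcal{D}_n}[h(x)\ne c(x)]\le\epsilon$. -/

import Mathlib

noncomputable section

namespace PAC

/-! ## The machine model

Programs work on finitely many stacks of bits (stack `i` for `i : ℕ`; a program mentions only
finitely many of them), with finite structured control. One step touches the top of one stack, so
that without the extra devices this is a multitape Turing machine up to polynomial overhead.
The extra devices are: a fair coin, an oracle for labelled examples (unit time per call), and a
register of qubits under classical control (gates `H`, `T`, `CNOT`, measurement of a single qubit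
in the computational basis, preparation of the all-zero state). -/

/-- Elementary instructions. A qubit is addressed by the *length* of a stack (a unary address). -/
inductive Instr : Type
  /-- push the bit `b` on stack `i` -/
  | push (b : Bool) (i : ℕ)
  /-- remove the top of stack `i` (no effect on an empty stack) -/
  | pop (i : ℕ)
  /-- push a fair random bit on stack `i` -/
  | coin (i : ℕ)
  /-- call the oracle; its answer replaces the content of stack `i` -/
  | query (i : ℕ)
  /-- prepare the whole quantum register in the state `|0…0⟩` -/
  | qinit
  /-- Hadamard gate on the qubit with index the length of stack `i` -/
  | hGate (i : ℕ)
  /-- `T = diag(1, exp(iπ/4))` on the qubit with index the length of stack `i` -/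
  | tGate (i : ℕ)
  /-- controlled NOT; control and target are the lengths of stacks `i` and `j`
  (no effect if they coincide) -/
  | cnot (i j : ℕ)
  /-- measure the qubit with index the length of stack `i`, push the outcome on stack `j` -/
  | measure (i j : ℕ)

/-- Programs. -/
inductive Prog : Type
  /-- an elementary instruction -/
  | instr (a : Instr)
  /-- first `p`, then `q` -/
  | seq (p q : Prog)
  /-- continue with `e`, `f` or `t` when stack `i` is empty, has top `false`, has top `true` -/
  | branch (i : ℕ) (e f t : Prog)
  /-- repeat `p` as long as stack `i` is not empty -/
  | loop (i : ℕ) (p : Prog)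

/-- Every instruction in the program satisfies `S`. -/
def Prog.All (S : Instr → Prop) : Prog → Prop
  | .instr a => S a
  | .seq p q => p.All S ∧ q.All S
  | .branch _ e f t => e.All S ∧ f.All S ∧ t.All S
  | .loop _ p => p.All S

/-- Instructions of a deterministic classical machine. -/
def Instr.IsDeterministic : Instr → Prop
  | .push _ _ => True
  | .pop _ => True
  | _ => False

/-- Instructions on the quantum register. -/
def Instr.IsQuantum : Instr → Prop
  | .qinit => True
  | .hGate _ => True
  | .tGate _ => True
  | .cnot _ _ => True
  | .measure _ _ => True
  | _ => False

/-- Calls of the oracle. -/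
def Instr.IsQuery : Instr → Prop
  | .query _ => True
  | _ => False

/-- The type of computer: a classical randomized one or a quantum one. -/
inductive Mode : Type
  | classical
  | quantum

/-- Instructions available on a computer of the given type. -/
def Instr.AllowedOn : Mode → Instr → Prop
  | .classical, a => ¬ a.IsQuantum
  | .quantum, _ => True

/-- Vectors of the quantum register. Qubits are indexed by `ℕ`; the basis state `S : Finset ℕ` is
the one in which exactly the qubits in `S` have value 1. -/
abbrev QState : Type := Finset ℕ →₀ ℂ

/-- The state `|0…0⟩`. -/
def QState.zero : QState := Finsupp.single ∅ 1

/-- Hadamard gate on qubit `q`. -/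
def QState.applyH (q : ℕ) : QState →ₗ[ℂ] QState :=
  Finsupp.linearCombination ℂ fun S : Finset ℕ =>
    (Finsupp.single (S.erase q) ((1 / Real.sqrt 2 : ℝ) : ℂ) +
      Finsupp.single (insert q S)
        (if q ∈ S then -((1 / Real.sqrt 2 : ℝ) : ℂ) else ((1 / Real.sqrt 2 : ℝ) : ℂ)) : QState)

/-- `T` gate on qubit `q`. -/
def QState.applyT (q : ℕ) : QState →ₗ[ℂ] QState :=
  Finsupp.linearCombination ℂ fun S : Finset ℕ =>
    (Finsupp.single S
      (if q ∈ S then Complex.exp (Complex.I * ((Real.pi / 4 : ℝ) : ℂ)) else 1) : QState)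

/-- Controlled NOT with control `c` and target `t` (the identity if `c = t`). -/
def QState.applyCNOT (c t : ℕ) : QState →ₗ[ℂ] QState :=
  Finsupp.linearCombination ℂ fun S : Finset ℕ =>
    (Finsupp.single (if c ≠ t ∧ c ∈ S then symmDiff S {t} else S) 1 : QState)

/-- Projection on the subspace in which qubit `q` has value `b`. -/
def QState.proj (q : ℕ) (b : Bool) (ψ : QState) : QState :=
  ψ.filter fun S => decide (q ∈ S) = b

/-- The squared norm. -/
def QState.normSq (ψ : QState) : NNReal :=
  ψ.sum fun _ a => ‖a‖₊ ^ 2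

/-- The probability of outcome 1 when qubit `q` is measured (Born rule for a nonzero vector that
need not be normalized). -/
def QState.probOne (q : ℕ) (ψ : QState) : NNReal :=
  (ψ.proj q true).normSq / ((ψ.proj q true).normSq + (ψ.proj q false).normSq)

theorem QState.probOne_le_one (q : ℕ) (ψ : QState) : ψ.probOne q ≤ 1 :=
  div_le_one_of_le₀ le_self_add (by positivity)

theorem QState.sum_outcome (q : ℕ) (ψ : QState) :
    ∑ b : Bool, (if b then (ψ.probOne q : ENNReal) else ((1 - ψ.probOne q : NNReal) : ENNReal))
      = 1 := by
  rw [Fintype.sum_bool]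
  simp only [if_true, Bool.false_eq_true, if_false]
  rw [← ENNReal.coe_add, add_tsub_cancel_of_le (ψ.probOne_le_one q), ENNReal.coe_one]

/-- The distribution of the measurement outcome of qubit `q`. -/
def QState.outcome (q : ℕ) (ψ : QState) : PMF Bool :=
  PMF.ofFintype
    (fun b => if b then (ψ.probOne q : ENNReal) else ((1 - ψ.probOne q : NNReal) : ENNReal))
    (ψ.sum_outcome q)

/-- The memory of a computer. -/
structure Store : Type where
  /-- the stacks; the head of the list is the top of the stack -/
  stack : ℕ → List Bool
  /-- the state vector of the quantum register, up to a nonzero scalar -/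
  reg : QState

/-- Replace the content of stack `i`. -/
def Store.set (s : Store) (i : ℕ) (w : List Bool) : Store :=
  { s with stack := Function.update s.stack i w }

/-- Initially stack `j` holds the `j`-th input, all other stacks are empty, all qubits are 0. -/
def Store.init (ins : List (List Bool)) : Store where
  stack := fun j => ins.getD j []
  reg := QState.zero

/-- Effect of an instruction; every call of the oracle is an independent draw from `O`. -/
def Instr.exec (O : PMF (List Bool)) (s : Store) : Instr → PMF Store
  | .push b i => PMF.pure (s.set i (b :: s.stack i))
  | .pop i => PMF.pure (s.set i (s.stack i).tail)
  | .coin i => (PMF.uniformOfFintype Bool).map fun b => s.set i (b :: s.stack i)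
  | .query i => O.map fun w => s.set i w
  | .qinit => PMF.pure { s with reg := QState.zero }
  | .hGate i => PMF.pure { s with reg := QState.applyH (s.stack i).length s.reg }
  | .tGate i => PMF.pure { s with reg := QState.applyT (s.stack i).length s.reg }
  | .cnot i j => PMF.pure
      { s with reg := QState.applyCNOT (s.stack i).length (s.stack j).length s.reg }
  | .measure i j => (s.reg.outcome (s.stack i).length).map fun b =>
      Store.set { s with reg := s.reg.proj (s.stack i).length b } j (b :: s.stack j)

/-- A configuration: the programs that remain to be executed, in order, and the memory. -/
abbrev Cfg : Type := List Prog × Store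

/-- One step of computation. A configuration with nothing left to execute has halted. -/
def step (O : PMF (List Bool)) : Cfg → PMF Cfg
  | ([], s) => PMF.pure ([], s)
  | (.instr a :: k, s) => (a.exec O s).map fun s' => (k, s')
  | (.seq p q :: k, s) => PMF.pure (p :: q :: k, s)
  | (.branch i e f t :: k, s) =>
      match s.stack i with
      | [] => PMF.pure (e :: k, s)
      | false :: _ => PMF.pure (f :: k, s)
      | true :: _ => PMF.pure (t :: k, s)
  | (.loop i p :: k, s) =>
      match s.stack i with
      | [] => PMF.pure (k, s)
      | _ :: _ => PMF.pure (p :: .loop i p :: k, s)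

/-- The distribution of the configuration after `T` steps from `c`. -/
def run (O : PMF (List Bool)) (c : Cfg) : ℕ → PMF Cfg
  | 0 => PMF.pure c
  | T + 1 => (run O c T).bind (step O)

/-- On inputs `ins` with oracle `O`, the program has halted after `T` steps, whatever the outcomes
of the random events are. -/
def Prog.HaltsWithin (P : Prog) (O : PMF (List Bool)) (ins : List (List Bool)) (T : ℕ) : Prop :=
  ∀ c ∈ (run O ([P], Store.init ins) T).support, c.1 = []

/-- The probability that the program, on inputs `ins` with oracle `O`, halts with an output in `W`.
The output is the content of stack `0` at the end. -/
def Prog.prob (P : Prog) (O : PMF (List Bool)) (ins : List (List Bool)) (W : Set (List Bool)) :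
    ENNReal :=
  ⨆ T : ℕ, (run O ([P], Store.init ins) T).toOuterMeasure {c | c.1 = [] ∧ c.2.stack 0 ∈ W}

/-- The trivial oracle, for programs that do not call an oracle. -/
def noOracle : PMF (List Bool) := PMF.pure []

/-- A polynomial-time algorithm with `r` input strings and without oracle. -/
def Prog.IsPolyTime (P : Prog) (r : ℕ) : Prop :=
  P.All (fun a => ¬ a.IsQuery) ∧
    ∃ t : Polynomial ℕ, ∀ ins : List (List Bool), ins.length = r →
      P.HaltsWithin noOracle ins (t.eval (ins.map List.length).sum)

/-! ## Concepts, learning problems, heuristic complexity -/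

/-- Bit strings of length `n`. -/
abbrev BitStr (n : ℕ) : Type := Fin n → Bool

/-- Concepts and hypotheses of instance size `n`. -/
abbrev Concept (n : ℕ) : Type := BitStr n → Bool

/-- The number `k` in unary, `0^k`. -/
def unary (k : ℕ) : List Bool := List.replicate k false

/-- The probability of an event under a distribution. -/
def Pr {α : Type} (μ : PMF α) (A : Set α) : ENNReal := μ.toOuterMeasure A

/-- `P` computes `f` on `{0,1}^n`, given the further input `w`, with probability at least `2/3`
on every instance. -/
def Prog.Evaluates (P : Prog) {n : ℕ} (w : List Bool) (f : Concept n) : Prop :=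
  ∀ x : BitStr n, 2 / 3 ≤ P.prob noOracle [List.ofFn x, w] {[f x]}

/-- The distributional problem `({c n}, {D n})` is in `HeurP/poly`. -/
def HeurPPoly (c : ∀ n, Concept n) (D : ∀ n, PMF (BitStr n)) : Prop :=
  ∃ (A : Prog) (q : Polynomial ℕ),
    A.All Instr.IsDeterministic ∧ A.IsPolyTime 3 ∧
    ∀ (n : ℕ) (ε : ℝ), 0 < ε →
      ∃ α : List Bool, α.length ≤ q.eval (n + ⌊1 / ε⌋₊) ∧
        ENNReal.ofReal (1 - ε) ≤ Pr (D n)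
          {x | A.prob noOracle [List.ofFn x, unary ⌊1 / ε⌋₊, α] {[c n x]} = 1}

/-- The concepts of the class can be evaluated in polynomial time on a quantum computer: one
polynomial-time quantum algorithm evaluates every concept of every `C n`, given its number (in
unary, so in time polynomial in `n` if there are polynomially many) in a list
`e n 0, …, e n (m n - 1)` of the elements of `C n`. Repetitions in the list are allowed as long as
its length stays polynomial in `n` and the number of concepts. -/
def QuantumEvaluable (C : ∀ n, Set (Concept n)) : Prop :=
  ∃ (E : Prog) (m : ℕ → ℕ) (e : ∀ n, ℕ → Concept n) (q : Polynomial ℕ),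
    E.IsPolyTime 2 ∧
    ∀ n, C n = e n '' Set.Iio (m n) ∧ m n ≤ q.eval (n + (C n).ncard) ∧
      ∀ i < m n, E.Evaluates (unary i) (e n i)

/-- A hypothesis class, given by its enumeration: `R n σ = some h` says that the string `σ` is a
specification of the hypothesis `h` of instance size `n`; `none` says that `σ` specifies nothing. -/
abbrev HypothesisClass : Type := ∀ n, List Bool → Option (Concept n)

/-- The hypothesis class is efficiently evaluatable on a computer of type `M`. -/
def EvaluatableOn (M : Mode) (R : HypothesisClass) : Prop :=
  ∃ E : Prog, E.All (Instr.AllowedOn M) ∧ E.IsPolyTime 2 ∧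
    ∀ (n : ℕ) (σ : List Bool) (h : Concept n), R n σ = some h → E.Evaluates σ h

/-- The answer of an example oracle for the labelled example `(x, y)`: label on top, then `x`. -/
def encodeExample {n : ℕ} (z : BitStr n × Bool) : List Bool := z.2 :: List.ofFn z.1

/-- The example oracle `EX(c, μ)`. -/
def exampleOracle {n : ℕ} (c : Concept n) (μ : PMF (BitStr n)) : PMF (List Bool) :=
  μ.map fun x => encodeExample (x, c x)

/-- The inputs of a learning algorithm: `n`, `ε` and `δ`, in unary. -/
def learnerInput (n : ℕ) (ε δ : ℝ) : List (List Bool) :=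
  [unary n, unary ⌊1 / ε⌋₊, unary ⌊1 / δ⌋₊]

/-- The specifications of hypotheses with error at most `ε` with respect to `c` under `μ`. -/
def goodSpecs (R : HypothesisClass) {n : ℕ} (c : Concept n) (μ : PMF (BitStr n)) (ε : ℝ) :
    Set (List Bool) :=
  {σ | ∃ h : Concept n, R n σ = some h ∧ Pr μ {x | h x ≠ c x} ≤ ENNReal.ofReal ε}

/-- `C` is efficiently PAC learnable under `D`, by a learning algorithm on a computer of type `M`,
with the hypothesis class `R`. The running time is polynomial in `n`, `1/ε` and `1/δ`, for every
source of labelled examples. -/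
def LearnableWith (M : Mode) (R : HypothesisClass) (C : ∀ n, Set (Concept n))
    (D : ∀ n, PMF (BitStr n)) : Prop :=
  ∃ (A : Prog) (t : Polynomial ℕ), A.All (Instr.AllowedOn M) ∧
    ∀ (n : ℕ) (ε δ : ℝ), 0 < ε → ε < 1 / 2 → 0 < δ → δ < 1 / 2 →
      (∀ μ : PMF (BitStr n × Bool),
        A.HaltsWithin (μ.map encodeExample) (learnerInput n ε δ)
          (t.eval (n + ⌊1 / ε⌋₊ + ⌊1 / δ⌋₊))) ∧
      ∀ c ∈ C n, ENNReal.ofReal (1 - δ) ≤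
        A.prob (exampleOracle c (D n)) (learnerInput n ε δ) (goodSpecs R c (D n) ε)

/-- The categories of learning problems: learner of type `M₁`, hypothesis class evaluatable on a
computer of type `M₂`. -/
def InCategory (M₁ M₂ : Mode) (C : ∀ n, Set (Concept n)) (D : ∀ n, PMF (BitStr n)) : Prop :=
  ∃ R : HypothesisClass, EvaluatableOn M₂ R ∧ LearnableWith M₁ R C D

/-- The category `CC`. -/
def CC (C : ∀ n, Set (Concept n)) (D : ∀ n, PMF (BitStr n)) : Prop :=
  InCategory .classical .classical C D

/-- The category `QQ`. -/
def QQ (C : ∀ n, Set (Concept n)) (D : ∀ n, PMF (BitStr n)) : Prop :=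
  InCategory .quantum .quantum C D

/-- The learning problem exhibits a `CC/QQ` separation. -/
def SeparationCCQQ (C : ∀ n, Set (Concept n)) (D : ∀ n, PMF (BitStr n)) : Prop :=
  QQ C D ∧ ¬ CC C D

end PAC

end

noncomputable section

namespace PAC

section

/-! Learnability in `QQ` is learning by enumeration. The hypotheses are the concepts themselves,
specified by their numbers in unary. With `S = n + ⌊1/ε⌋ + ⌊1/δ⌋ + 2` and `M = S ^ c` for a suitable
constant `c`, the learner tries the numbers `0, 1, …` in turn. It tests each on `M` fresh examples,
replaces every evaluation by a majority vote over `M` runs of the evaluator, and accepts the first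
number that agrees with all its examples. Let the target have number `t`. A concept of error above
`ε` passes its test with probability at most `(1 - ε/2)^M ≤ 2/(Mε)`, and the target fails with
probability at most `M (17/18)^M ≤ 1296/M`. Since `t` is below a polynomial, a union bound over the
numbers up to `t` leaves failure probability at most `δ` (`searchDist_failure`). That the program
realizes this process in polynomial time, for every source of examples, is `sem_learner`.

Membership in `CC` would put every family of concepts of the class in `HeurP/poly`, against the
third assumption (`heurPPoly_of_cc`). The learner succeeds with positive probability, so a good
specification exists, and it is short because it was written in polynomial time
(`exists_short_goodSpec`). It serves as advice. Its evaluator is randomized, and Adleman's argument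
removes the coins: a majority over `18 (n + 1)` runs errs with probability below `2^{-n}` on each
instance, so by a union bound one tape of coins is right on all `2^n` instances (`exists_tape`).
Specification, number of votes and tape together form the advice of the deterministic program
`decider`.

Both halves use the same program `majority`, with error estimate `majority_potential`. Programs are
analysed through `Sem`, which forgets all of the final store except an abstract outcome whose exact
distribution is known. Probability theory is then done on explicit Markov chains (`iter`), apart
from the machine. -/

theorem _root_.PMF.bind_congr_support {α β : Type} (p : PMF α) {f g : α → PMF β}
    (h : ∀ a ∈ p.support, f a = g a) : p.bind f = p.bind g := by
  ext b
  simp only [PMF.bind_apply]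
  refine tsum_congr fun a => ?_
  by_cases ha : p a = 0
  · simp [ha]
  · rw [h a ((PMF.mem_support_iff _ _).2 ha)]

theorem _root_.PMF.map_congr_support {α β : Type} (p : PMF α) {f g : α → β}
    (h : ∀ a ∈ p.support, f a = g a) : p.map f = p.map g := by
  simp only [← PMF.bind_pure_comp]
  exact p.bind_congr_support fun a ha => by simp [h a ha]

/-! ## Running programs -/

variable {O : PMF (List Bool)}

/-- `run` splits off the last step; arguments that follow a program split off the first. -/
theorem run_succ' (c : Cfg) (T : ℕ) :
    run O c (T + 1) = (step O c).bind fun c' => run O c' T := by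
  induction T with
  | zero => simp [run]
  | succ T ih =>
    rw [run, ih, PMF.bind_bind]
    rfl

theorem run_nil (s : Store) (T : ℕ) : run O ([], s) T = PMF.pure ([], s) := by
  induction T with
  | zero => rfl
  | succ T ih => rw [run, ih, PMF.pure_bind]; rfl

theorem run_add (c : Cfg) (T T' : ℕ) :
    run O c (T + T') = (run O c T).bind fun c' => run O c' T' := by
  induction T' with
  | zero => simp [run]
  | succ T' ih => rw [← add_assoc, run, ih, PMF.bind_bind]; rfl

/-- The computation from `c` has surely halted after `T` steps. -/
def Halts (O : PMF (List Bool)) (c : Cfg) (T : ℕ) : Prop :=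
  ∀ c' ∈ (run O c T).support, c'.1 = []

theorem Halts.run_add {c : Cfg} {T : ℕ} (h : Halts O c T) (T' : ℕ) :
    run O c (T + T') = run O c T := by
  rw [PAC.run_add]
  conv_rhs => rw [← PMF.bind_pure (run O c T)]
  refine PMF.bind_congr_support _ fun c' hc' => ?_
  obtain ⟨k, s⟩ := c'
  obtain rfl : k = [] := h _ hc'
  exact run_nil s T'

theorem Halts.run_eq {c : Cfg} {T T' : ℕ} (h : Halts O c T) (hT : T ≤ T') :
    run O c T' = run O c T := by
  obtain ⟨d, rfl⟩ := Nat.exists_eq_add_of_le hT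
  exact h.run_add d

theorem Halts.mono {c : Cfg} {T T' : ℕ} (h : Halts O c T) (hT : T ≤ T') : Halts O c T' := by
  intro c' hc'
  rw [h.run_eq hT] at hc'
  exact h c' hc'

theorem step_append (P : Prog) (k k' : List Prog) (s : Store) :
    step O (P :: k ++ k', s) = (step O (P :: k, s)).map fun c => (c.1 ++ k', c.2) := by
  cases P with
  | instr a => simp only [List.cons_append, step, PMF.map_comp]; rfl
  | seq p q => simp [step, PMF.pure_map]
  | branch i e f t =>
    simp only [List.cons_append, step]
    split <;> simp [PMF.pure_map]
  | loop i p =>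
    simp only [List.cons_append, step]
    split <;> simp [PMF.pure_map]

/-- The budgets are only upper bounds: on some random branches `k` may end early, so that `k'`
starts early. The two sides still agree because a halted configuration no longer changes, which is
why `k'` is required to halt within `T'` from every store reached. -/
theorem run_append {T : ℕ} : ∀ {k k' : List Prog} {s : Store} {T' : ℕ},
    (∀ c ∈ (run O (k, s) T).support, c.1 = [] ∧ Halts O (k', c.2) T') →
    run O (k ++ k', s) (T + T') = (run O (k, s) T).bind fun c => run O (k', c.2) T' := by
  induction T with
  | zero =>
    intro k k' s T' h
    have := (h (k, s) (by simp [run])).1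
    simp only at this
    subst this
    simp [run]
  | succ T ih =>
    intro k k' s T' h
    cases k with
    | nil =>
      rw [run_nil, PMF.pure_bind, List.nil_append]
      refine Halts.run_eq ?_ (by omega)
      exact (h ([], s) (by simp [run_nil])).2
    | cons P k =>
      rw [show T + 1 + T' = (T + T') + 1 by ring, run_succ', run_succ', step_append, PMF.bind_map,
        PMF.bind_bind]
      refine PMF.bind_congr_support _ fun c hc => ?_
      refine ih fun c' hc' => h c' ?_
      rw [run_succ', PMF.mem_support_bind_iff]
      exact ⟨c, hc, hc'⟩

/-! ### A program logic with exact output distributions -/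

/-- Started in `(k, s)`, the computation surely halts within `T` steps; up to the abstraction `R`
of stores, the distribution of the result is `ν`. -/
def Sem (O : PMF (List Bool)) (k : List Prog) (s : Store) (T : ℕ) {α : Type} (ν : PMF α)
    (R : α → Store → Prop) : Prop :=
  ∃ κ : PMF (α × Store), κ.map Prod.fst = ν ∧ (∀ p ∈ κ.support, R p.1 p.2) ∧
    run O (k, s) T = κ.map fun p => ([], p.2)

variable {α β : Type} {k k' : List Prog} {s s' : Store} {T T' : ℕ} {ν : PMF α}
  {R : α → Store → Prop}

theorem Sem.halts (h : Sem O k s T ν R) : Halts O (k, s) T := by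
  obtain ⟨κ, -, -, h⟩ := h
  intro c hc
  rw [h, PMF.mem_support_map_iff] at hc
  obtain ⟨p, -, rfl⟩ := hc
  rfl

theorem Sem.mono (h : Sem O k s T ν R) (hT : T ≤ T') : Sem O k s T' ν R := by
  have hh := h.halts.run_eq hT
  obtain ⟨κ, h1, h2, h3⟩ := h
  exact ⟨κ, h1, h2, hh.trans h3⟩

theorem Sem.nil {a : α} (h : R a s) : Sem O [] s T (PMF.pure a) R :=
  ⟨PMF.pure (a, s), by simp [PMF.pure_map], by simpa using h, by simp [run_nil, PMF.pure_map]⟩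

theorem Sem.conseq {R' : α → Store → Prop} (h : Sem O k s T ν R)
    (hR : ∀ a ∈ ν.support, ∀ s', R a s' → R' a s') : Sem O k s T ν R' := by
  obtain ⟨κ, h1, h2, h3⟩ := h
  refine ⟨κ, h1, fun p hp => hR _ ?_ _ (h2 p hp), h3⟩
  rw [← h1, PMF.mem_support_map_iff]
  exact ⟨p, hp, rfl⟩

/-- The Markov property for abstract outcomes: the law of the second outcome may depend on the store
only through `a`, so the laws compose by `bind` whatever else the store contains. -/
theorem Sem.append {ν' : α → PMF β} {R' : β → Store → Prop} (h : Sem O k s T ν R)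
    (h' : ∀ a ∈ ν.support, ∀ s', R a s' → Sem O k' s' T' (ν' a) R') :
    Sem O (k ++ k') s (T + T') (ν.bind ν') R' := by
  obtain ⟨κ, rfl, h2, h3⟩ := h
  have hex : ∀ p ∈ κ.support, Sem O k' p.2 T' (ν' p.1) R' := fun p hp =>
    h' p.1 ((PMF.mem_support_map_iff _ _ _).2 ⟨p, hp, rfl⟩) p.2 (h2 p hp)
  -- Off the support nothing is known about the continuation, but a distribution is needed there
  -- too; one is borrowed from a point of the support.
  have : ∀ p, ∃ κ' : PMF (β × Store), p ∈ κ.support → (κ'.map Prod.fst = ν' p.1 ∧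
      (∀ p ∈ κ'.support, R' p.1 p.2) ∧ run O (k', p.2) T' = κ'.map fun p => ([], p.2)) := by
    intro p
    by_cases hp : p ∈ κ.support
    · obtain ⟨κ', h⟩ := hex p hp
      exact ⟨κ', fun _ => h⟩
    · obtain ⟨q, hq⟩ := κ.support_nonempty
      obtain ⟨κ', -⟩ := hex q hq
      exact ⟨κ', fun h => absurd h hp⟩
  choose κ' hκ' using this
  refine ⟨κ.bind κ', ?_, ?_, ?_⟩
  · rw [PMF.map_bind, PMF.bind_map]
    exact PMF.bind_congr_support _ fun p hp => (hκ' p hp).1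
  · intro q hq
    obtain ⟨p, hp, hq⟩ := (PMF.mem_support_bind_iff _ _ _).1 hq
    exact (hκ' p hp).2.1 q hq
  · rw [run_append, h3, PMF.bind_map, PMF.map_bind]
    · exact PMF.bind_congr_support _ fun p hp => (hκ' p hp).2.2
    · intro c hc
      rw [h3, PMF.mem_support_map_iff] at hc
      obtain ⟨p, hp, rfl⟩ := hc
      exact ⟨rfl, (hex p hp).halts⟩

theorem Sem.cons {P : Prog} {ν' : α → PMF β} {R' : β → Store → Prop} (h : Sem O [P] s T ν R)
    (h' : ∀ a ∈ ν.support, ∀ s', R a s' → Sem O k' s' T' (ν' a) R') :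
    Sem O (P :: k') s (T + T') (ν.bind ν') R' := h.append h'

/-- The computation deterministically ends in the store `s'`. -/
def Det (O : PMF (List Bool)) (k : List Prog) (s : Store) (T : ℕ) (s' : Store) : Prop :=
  Sem O k s T (PMF.pure ()) fun _ x => x = s'

theorem Det.append (h : Det O k s T s') (h' : Sem O k' s' T' ν R) :
    Sem O (k ++ k') s (T + T') ν R := by
  have := Sem.append (ν' := fun _ => ν) (R' := R) (T' := T') h
    (fun _ _ x hx => by rw [hx]; exact h')
  simpa using this

theorem Det.cons {P : Prog} (h : Det O [P] s T s') (h' : Sem O k' s' T' ν R) :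
    Sem O (P :: k') s (T + T') ν R := Det.append h h'

theorem Det.nil : Det O [] s T s := Sem.nil rfl

theorem Sem.of_step_pure {c : Cfg} (hc : step O (k, s) = PMF.pure c)
    (h : Sem O c.1 c.2 T ν R) : Sem O k s (T + 1) ν R := by
  obtain ⟨κ, h1, h2, h3⟩ := h
  refine ⟨κ, h1, h2, ?_⟩
  rw [run_succ', hc, PMF.pure_bind, ← h3]

theorem Sem.push {b : Bool} {i : ℕ} (h : Sem O k (s.set i (b :: s.stack i)) T ν R) :
    Sem O (.instr (.push b i) :: k) s (T + 1) ν R :=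
  Sem.of_step_pure (c := (k, _)) (by simp only [step, Instr.exec, PMF.pure_map]; rfl) h

theorem Sem.pop {i : ℕ} (h : Sem O k (s.set i (s.stack i).tail) T ν R) :
    Sem O (.instr (.pop i) :: k) s (T + 1) ν R :=
  Sem.of_step_pure (c := (k, _)) (by simp only [step, Instr.exec, PMF.pure_map]; rfl) h

theorem Sem.qinit (h : Sem O k { s with reg := QState.zero } T ν R) :
    Sem O (.instr .qinit :: k) s (T + 1) ν R :=
  Sem.of_step_pure (c := (k, _)) (by simp only [step, Instr.exec, PMF.pure_map]) h

theorem Sem.seq {p q : Prog} (h : Sem O (p :: q :: k) s T ν R) :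
    Sem O (.seq p q :: k) s (T + 1) ν R :=
  Sem.of_step_pure (c := (_, s)) rfl h

theorem Sem.branch_nil {i : ℕ} {e f t : Prog} (hi : s.stack i = [])
    (h : Sem O (e :: k) s T ν R) : Sem O (.branch i e f t :: k) s (T + 1) ν R :=
  Sem.of_step_pure (c := (_, s)) (by simp [step, hi]) h

theorem Sem.branch_cons {i : ℕ} {e f t : Prog} {b : Bool} {w : List Bool}
    (hi : s.stack i = b :: w)
    (h : Sem O ((if b then t else f) :: k) s T ν R) : Sem O (.branch i e f t :: k) s (T + 1) ν R :=
  Sem.of_step_pure (c := (_, s)) (by cases b <;> simp [step, hi]) h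

theorem Sem.loop_nil {i : ℕ} {p : Prog} (hi : s.stack i = [])
    (h : Sem O k s T ν R) : Sem O (.loop i p :: k) s (T + 1) ν R :=
  Sem.of_step_pure (c := (_, s)) (by simp [step, hi]) h

theorem Sem.loop_cons {i : ℕ} {p : Prog} (hi : s.stack i ≠ [])
    (h : Sem O (p :: .loop i p :: k) s T ν R) : Sem O (.loop i p :: k) s (T + 1) ν R :=
  Sem.of_step_pure (c := (_, s))
    (by
      obtain ⟨b, w, hw⟩ := List.exists_cons_of_ne_nil hi
      simp [step, hw]) h

/-- `j` steps of a Markov chain. -/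
def iter (f : α → PMF α) : ℕ → α → PMF α
  | 0, a => PMF.pure a
  | j + 1, a => (f a).bind (iter f j)

/-- The invariant is indexed by the number of rounds still to come, and the premises force the loop
to stop exactly when this number is 0. Each round costs `T` for the body and 1 for the test of the
stack. -/
theorem Sem.loop {i : ℕ} {p : Prog} {f : α → PMF α} {R : ℕ → α → Store → Prop} {T : ℕ}
    (h0 : ∀ a s, R 0 a s → s.stack i = [])
    (h1 : ∀ j a s, R (j + 1) a s → s.stack i ≠ [] ∧ Sem O [p] s T (f a) (R j)) :
    ∀ j a s, R j a s → Sem O [.loop i p] s (j * (T + 1) + 1) (iter f j a) (R 0) := by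
  intro j
  induction j with
  | zero =>
    intro a s h
    exact (Sem.loop_nil (h0 a s h) (Sem.nil h)).mono (by omega) (T := 1)
  | succ j ih =>
    intro a s h
    obtain ⟨hi, hb⟩ := h1 j a s h
    refine (Sem.loop_cons hi (hb.cons fun a' _ s' hs' => ih a' s' hs')).mono ?_
    ring_nf; omega

end

section

variable {O : PMF (List Bool)}

/-! ## Stacks used by a program, relocation of stacks -/

theorem Store.set_stack (s : Store) (i j : ℕ) (w : List Bool) :
    (s.set i w).stack j = if j = i then w else s.stack j := by
  simp [Store.set, Function.update_apply]

theorem Store.ext' {s t : Store} (h : ∀ j, s.stack j = t.stack j) (hr : s.reg = t.reg) : s = t := by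
  cases s; cases t; simp only [Store.mk.injEq]; exact ⟨funext h, hr⟩

/-- All stacks mentioned by the instruction satisfy `S`. -/
def Instr.Stacks (S : ℕ → Prop) : Instr → Prop
  | .push _ i => S i
  | .pop i => S i
  | .coin i => S i
  | .query i => S i
  | .qinit => True
  | .hGate i => S i
  | .tGate i => S i
  | .cnot i j => S i ∧ S j
  | .measure i j => S i ∧ S j

/-- All stacks mentioned by the program satisfy `S`. -/
def Prog.Stacks (S : ℕ → Prop) : Prog → Prop
  | .instr a => a.Stacks S
  | .seq p q => p.Stacks S ∧ q.Stacks S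
  | .branch i e f t => S i ∧ e.Stacks S ∧ f.Stacks S ∧ t.Stacks S
  | .loop i p => S i ∧ p.Stacks S

theorem Instr.Stacks.mono {S S' : ℕ → Prop} (h : ∀ i, S i → S' i) {a : Instr}
    (ha : a.Stacks S) : a.Stacks S' := by
  cases a <;> simp only [Instr.Stacks] at ha ⊢ <;> first | exact h _ ha | exact ⟨h _ ha.1, h _ ha.2⟩

theorem Prog.Stacks.mono {S S' : ℕ → Prop} (h : ∀ i, S i → S' i) :
    ∀ {P : Prog}, P.Stacks S → P.Stacks S'
  | .instr _, hP => Instr.Stacks.mono h hP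
  | .seq _ _, hP => ⟨hP.1.mono h, hP.2.mono h⟩
  | .branch _ _ _ _, hP => ⟨h _ hP.1, hP.2.1.mono h, hP.2.2.1.mono h, hP.2.2.2.mono h⟩
  | .loop _ _, hP => ⟨h _ hP.1, hP.2.mono h⟩

/-- The evaluator is an arbitrary program; this tells how many stacks must be wiped before it can be
called again. -/
theorem Prog.exists_bound (P : Prog) : ∃ b, P.Stacks (· < b) := by
  have hm {b b' : ℕ} (h : b ≤ b') {Q : Prog} (hQ : Q.Stacks (· < b)) : Q.Stacks (· < b') :=
    hQ.mono fun _ hi => lt_of_lt_of_le hi h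
  induction P with
  | instr a =>
    cases a with
    | qinit => exact ⟨0, trivial⟩
    | cnot i j => exact ⟨i + j + 1, by simp only [Prog.Stacks, Instr.Stacks]; omega⟩
    | measure i j => exact ⟨i + j + 1, by simp only [Prog.Stacks, Instr.Stacks]; omega⟩
    | _ => rename_i i; exact ⟨i + 1, Nat.lt_succ_self i⟩
  | seq p q hp hq =>
    obtain ⟨a, ha⟩ := hp
    obtain ⟨b, hb⟩ := hq
    exact ⟨a + b, hm (by omega) ha, hm (by omega) hb⟩
  | branch i e f t he hf ht =>
    obtain ⟨a, ha⟩ := he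
    obtain ⟨b, hb⟩ := hf
    obtain ⟨c, hc⟩ := ht
    exact ⟨i + 1 + a + b + c, by omega, hm (by omega) ha, hm (by omega) hb, hm (by omega) hc⟩
  | loop i p hp =>
    obtain ⟨a, ha⟩ := hp
    exact ⟨i + 1 + a, by omega, hm (by omega) ha⟩

/-! ### Invariants of computations -/

/-- A property of programs inherited by the subprograms that remain to be executed. -/
structure Hereditary (H : Prog → Prop) : Prop where
  seq : ∀ p q, H (.seq p q) → H p ∧ H q
  branch : ∀ i e f t, H (.branch i e f t) → H e ∧ H f ∧ H t
  loop : ∀ i p, H (.loop i p) → H p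

theorem hereditary_all (S : Instr → Prop) : Hereditary (Prog.All S) :=
  ⟨fun _ _ h => h, fun _ _ _ _ h => h, fun _ _ h => h⟩

theorem hereditary_stacks (S : ℕ → Prop) : Hereditary (Prog.Stacks S) :=
  ⟨fun _ _ h => h, fun _ _ _ _ h => h.2, fun _ _ h => h.2⟩

theorem Hereditary.step {H : Prog → Prop} (hH : Hereditary H) {c c' : Cfg}
    (hc : ∀ P ∈ c.1, H P) (h : c' ∈ (step O c).support) : ∀ P ∈ c'.1, H P := by
  obtain ⟨k, s⟩ := c
  cases k with
  | nil =>
    simp only [PAC.step, PMF.support_pure, Set.mem_singleton_iff] at h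
    subst h; exact hc
  | cons P k =>
    have hk : ∀ P ∈ k, H P := fun P hP => hc P (List.mem_cons_of_mem _ hP)
    have hP : H P := hc P List.mem_cons_self
    cases P with
    | instr a =>
      simp only [PAC.step, PMF.mem_support_map_iff] at h
      obtain ⟨_, -, rfl⟩ := h
      exact hk
    | seq p q =>
      simp only [PAC.step, PMF.support_pure, Set.mem_singleton_iff] at h
      subst h
      simpa using ⟨(hH.seq _ _ hP).1, (hH.seq _ _ hP).2, hk⟩
    | branch i e f t =>
      have := hH.branch _ _ _ _ hP
      simp only [PAC.step] at h
      split at h <;> simp only [PMF.support_pure, Set.mem_singleton_iff] at h <;> subst h <;>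
        simp only [List.mem_cons, forall_eq_or_imp] <;> tauto
    | loop i p =>
      have := hH.loop _ _ hP
      simp only [PAC.step] at h
      split at h <;> simp only [PMF.support_pure, Set.mem_singleton_iff] at h <;> subst h <;>
        simp only [List.mem_cons, forall_eq_or_imp] <;> tauto

/-- An invariant of the instructions in `c` is an invariant of the computation. -/
theorem run_invariant {H : Prog → Prop} (hH : Hereditary H) {I : ℕ → Store → Prop}
    (hI : ∀ T s, I T s → I (T + 1) s)
    (hexec : ∀ a, H (.instr a) → ∀ T s, I T s → ∀ s' ∈ (a.exec O s).support, I (T + 1) s')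
    {c : Cfg} (hc : ∀ P ∈ c.1, H P) (h0 : I 0 c.2) :
    ∀ T, ∀ c' ∈ (run O c T).support, (∀ P ∈ c'.1, H P) ∧ I T c'.2 := by
  intro T
  induction T with
  | zero =>
    intro c' hc'
    simp only [run, PMF.support_pure, Set.mem_singleton_iff] at hc'
    subst hc'; exact ⟨hc, h0⟩
  | succ T ih =>
    intro c'' h''
    obtain ⟨c', hc', h''⟩ := (PMF.mem_support_bind_iff _ _ _).1 h''
    obtain ⟨hk, hs⟩ := ih c' hc'
    refine ⟨hH.step hk h'', ?_⟩
    obtain ⟨k, s⟩ := c'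
    cases k with
    | nil =>
      simp only [PAC.step, PMF.support_pure, Set.mem_singleton_iff] at h''
      subst h''; exact hI _ _ hs
    | cons P k =>
      cases P with
      | instr a =>
        simp only [PAC.step, PMF.mem_support_map_iff] at h''
        obtain ⟨s', hs', rfl⟩ := h''
        exact hexec a (hk _ List.mem_cons_self) T s hs s' hs'
      | seq p q =>
        simp only [PAC.step, PMF.support_pure, Set.mem_singleton_iff] at h''
        subst h''; exact hI _ _ hs
      | branch i e f t =>
        simp only [PAC.step] at h''
        split at h'' <;> simp only [PMF.support_pure, Set.mem_singleton_iff] at h'' <;> subst h'' <;>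
          exact hI _ _ hs
      | loop i p =>
        simp only [PAC.step] at h''
        split at h'' <;> simp only [PMF.support_pure, Set.mem_singleton_iff] at h'' <;> subst h'' <;>
          exact hI _ _ hs

theorem Instr.exec_length_le {a : Instr} {s s' : Store} {b : ℕ}
    (hO : ∀ w ∈ O.support, w.length ≤ b) (hs : ∀ j, (s.stack j).length ≤ b)
    (h : s' ∈ (a.exec O s).support) (j : ℕ) : (s'.stack j).length ≤ b + 1 := by
  have hj := hs j
  cases a <;> simp only [Instr.exec, PMF.support_pure, Set.mem_singleton_iff,
    PMF.mem_support_map_iff] at h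
  case coin i =>
    obtain ⟨c, -, rfl⟩ := h
    have := hs i
    rw [Store.set_stack]
    split <;> simp <;> omega
  case query i =>
    obtain ⟨w, hw, rfl⟩ := h
    have := hO w hw
    rw [Store.set_stack]
    split <;> simp <;> omega
  case measure i i' =>
    obtain ⟨c, -, rfl⟩ := h
    have := hs i'
    rw [Store.set_stack]
    split <;> simp <;> omega
  case push c i =>
    subst h
    have := hs i
    rw [Store.set_stack]
    split <;> simp <;> omega
  case pop i =>
    subst h
    have := hs i
    rw [Store.set_stack]
    split <;> simp <;> omega
  all_goals subst h; simp only; omega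

/-- A step lengthens a stack by at most one bit, except that a query installs an answer of length at
most `b`. This bounds the cost of wiping the workspace and, later, the length of a learned
specification. -/
theorem run_length_le {c : Cfg} {b : ℕ} (hO : ∀ w ∈ O.support, w.length ≤ b)
    (hs : ∀ j, (c.2.stack j).length ≤ b) {T : ℕ} {c' : Cfg} (h : c' ∈ (run O c T).support) (j : ℕ) :
    (c'.2.stack j).length ≤ b + T := by
  have := run_invariant (H := fun _ => True) (O := O) (c := c) ⟨by simp, by simp, by simp⟩
    (I := fun T s => ∀ j, (s.stack j).length ≤ b + T)
    (fun T s h j => (h j).trans (by omega))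
    (fun a _ T s h s' hs' j => Instr.exec_length_le (b := b + T)
      (fun w hw => (hO w hw).trans (by omega)) h hs' j) (by simp) hs
  exact (this T c' h).2 j

theorem Instr.exec_stack_eq {S : ℕ → Prop} {a : Instr} {s s' : Store} (ha : a.Stacks S)
    (h : s' ∈ (a.exec O s).support) {j : ℕ} (hj : ¬ S j) : s'.stack j = s.stack j := by
  cases a <;> simp only [Instr.exec, PMF.support_pure, Set.mem_singleton_iff,
    PMF.mem_support_map_iff, Instr.Stacks] at h ha
  case coin i =>
    obtain ⟨c, -, rfl⟩ := h
    rw [Store.set_stack, if_neg (by rintro rfl; exact hj ha)]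
  case query i =>
    obtain ⟨w, hw, rfl⟩ := h
    rw [Store.set_stack, if_neg (by rintro rfl; exact hj ha)]
  case measure i i' =>
    obtain ⟨c, -, rfl⟩ := h
    rw [Store.set_stack, if_neg (by rintro rfl; exact hj ha.2)]
  case push c i =>
    subst h
    rw [Store.set_stack, if_neg (by rintro rfl; exact hj ha)]
  case pop i =>
    subst h
    rw [Store.set_stack, if_neg (by rintro rfl; exact hj ha)]
  all_goals subst h; rfl

theorem run_stack_eq {S : ℕ → Prop} {c : Cfg} (hc : ∀ P ∈ c.1, P.Stacks S) {T : ℕ} {c' : Cfg}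
    (h : c' ∈ (run O c T).support) {j : ℕ} (hj : ¬ S j) : c'.2.stack j = c.2.stack j := by
  have := run_invariant (hereditary_stacks S) (O := O) (c := c)
    (I := fun _ s => s.stack j = c.2.stack j)
    (fun T s h => h)
    (fun a ha T s h s' hs' => (Instr.exec_stack_eq ha hs' hj).trans h) hc rfl
  exact (this T c' h).2

/-! ### Relocated programs as subroutines -/

/-- Replace stack `i` by stack `i + K`. -/
def Instr.shift (K : ℕ) : Instr → Instr
  | .push b i => .push b (i + K)
  | .pop i => .pop (i + K)
  | .coin i => .coin (i + K)
  | .query i => .query (i + K)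
  | .qinit => .qinit
  | .hGate i => .hGate (i + K)
  | .tGate i => .tGate (i + K)
  | .cnot i j => .cnot (i + K) (j + K)
  | .measure i j => .measure (i + K) (j + K)

/-- Replace stack `i` by stack `i + K`. -/
def Prog.shift (K : ℕ) : Prog → Prog
  | .instr a => .instr (a.shift K)
  | .seq p q => .seq (p.shift K) (q.shift K)
  | .branch i e f t => .branch (i + K) (e.shift K) (f.shift K) (t.shift K)
  | .loop i p => .loop (i + K) (p.shift K)

theorem Prog.All.shift {S : Instr → Prop} {K : ℕ} (hS : ∀ a, S a → S (a.shift K)) :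
    ∀ {P : Prog}, P.All S → (P.shift K).All S
  | .instr _, hP => hS _ hP
  | .seq _ _, hP => ⟨hP.1.shift hS, hP.2.shift hS⟩
  | .branch _ _ _ _, hP => ⟨hP.1.shift hS, hP.2.1.shift hS, hP.2.2.shift hS⟩
  | .loop _ p, hP => Prog.All.shift (P := p) hS hP

theorem Prog.stacks_shift (K : ℕ) : ∀ P : Prog, (P.shift K).Stacks (K ≤ ·)
  | .instr a => by cases a <;> simp [Prog.shift, Instr.shift, Prog.Stacks, Instr.Stacks]
  | .seq p q => ⟨p.stacks_shift K, q.stacks_shift K⟩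
  | .branch i e f t =>
    ⟨Nat.le_add_left _ _, e.stacks_shift K, f.stacks_shift K, t.stacks_shift K⟩
  | .loop i p => ⟨Nat.le_add_left _ _, p.stacks_shift K⟩

/-- The stacks below `K` come from `b`, the others and the register from `t`. -/
def Store.embed (K : ℕ) (b : ℕ → List Bool) (t : Store) : Store where
  stack j := if j < K then b j else t.stack (j - K)
  reg := t.reg

theorem Store.embed_stack_add (K : ℕ) (b : ℕ → List Bool) (t : Store) (i : ℕ) :
    (t.embed K b).stack (i + K) = t.stack i := by
  simp [Store.embed]

theorem Store.embed_set (K : ℕ) (b : ℕ → List Bool) (t : Store) (i : ℕ) (w : List Bool) :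
    (t.set i w).embed K b = (t.embed K b).set (i + K) w := by
  refine Store.ext' (fun j => ?_) rfl
  simp only [Store.embed, Store.set_stack]
  by_cases hj : j < K
  · simp [hj, show j ≠ i + K by omega]
  · simp [hj, show j - K = i ↔ j = i + K by omega]

/-- The two oracles may differ because no query is made: the evaluator is specified with `noOracle`
but is called by a learner that has an example oracle. -/
theorem Instr.exec_shift (K : ℕ) (b : ℕ → List Bool) {a : Instr} (ha : ¬ a.IsQuery) (t : Store) :
    (a.shift K).exec O (t.embed K b) = (a.exec noOracle t).map (Store.embed K b) := by
  cases a <;> simp only [Instr.shift, Instr.exec, PMF.pure_map, PMF.map_comp,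
    Store.embed_stack_add, Store.embed_set, Function.comp_def]
  case query => exact absurd trivial ha
  all_goals rfl

theorem step_shift (K : ℕ) (b : ℕ → List Bool) {c : Cfg}
    (hc : ∀ P ∈ c.1, P.All fun a => ¬ a.IsQuery) :
    step O (c.1.map (Prog.shift K), c.2.embed K b) =
      (step noOracle c).map fun c => (c.1.map (Prog.shift K), c.2.embed K b) := by
  obtain ⟨k, s⟩ := c
  cases k with
  | nil => simp [step, PMF.pure_map]
  | cons P k =>
    have hP := hc P List.mem_cons_self
    cases P with
    | instr a =>
      simp only [List.map_cons, Prog.shift, step, Instr.exec_shift K b (a := a) hP, PMF.map_comp,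
        Function.comp_def]
    | seq p q => simp [step, PMF.pure_map, Prog.shift]
    | branch i e f t =>
      simp only [List.map_cons, Prog.shift, step, Store.embed_stack_add]
      split <;> simp [PMF.pure_map]
    | loop i p =>
      simp only [List.map_cons, Prog.shift, step, Store.embed_stack_add]
      split <;> simp [PMF.pure_map, Prog.shift]

theorem run_shift (K : ℕ) (b : ℕ → List Bool) (T : ℕ) : ∀ {c : Cfg},
    (∀ P ∈ c.1, P.All fun a => ¬ a.IsQuery) →
    run O (c.1.map (Prog.shift K), c.2.embed K b) T =
      (run noOracle c T).map fun c => (c.1.map (Prog.shift K), c.2.embed K b) := by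
  induction T with
  | zero => intro c _; simp [run, PMF.pure_map]
  | succ T ih =>
    intro c hc
    rw [run_succ', run_succ', step_shift K b hc, PMF.bind_map, PMF.map_bind]
    exact PMF.bind_congr_support _ fun c' hc' => ih ((hereditary_all _).step hc hc')

/-- The Boolean answer read off an output string. -/
def answer (w : List Bool) : Bool := w.headD false

/-- The distribution of the answer of `E` within `T` steps. -/
def answerDist (E : Prog) (ins : List (List Bool)) (T : ℕ) : PMF Bool :=
  (run noOracle ([E], Store.init ins) T).map fun c => answer (c.2.stack 0)

theorem Store.init_length_le (ins : List (List Bool)) (j : ℕ) :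
    ((Store.init ins).stack j).length ≤ (ins.map List.length).sum := by
  simp only [Store.init, List.getD_eq_getElem?_getD]
  by_cases hj : j < ins.length
  · rw [List.getElem?_eq_getElem hj]
    exact List.le_sum_of_mem (List.mem_map.2 ⟨_, List.getElem_mem hj, rfl⟩)
  · rw [List.getElem?_eq_none (by omega)]
    simp

/-- Calling a program as a subroutine on the stacks from `K` on. -/
theorem Sem.call {E : Prog} (hE : E.All fun a => ¬ a.IsQuery) {b : ℕ} (hb : E.Stacks (· < b))
    {ins : List (List Bool)} (hins : ins.length ≤ b) {T : ℕ} (hT : E.HaltsWithin noOracle ins T)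
    {K : ℕ} {s : Store} (hs : ∀ j, s.stack (j + K) = ins.getD j []) (hr : s.reg = QState.zero) :
    Sem O [E.shift K] s T (answerDist E ins T) fun a s' =>
      (∀ j < K, s'.stack j = s.stack j) ∧ answer (s'.stack K) = a ∧
      (∀ j, (s'.stack (j + K)).length ≤ (ins.map List.length).sum + T) ∧
      ∀ j, b ≤ j → s'.stack (j + K) = [] := by
  have hse : s = (Store.init ins).embed K s.stack := by
    refine Store.ext' (fun j => ?_) hr
    simp only [Store.embed]
    split
    · rfl
    · obtain ⟨d, rfl⟩ := Nat.exists_eq_add_of_le (Nat.le_of_not_lt ‹_›)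
      rw [add_comm, hs]; simp [Store.init]
  refine ⟨(run noOracle ([E], Store.init ins) T).map fun c =>
    (answer (c.2.stack 0), c.2.embed K s.stack), ?_, ?_, ?_⟩
  · rw [PMF.map_comp]; rfl
  · intro p hp
    obtain ⟨c, hc, rfl⟩ := (PMF.mem_support_map_iff _ _ _).1 hp
    simp only [Store.embed_stack_add]
    refine ⟨fun j hj => by simp [Store.embed, hj], by simp [Store.embed], fun j => ?_,
      fun j hj => ?_⟩
    · exact run_length_le (by simp [noOracle]) (Store.init_length_le ins) hc j
    · rw [run_stack_eq (S := (· < b)) (by simpa using hb) hc (by omega)]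
      simp [Store.init, List.getD_eq_getElem?_getD, List.getElem?_eq_none (hins.trans hj)]
  · have := run_shift (O := O) K s.stack T (c := ([E], Store.init ins)) (by simpa using hE)
    simp only [List.map_cons, List.map_nil] at this
    rw [← hse] at this
    rw [this, PMF.map_comp]
    refine PMF.map_congr_support _ fun c hc => ?_
    simp [hT c hc]

end

section

variable {O : PMF (List Bool)}

theorem Sem.map {k : List Prog} {s : Store} {T : ℕ} {α β : Type} {ν : PMF α}
    {R : α → Store → Prop} {R' : β → Store → Prop} (g : α → β) (h : Sem O k s T ν R)
    (hR : ∀ a ∈ ν.support, ∀ s', R a s' → R' (g a) s') : Sem O k s T (ν.map g) R' := by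
  have := h.append (k' := []) (T' := 0) (ν' := fun a => PMF.pure (g a)) (R' := R')
    fun a ha s' hs' => Sem.nil (hR a ha s' hs')
  rw [← PMF.bind_pure_comp]
  rw [List.append_nil] at this
  exact this

theorem Store.set_self {s : Store} {i : ℕ} {w : List Bool} (h : s.stack i = w) : s.set i w = s :=
  Store.ext' (fun j => by rw [Store.set_stack]; split <;> simp_all) rfl

theorem Det.conv {k : List Prog} {s s' s'' : Store} {T T' : ℕ} (h : Det O k s T s') (hT : T ≤ T')
    (hs : s' = s'') : Det O k s T' s'' := hs ▸ Sem.mono h hT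

/-! ## Deterministic subroutines -/

/-- Move the top of stack `i` to stack `j`. -/
def mv (i j : ℕ) : Prog :=
  .branch i (.instr (.pop i)) (.seq (.instr (.pop i)) (.instr (.push false j)))
    (.seq (.instr (.pop i)) (.instr (.push true j)))

theorem sem_mv {i j : ℕ} (hij : i ≠ j) {k : List Prog} {s : Store} {T : ℕ} {α : Type} {ν : PMF α}
    {R : α → Store → Prop} {a : Bool} {w : List Bool} (hi : s.stack i = a :: w)
    (h : Sem O k ((s.set i w).set j (a :: s.stack j)) T ν R) :
    Sem O (mv i j :: k) s (T + 4) ν R := by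
  refine Sem.branch_cons hi ?_
  cases a <;> refine Sem.seq (Sem.pop (Sem.push ?_)) <;>
    simpa [Store.set_stack, hi, hij.symm] using h

/-- Move the content of stack `i` to stack `j`, in reverse order. -/
def moveRev (i j : ℕ) : Prog := .loop i (mv i j)

theorem det_moveRev {i j : ℕ} (hij : i ≠ j) : ∀ {w : List Bool} {s : Store}, s.stack i = w →
    Det O [moveRev i j] s (5 * w.length + 1) ((s.set i []).set j (w.reverse ++ s.stack j)) := by
  intro w
  induction w with
  | nil =>
    intro s h
    refine Sem.loop_nil h ?_
    rw [Store.set_self h, Store.set_self (by simp)]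
    exact Det.nil
  | cons a w ih =>
    intro s h
    refine (Sem.loop_cons (by simp [h]) (sem_mv hij h ?_)).mono (T := 5 * w.length + 1 + 4 + 1)
      (by simp; omega)
    have := ih (s := (s.set i w).set j (a :: s.stack j)) (by simp [Store.set_stack, hij])
    refine this.conv le_rfl ?_
    refine Store.ext' (fun l => ?_) rfl
    simp only [Store.set_stack, List.reverse_cons, List.append_assoc, List.singleton_append]
    split_ifs <;> simp_all

/-- Move the content of stack `t` to both stacks `i` and `j`, in reverse order. -/
def spread (t i j : ℕ) : Prog :=
  .loop t (.branch t (.instr (.pop t))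
    (.seq (.instr (.pop t)) (.seq (.instr (.push false i)) (.instr (.push false j))))
    (.seq (.instr (.pop t)) (.seq (.instr (.push true i)) (.instr (.push true j)))))

theorem det_spread {t i j : ℕ} (hti : t ≠ i) (htj : t ≠ j) (hij : i ≠ j) :
    ∀ {w : List Bool} {s : Store}, s.stack t = w →
    Det O [spread t i j] s (7 * w.length + 1)
      (((s.set t []).set i (w.reverse ++ s.stack i)).set j (w.reverse ++ s.stack j)) := by
  intro w
  induction w with
  | nil =>
    intro s h
    refine Sem.loop_nil h ?_
    rw [Store.set_self h, Store.set_self (i := i) (by simp), Store.set_self (by simp)]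
    exact Det.nil
  | cons a w ih =>
    intro s h
    have := ih (s := ((s.set t w).set i (a :: s.stack i)).set j (a :: s.stack j))
      (by simp [Store.set_stack, hti, htj])
    refine (Sem.loop_cons (by simp [h]) (Sem.branch_cons h (T := 7 * w.length + 1 + 5) ?_)).mono
      (T := 7 * w.length + 1 + 7) (by simp; omega)
    have key : Det O [spread t i j]
        (((s.set t w).set i (a :: s.stack i)).set j (a :: s.stack j)) (7 * w.length + 1)
        (((s.set t []).set i ((a :: w).reverse ++ s.stack i)).set j
          ((a :: w).reverse ++ s.stack j)) := by
      refine this.conv le_rfl ?_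
      refine Store.ext' (fun l => ?_) rfl
      simp only [Store.set_stack, List.reverse_cons, List.append_assoc, List.singleton_append]
      split_ifs <;> simp_all
    cases a <;> refine Sem.seq (Sem.pop (Sem.seq (Sem.push (Sem.push ?_)))) <;>
      simpa [Store.set_stack, h, hti.symm, htj.symm, hij.symm, spread, Det] using key

/-- Copy stack `i` onto stack `j`, using the empty stack `t`. -/
def copy (i t j : ℕ) : Prog := .seq (moveRev i t) (spread t i j)

theorem det_copy {i t j : ℕ} (hti : t ≠ i) (htj : t ≠ j) (hij : i ≠ j) {s : Store}
    (ht : s.stack t = []) :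
    Det O [copy i t j] s (12 * (s.stack i).length + 3) (s.set j (s.stack i ++ s.stack j)) := by
  have h1 := det_moveRev (O := O) hti.symm (s := s) rfl
  have h2 := det_spread (O := O) hti htj hij
    (s := (s.set i []).set t ((s.stack i).reverse ++ s.stack t)) rfl
  refine Det.conv (Sem.seq (h1.cons h2)) (by simp [Store.set_stack, ht]; omega) ?_
  refine Store.ext' (fun l => ?_) rfl
  simp only [Store.set_stack, ht]
  split_ifs <;> simp_all

/-- Empty stack `i`. -/
def clear (i : ℕ) : Prog := .loop i (.instr (.pop i))

theorem det_clear {i : ℕ} : ∀ {w : List Bool} {s : Store}, s.stack i = w →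
    Det O [clear i] s (2 * w.length + 1) (s.set i []) := by
  intro w
  induction w with
  | nil =>
    intro s h
    refine Sem.loop_nil h ?_
    rw [Store.set_self h]
    exact Det.nil
  | cons a w ih =>
    intro s h
    refine (Sem.loop_cons (by simp [h]) (Sem.pop ?_)).mono (T := 2 * w.length + 1 + 1 + 1)
      (by simp; omega)
    have := ih (s := s.set i w) (by simp [Store.set_stack])
    rw [h]
    refine this.conv le_rfl ?_
    refine Store.ext' (fun l => ?_) rfl
    simp only [Store.set_stack]
    split_ifs <;> simp_all

/-- Empty the stacks `K, …, K + b`. -/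
def clearRange (K : ℕ) : ℕ → Prog
  | 0 => clear K
  | b + 1 => .seq (clearRange K b) (clear (b + 1 + K))

theorem det_clearRange {K L : ℕ} : ∀ {b : ℕ} {s : Store},
    (∀ j, (s.stack (j + K)).length ≤ L) →
    Det O [clearRange K b] s ((b + 1) * (2 * L + 2))
      ⟨fun j => if K ≤ j ∧ j ≤ b + K then [] else s.stack j, s.reg⟩ := by
  intro b
  induction b with
  | zero =>
    intro s h
    have h0 := h 0
    simp only [zero_add] at h0
    refine (det_clear (i := K) rfl).conv (by omega) ?_
    refine Store.ext' (fun l => ?_) rfl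
    simp only [Store.set_stack, show (K ≤ l ∧ l ≤ 0 + K) ↔ l = K by omega]
  | succ b ih =>
    intro s h
    have h0 := h (b + 1)
    refine Det.conv (Sem.seq ((ih h).cons (det_clear (i := b + 1 + K) rfl))) ?_ ?_
    · simp only [show ¬ (K ≤ b + 1 + K ∧ b + 1 + K ≤ b + K) by omega, if_false]
      ring_nf at h0 ⊢
      omega
    · refine Store.ext' (fun l => ?_) rfl
      simp only [Store.set_stack]
      by_cases hl : l = b + 1 + K
      · rw [if_pos hl, if_pos (by omega)]
      · rw [if_neg hl]
        by_cases h' : K ≤ l ∧ l ≤ b + K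
        · rw [if_pos h', if_pos (by omega)]
        · rw [if_neg h', if_neg (by omega)]

/-! ## Majority votes -/

/-- A signed counter of votes, in unary: all its elements equal the current majority. -/
def voteStep (a : Bool) : List Bool → List Bool
  | [] => [a]
  | c :: v => if c = a then a :: c :: v else v

theorem length_voteStep_le (a : Bool) (v : List Bool) :
    (voteStep a v).length ≤ v.length + 1 := by
  cases v with
  | nil => simp [voteStep]
  | cons c v => simp only [voteStep]; split <;> simp; omega

/-- The majority among `k` independent votes. -/
def majDist (π : PMF Bool) (k : ℕ) : PMF Bool :=
  (iter (fun v => π.map fun a => voteStep a v) k []).map answer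

/-- Count the vote `a` on stack `i`. -/
def castVote (i : ℕ) (a : Bool) : Prog :=
  .branch i (.instr (.push a i)) (.instr (if a then .pop i else .push a i))
    (.instr (if a then .push a i else .pop i))

theorem det_castVote {i : ℕ} {a : Bool} {s : Store} :
    Det O [castVote i a] s 2 (s.set i (voteStep a (s.stack i))) := by
  cases hi : s.stack i with
  | nil =>
    refine Sem.branch_nil hi (Sem.push (T := 0) ?_)
    rw [hi]; exact Sem.nil rfl
  | cons c v =>
    refine Sem.branch_cons hi ?_
    cases a <;> cases c <;>
      first
      | (refine Sem.push (T := 0) ?_; rw [hi]; exact Sem.nil rfl)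
      | (refine Sem.pop (T := 0) ?_; rw [hi]; exact Sem.nil rfl)

/-- The stacks used by the subroutine: `b` many from stack 16 on, of length at most `L`. -/
def Workspace (b L : ℕ) (s : Store) : Prop :=
  (∀ j, (s.stack (j + 16)).length ≤ L) ∧ ∀ j, b ≤ j → s.stack (j + 16) = []

/-- Run `E` on the contents of stacks 3 and 4, and count its answer as a vote on stack 6. -/
def ballot (E : Prog) (b : ℕ) : Prog :=
  .seq (clearRange 16 b) <| .seq (copy 3 7 16) <| .seq (copy 4 7 17) <| .seq (.instr .qinit) <|
    .seq (E.shift 16) <| .branch 16 (castVote 6 false) (castVote 6 false) (castVote 6 true)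

/-- The majority among the answers of runs of `E` on the contents of stacks 3 and 4, one for every
element of stack 5. -/
def majority (E : Prog) (b : ℕ) : Prog := .loop 5 (.seq (.instr (.pop 5)) (ballot E b))

/-- Wiping the workspace and resetting the register make every call of `E` start from the same
initial store, so that successive votes are independent. `Workspace` bounds what a call leaves
behind, hence the cost of the next wiping. -/
theorem sem_ballot {E : Prog} (hE : E.All fun a => ¬ a.IsQuery) {b : ℕ} (hb : E.Stacks (· < b))
    (hb2 : 2 ≤ b) {L T : ℕ} {s : Store}
    (hT : E.HaltsWithin noOracle [s.stack 3, s.stack 4] T)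
    (hL : (s.stack 3).length + (s.stack 4).length + T ≤ L)
    (h7 : s.stack 7 = []) (hw : Workspace b L s) :
    Sem O [ballot E b] s ((b + 20) * (2 * L + 2))
      ((answerDist E [s.stack 3, s.stack 4] T).map fun a => voteStep a (s.stack 6))
      fun v s' => s'.stack 6 = v ∧ (∀ j < 16, j ≠ 6 → s'.stack j = s.stack j) ∧
        Workspace b L s' := by
  set x := s.stack 3 with hx
  set w := s.stack 4 with hw'
  set s1 : Store := ⟨fun j => if 16 ≤ j ∧ j ≤ b + 16 then [] else s.stack j, s.reg⟩ with hs1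
  have e3 : s1.stack 3 = x := by simp [hs1, hx]
  have e4 : s1.stack 4 = w := by simp [hs1, hw']
  have e7 : s1.stack 7 = [] := by simp [hs1, h7]
  have e16 : s1.stack 16 = [] := by simp [hs1]
  have e17 : s1.stack 17 = [] := by simp [hs1]; omega
  set s2 := s1.set 16 x with hs2
  set s3 := s2.set 17 w with hs3
  set s4 : Store := { s3 with reg := QState.zero } with hs4
  have d1 : Det O [clearRange 16 b] s ((b + 1) * (2 * L + 2)) s1 := det_clearRange hw.1
  have d2 : Det O [copy 3 7 16] s1 (12 * x.length + 3) s2 := by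
    have := det_copy (O := O) (i := 3) (t := 7) (j := 16) (by decide) (by decide) (by decide) e7
    rwa [e3, e16, List.append_nil] at this
  have d3 : Det O [copy 4 7 17] s2 (12 * w.length + 3) s3 := by
    have := det_copy (O := O) (s := s2) (i := 4) (t := 7) (j := 17) (by decide) (by decide)
      (by decide) (by simp [hs2, Store.set_stack, e7])
    simpa [hs2, Store.set_stack, e4, e17, ← hs3] using this
  have hj : ∀ j, s4.stack (j + 16) = [x, w].getD j [] := by
    intro j
    have : s4.stack (j + 16) = (s3.stack (j + 16)) := rfl
    rw [this, hs3, Store.set_stack, hs2, Store.set_stack]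
    rcases j with _ | _ | j
    · simp
    · simp
    -- Beyond the two inputs a stack has either been wiped or lies out of reach of `E` and was never
    -- filled.
    · simp only [hs1, show j + 1 + 1 + 16 ≠ 17 by omega, show j + 1 + 1 + 16 ≠ 16 by omega, if_false]
      by_cases h : j + 1 + 1 ≤ b
      · rw [if_pos (by omega)]; simp
      · rw [if_neg (by omega), hw.2 _ (by omega)]; simp
  have d5 := Sem.call (O := O) hE hb (ins := [x, w]) hb2 hT (K := 16) (s := s4) hj rfl
  have h4 : ∀ j < 16, s4.stack j = s.stack j := by
    intro j hj
    have : s4.stack j = s3.stack j := rfl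
    rw [this, hs3, Store.set_stack, hs2, Store.set_stack, if_neg (by omega), if_neg (by omega)]
    simp only [hs1]
    rw [if_neg (by omega)]
  -- An empty output counts as a vote for `false`, in accordance with the default value in `answer`.
  have d6 : ∀ a : Bool, ∀ s5 : Store, answer (s5.stack 16) = a → s5.stack 6 = s.stack 6 →
      Det O [.branch 16 (castVote 6 false) (castVote 6 false) (castVote 6 true)] s5 3
        (s5.set 6 (voteStep a (s.stack 6))) := by
    rintro a s5 rfl h6
    rw [← h6]
    cases h16 : s5.stack 16 with
    | nil => exact Sem.branch_nil h16 det_castVote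
    | cons c u =>
      refine Sem.branch_cons h16 ?_
      cases c
      · exact det_castVote
      · exact det_castVote
  have d7 : Sem O [E.shift 16,
      .branch 16 (castVote 6 false) (castVote 6 false) (castVote 6 true)] s4 (T + 3)
      ((answerDist E [x, w] T).bind fun a => PMF.pure (voteStep a (s.stack 6)))
      fun v s' => s'.stack 6 = v ∧ (∀ j < 16, j ≠ 6 → s'.stack j = s.stack j) ∧
        Workspace b L s' := by
    refine d5.cons ?_
    rintro a - s5 ⟨h5, h5a, h5l, h5e⟩
    refine (d6 a s5 h5a ((h5 6 (by decide)).trans (h4 6 (by decide)))).map (fun _ => voteStep a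
      (s.stack 6)) ?_ |> fun h => by simpa [PMF.pure_map] using h
    rintro - - s' rfl
    refine ⟨by simp [Store.set_stack], fun j hj hj6 => ?_, fun j => ?_, fun j hj => ?_⟩
    · rw [Store.set_stack, if_neg hj6, h5 j hj, h4 j hj]
    · rw [Store.set_stack, if_neg (by omega)]
      refine (h5l j).trans ?_
      simpa using hL
    · rw [Store.set_stack, if_neg (by omega)]
      exact h5e j hj
  rw [← PMF.bind_pure_comp]
  refine (Sem.seq (d1.cons (Sem.seq (d2.cons (Sem.seq (d3.cons (Sem.seq (Sem.qinit
    (Sem.seq d7))))))))).mono ?_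
  ring_nf
  have : 0 ≤ b * L := Nat.zero_le _
  omega

theorem sem_majority {E : Prog} (hE : E.All fun a => ¬ a.IsQuery) {b : ℕ} (hb : E.Stacks (· < b))
    (hb2 : 2 ≤ b) {L T : ℕ} {s : Store}
    (hT : E.HaltsWithin noOracle [s.stack 3, s.stack 4] T)
    (hL : (s.stack 3).length + (s.stack 4).length + T ≤ L)
    (h6 : s.stack 6 = []) (h7 : s.stack 7 = []) (hw : Workspace b L s) :
    Sem O [majority E b] s ((s.stack 5).length * ((b + 20) * (2 * L + 2) + 3) + 1)
      (majDist (answerDist E [s.stack 3, s.stack 4] T) (s.stack 5).length)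
      fun a s' => answer (s'.stack 6) = a ∧ s'.stack 5 = [] ∧
        (s'.stack 6).length ≤ (s.stack 5).length ∧
        (∀ j < 16, j ≠ 5 → j ≠ 6 → s'.stack j = s.stack j) ∧ Workspace b L s' := by
  set k := (s.stack 5).length with hk
  have main := Sem.loop (O := O) (i := 5) (p := .seq (.instr (.pop 5)) (ballot E b))
    (f := fun v => (answerDist E [s.stack 3, s.stack 4] T).map fun a => voteStep a v)
    -- The inequality `v.length + j ≤ k` bounds the final counter by the number of votes, so that it
    -- can be cleared in bounded time.
    (R := fun j v s' => s'.stack 6 = v ∧ (s'.stack 5).length = j ∧ v.length + j ≤ k ∧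
        (∀ j < 16, j ≠ 5 → j ≠ 6 → s'.stack j = s.stack j) ∧ Workspace b L s')
    (T := (b + 20) * (2 * L + 2) + 2)
    (fun a s' h => List.length_eq_zero_iff.1 h.2.1)
    (by
      rintro j v s' ⟨rfl, h5, hv, hf, hws⟩
      refine ⟨by rintro h; simp [h] at h5, Sem.seq (Sem.pop ?_)⟩
      have h3 := hf 3 (by decide) (by decide) (by decide)
      have h4 := hf 4 (by decide) (by decide) (by decide)
      have := sem_ballot (O := O) hE hb hb2 (L := L) (T := T)
        (s := s'.set 5 (s'.stack 5).tail) (by simpa [Store.set_stack, h3, h4] using hT)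
        (by simpa [Store.set_stack, h3, h4] using hL)
        (by simpa [Store.set_stack, h7] using hf 7 (by decide) (by decide) (by decide))
        (by
          refine ⟨fun j => ?_, fun j hj => ?_⟩
          · rw [Store.set_stack, if_neg (by omega)]; exact hws.1 j
          · rw [Store.set_stack, if_neg (by omega)]; exact hws.2 j hj)
      simp only [Store.set_stack, h3, h4, show (3 : ℕ) ≠ 5 by decide, show (4 : ℕ) ≠ 5 by decide,
        show (6 : ℕ) ≠ 5 by decide, if_false] at this
      refine this.conseq ?_
      rintro v' hv' s'' ⟨h6', hf', hws'⟩
      obtain ⟨a, -, rfl⟩ := (PMF.mem_support_map_iff _ _ _).1 hv'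
      have := length_voteStep_le a (s'.stack 6)
      refine ⟨h6', ?_, by omega, fun l hl hl5 hl6 => ?_, hws'⟩
      · rw [hf' 5 (by decide) (by decide), if_pos rfl, List.length_tail, h5]; rfl
      · rw [hf' l hl hl6, if_neg hl5, hf l hl hl5 hl6])
    k [] s ⟨h6, hk.symm, by simp, fun _ _ _ _ => rfl, hw⟩
  refine main.map answer ?_
  rintro v - s' ⟨rfl, h5, hv, hf, hws⟩
  exact ⟨rfl, List.length_eq_zero_iff.1 h5, by simpa using hv, hf, hws⟩

end

section

/-! ## The learner: choose the first concept that agrees with a sample -/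

variable {n : ℕ} {μ : PMF (BitStr n × Bool)}

/-- The example oracle with labelled examples drawn from `μ`. -/
abbrev oracleOf {n : ℕ} (μ : PMF (BitStr n × Bool)) : PMF (List Bool) := μ.map encodeExample

theorem sem_query {i : ℕ} {s : Store} : Sem (oracleOf μ) [.instr (.query i)] s 1 μ
    fun z s' => s' = s.set i (encodeExample z) := by
  refine ⟨μ.map fun z => (z, s.set i (encodeExample z)), ?_, ?_, ?_⟩
  · rw [PMF.map_comp]; exact PMF.map_id μ
  · intro p hp
    obtain ⟨w, -, rfl⟩ := (PMF.mem_support_map_iff _ _ _).1 hp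
    rfl
  · rw [run_succ']
    simp [step, Instr.exec, PMF.map_comp, run, PMF.bind_pure]
    rfl

/-- A flag, raised unless `ok`. -/
def flag (ok : Bool) : List Bool := if ok then [] else [false]

/-- Raise the flag on stack 10. -/
def raise : Prog := .seq (.instr (.pop 10)) (.instr (.push false 10))

/-- Raise the flag on stack 10 unless stack 14 has top `a`. -/
def compareWith (a : Bool) : Prog :=
  .branch 14 raise (if a then raise else clear 7) (if a then clear 7 else raise)

/-- Draw an example; raise the flag on stack 10 if its label differs from the majority vote for the
concept on stack 4. -/
def trial (E : Prog) (b : ℕ) : Prog :=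
  .seq (.instr (.query 3)) <| .seq (mv 3 14) <| .seq (copy 8 7 5) <| .seq (majority E b) <|
    .seq (.branch 6 (compareWith false) (compareWith false) (compareWith true)) <|
    .seq (clear 6) (clear 14)

/-- The stacks used by `trial` are clean. -/
structure Idle (b L : ℕ) (s : Store) : Prop where
  h5 : s.stack 5 = []
  h6 : s.stack 6 = []
  h7 : s.stack 7 = []
  h14 : s.stack 14 = []
  ws : Workspace b L s

theorem Workspace.set {b L : ℕ} {s : Store} (h : Workspace b L s) {i : ℕ} (hi : i < 16)
    (w : List Bool) : Workspace b L (s.set i w) := by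
  refine ⟨fun j => ?_, fun j hj => ?_⟩
  · rw [Store.set_stack, if_neg (by omega)]; exact h.1 j
  · rw [Store.set_stack, if_neg (by omega)]; exact h.2 j hj

theorem Idle.set {b L : ℕ} {s : Store} (h : Idle b L s) {i : ℕ} (hi : i < 16)
    (h5 : i ≠ 5) (h6 : i ≠ 6) (h7 : i ≠ 7) (h14 : i ≠ 14)
    (w : List Bool) : Idle b L (s.set i w) := by
  refine ⟨?_, ?_, ?_, ?_, h.ws.set hi w⟩ <;> rw [Store.set_stack, if_neg (by omega)]
  exacts [h.h5, h.h6, h.h7, h.h14]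

theorem det_compareWith {O : PMF (List Bool)} {a y ok : Bool} {s : Store} (h7 : s.stack 7 = [])
    (h14 : s.stack 14 = [y]) (h10 : s.stack 10 = flag ok) :
    Det O [compareWith a] s 4 (s.set 10 (flag (ok && a == y))) := by
  have hraise : Det O [raise] s 3 (s.set 10 [false]) := by
    refine Det.conv (Sem.seq (Sem.pop (Sem.push (T := 0) Det.nil))) le_rfl ?_
    refine Store.ext' (fun l => ?_) rfl
    simp only [Store.set_stack, if_true, h10]
    split_ifs <;> cases ok <;> simp_all [flag]
  -- Stack 7 is empty here, so `clear 7` plays the part of a no-op.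
  have hnop : Det O [clear 7] s 3 (s.set 10 (flag ok)) := by
    refine (det_clear h7).conv (by simp) ?_
    rw [Store.set_self h7, Store.set_self h10]
  refine Sem.branch_cons h14 ?_
  cases a <;> cases y <;> cases ok <;>
    first
    | exact hraise
    | exact hnop

/-- Once the label has been moved away, the answer of the oracle is exactly the instance on which
`E` is to be run. The flag is the whole abstract state of a test, and `ok && _` never lowers it once
it has been raised. -/
theorem sem_trial {E : Prog} (hE : E.All fun a => ¬ a.IsQuery) {b : ℕ} (hb : E.Stacks (· < b))
    (hb2 : 2 ≤ b) {M T : ℕ} {s : Store} {w : List Bool} (h4 : s.stack 4 = w)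
    (hT : ∀ x : BitStr n, E.HaltsWithin noOracle [List.ofFn x, w] T) (hw : w.length ≤ M)
    (h8 : (s.stack 8).length = M) {ok : Bool} (h10 : s.stack 10 = flag ok)
    (hs : Idle b (n + M + T) s) :
    Sem (oracleOf μ) [trial E b] s ((M + 1) * ((b + 20) * (2 * (n + M + T) + 2) + 37))
      (μ.bind fun z => (majDist (answerDist E [List.ofFn z.1, w] T) M).map fun a => ok && a == z.2)
      fun ok' s' => Idle b (n + M + T) s' ∧ s'.stack 10 = flag ok' ∧ s'.stack 4 = s.stack 4 ∧
        s'.stack 8 = s.stack 8 ∧ s'.stack 9 = s.stack 9 ∧ s'.stack 11 = s.stack 11 ∧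
        s'.stack 12 = s.stack 12 := by
  set L := n + M + T with hL
  set B := (b + 20) * (2 * L + 2) with hB
  -- Voting costs `M * (B + 3)`, copying the counter `12 * M`, clearing the votes `2 * M`; the
  -- constant 30 covers the remaining steps.
  refine (Sem.seq (sem_query.cons (T' := M * (B + 3) + 14 * M + 30) ?_)).mono (by ring_nf; omega)
  rintro ⟨x, y⟩ - s1 rfl
  set s2 := ((s.set 3 (encodeExample (x, y))).set 3 (List.ofFn x)).set 14 [y] with hs2
  have e8 : s2.stack 8 = s.stack 8 := by simp [hs2, Store.set_stack]
  have i2 : s2.stack 5 = [] ∧ s2.stack 6 = [] ∧ s2.stack 7 = [] ∧ s2.stack 4 = w := by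
    simp [hs2, Store.set_stack, hs.h5, hs.h6, hs.h7, h4]
  have d3 : Det (oracleOf μ) [copy 8 7 5] s2 (12 * M + 3) (s2.set 5 (s.stack 8)) := by
    have := det_copy (O := oracleOf μ) (s := s2) (i := 8) (t := 7) (j := 5) (by decide) (by decide)
      (by decide) i2.2.2.1
    rwa [e8, i2.1, List.append_nil, h8] at this
  set s3 := s2.set 5 (s.stack 8) with hs3
  have e3 : s3.stack 3 = List.ofFn x := by simp [hs3, hs2, Store.set_stack]
  have e4 : s3.stack 4 = w := by simp [hs3, Store.set_stack, i2.2.2.2]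
  have e5 : (s3.stack 5).length = M := by simp [hs3, Store.set_stack, h8]
  have d4 := sem_majority (O := oracleOf μ) hE hb hb2 (s := s3) (L := L) (T := T)
    (by rw [e3, e4]; exact hT x) (by rw [e3, e4, List.length_ofFn]; omega)
    (by simp [hs3, Store.set_stack, i2.2.1]) (by simp [hs3, Store.set_stack, i2.2.2.1])
    (((hs.ws.set (i := 3) (by decide) _).set (i := 3) (by decide) _).set (i := 14)
      (by decide) _ |>.set (i := 5) (by decide) _)
  rw [e3, e4, e5] at d4
  have d5 : ∀ a s4, (answer (s4.stack 6) = a ∧ s4.stack 5 = [] ∧ (s4.stack 6).length ≤ M ∧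
        (∀ j < 16, j ≠ 5 → j ≠ 6 → s4.stack j = s3.stack j) ∧ Workspace b L s4) →
      Sem (oracleOf μ) [.seq (.branch 6 (compareWith false) (compareWith false) (compareWith true))
        (.seq (clear 6) (clear 14))] s4 (2 * M + 11) (PMF.pure (ok && a == y))
        fun ok' s' => Idle b L s' ∧ s'.stack 10 = flag ok' ∧ s'.stack 4 = s.stack 4 ∧
        s'.stack 8 = s.stack 8 ∧ s'.stack 9 = s.stack 9 ∧ s'.stack 11 = s.stack 11 ∧
        s'.stack 12 = s.stack 12 := by
    rintro a s4 ⟨rfl, f5, f6, f, fw⟩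
    have f7 : s4.stack 7 = [] := by
      rw [f 7 (by decide) (by decide) (by decide)]; simp [hs3, Store.set_stack, i2.2.2.1]
    have f14 : s4.stack 14 = [y] := by
      rw [f 14 (by decide) (by decide) (by decide)]; simp [hs3, hs2, Store.set_stack]
    have f10 : s4.stack 10 = flag ok := by
      rw [f 10 (by decide) (by decide) (by decide)]; simp [hs3, hs2, Store.set_stack, h10]
    have c1 : Det (oracleOf μ) [.branch 6 (compareWith false) (compareWith false)
        (compareWith true)] s4 5 (s4.set 10 (flag (ok && answer (s4.stack 6) == y))) := by
      cases h6 : s4.stack 6 with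
      | nil => exact Sem.branch_nil h6 (det_compareWith f7 f14 f10)
      | cons c v =>
        refine Sem.branch_cons h6 ?_
        cases c
        · exact det_compareWith f7 f14 f10
        · exact det_compareWith f7 f14 f10
    set g := flag (ok && answer (s4.stack 6) == y)
    have c2 := det_clear (O := oracleOf μ) (i := 6) (s := s4.set 10 g) rfl
    have c3 := det_clear (O := oracleOf μ) (i := 14) (s := (s4.set 10 g).set 6 []) rfl
    refine (Sem.seq (c1.cons (Sem.seq (c2.cons (c3.append (T' := 0) (Sem.nil ?_)))))).mono ?_
    · have hf : ∀ j < 16, j ≠ 5 → j ≠ 6 → j ≠ 14 → j ≠ 3 → s4.stack j = s.stack j := by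
        intro j hj j5 j6 j14 j3
        rw [f j hj j5 j6]; simp [hs3, hs2, Store.set_stack, j5, j14, j3]
      refine ⟨⟨?_, ?_, ?_, ?_, ((fw.set (by decide) _).set (by decide) _).set (by decide) _⟩,
        ?_, ?_, ?_, ?_, ?_, ?_⟩ <;> simp [Store.set_stack, f5, f7, hf]
      rfl
    · simp [Store.set_stack, f14]; omega
  refine (Sem.seq (sem_mv (by decide) (a := y) (w := List.ofFn x)
    (by simp [Store.set_stack, encodeExample]) (T := 12 * M + 3 + (M * (B + 3) + 1 + (2 * M + 11)
      + 1) + 1) ?_)).mono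
    (by omega)
  have e14 : (s.set 3 (encodeExample (x, y))).stack 14 = [] := by simp [Store.set_stack, hs.h14]
  rw [e14, ← PMF.bind_pure_comp]
  exact Sem.seq (d3.cons (Sem.seq (d4.cons fun a _ s4 h4 => d5 a s4 h4)))

/-- Test the concept on stack 4 with one trial for every element of stack 9. -/
def test (E : Prog) (b : ℕ) : Prog := .loop 9 (.seq (.instr (.pop 9)) (trial E b))

/-- The distribution of the outcome of a test with `M` trials. -/
def testDist (E : Prog) (μ : PMF (BitStr n × Bool)) (M T : ℕ) (w : List Bool) : PMF Bool :=
  iter (fun ok => μ.bind fun z =>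
    (majDist (answerDist E [List.ofFn z.1, w] T) M).map fun a => ok && a == z.2) M true

theorem sem_test {E : Prog} (hE : E.All fun a => ¬ a.IsQuery) {b : ℕ} (hb : E.Stacks (· < b))
    (hb2 : 2 ≤ b) {M T : ℕ} {s : Store} {w : List Bool} (h4 : s.stack 4 = w)
    (hT : ∀ x : BitStr n, E.HaltsWithin noOracle [List.ofFn x, w] T) (hw : w.length ≤ M)
    (h8 : (s.stack 8).length = M) (h9 : (s.stack 9).length = M) (h10 : s.stack 10 = [])
    (hs : Idle b (n + M + T) s) :
    Sem (oracleOf μ) [test E b] s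
      (M * ((M + 1) * ((b + 20) * (2 * (n + M + T) + 2) + 37) + 3) + 1) (testDist E μ M T w)
      fun ok' s' => Idle b (n + M + T) s' ∧ s'.stack 9 = [] ∧ s'.stack 10 = flag ok' ∧
        s'.stack 4 = s.stack 4 ∧ s'.stack 8 = s.stack 8 ∧ s'.stack 11 = s.stack 11 ∧
        s'.stack 12 = s.stack 12 := by
  have main := Sem.loop (O := oracleOf μ) (i := 9) (p := .seq (.instr (.pop 9)) (trial E b))
    (f := fun ok => μ.bind fun z =>
      (majDist (answerDist E [List.ofFn z.1, w] T) M).map fun a => ok && a == z.2)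
    (R := fun j ok s' => (s'.stack 9).length = j ∧ Idle b (n + M + T) s' ∧
      s'.stack 10 = flag ok ∧ s'.stack 4 = s.stack 4 ∧ s'.stack 8 = s.stack 8 ∧
      s'.stack 11 = s.stack 11 ∧ s'.stack 12 = s.stack 12)
    (T := (M + 1) * ((b + 20) * (2 * (n + M + T) + 2) + 37) + 2)
    (fun a s' h => List.length_eq_zero_iff.1 h.1)
    (by
      rintro j ok s' ⟨g9, gi, g10, g4, g8, g11, g12⟩
      refine ⟨by rintro h; simp [h] at g9, Sem.seq (Sem.pop ?_)⟩
      refine (sem_trial (μ := μ) hE hb hb2 (T := T) (M := M) (ok := ok) (w := w) ?_ hT hw ?_ ?_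
        (gi.set (by decide) (by decide) (by decide) (by decide) (by decide) _)).conseq ?_
      · simp [Store.set_stack, g4, h4]
      · simp [Store.set_stack, g8, h8]
      · simp [Store.set_stack, g10]
      · rintro ok' - s'' ⟨k1, k2, k3, k4, k5, k6, k7⟩
        simp only [Store.set_stack] at k3 k4 k5 k6 k7
        refine ⟨?_, k1, k2, k3.trans g4, k4.trans g8, k6.trans g11, k7.trans g12⟩
        simp [k5, g9])
    M true s ⟨h9, hs, h10, rfl, rfl, rfl, rfl⟩
  refine main.conseq ?_
  rintro ok - s' ⟨g9, gi, g10, g4, g8, g11, g12⟩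
  exact ⟨gi, List.length_eq_zero_iff.1 g9, g10, g4, g8, g11, g12⟩

/-- Unless stack 12 reports that a concept has been accepted, test the concept on stack 4. Then
report it as accepted, or pass to the next one. -/
def attempt (E : Prog) (b : ℕ) : Prog :=
  .branch 12
    (.seq (copy 8 7 9) <| .seq (test E b) <| .branch 10 (.instr (.push true 12))
      (.seq (clear 10) (.instr (.push false 4))) (.instr (.pop 12)))
    (clear 7) (clear 7)

/-- Attempts, one for every element of stack 11. -/
def search (E : Prog) (b : ℕ) : Prog := .loop 11 (.seq (.instr (.pop 11)) (attempt E b))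

/-- The distribution of an attempt. The state is the number of the current concept and whether it
has been accepted. -/
def attemptDist (E : Prog) (μ : PMF (BitStr n × Bool)) (M T : ℕ) : ℕ × Bool → PMF (ℕ × Bool)
  | (i, true) => PMF.pure (i, true)
  | (i, false) => (testDist E μ M T (unary i)).map fun ok => if ok then (i, true) else (i + 1, false)

/-- The distribution of the number of the concept found by the learner. -/
def searchDist (E : Prog) (μ : PMF (BitStr n × Bool)) (M T : ℕ) : PMF ℕ :=
  (iter (attemptDist E μ M T) M (0, false)).map Prod.fst

/-- Bound on the time of an attempt. -/
def attemptTime (b n M T : ℕ) : ℕ :=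
  M * ((M + 1) * ((b + 20) * (2 * (n + M + T) + 2) + 37) + 3) + 12 * M + 20

theorem sem_attempt {E : Prog} (hE : E.All fun a => ¬ a.IsQuery) {b : ℕ} (hb : E.Stacks (· < b))
    (hb2 : 2 ≤ b) {M T i : ℕ} {found : Bool} {s : Store} (h4 : s.stack 4 = unary i)
    (hT : ∀ x : BitStr n, E.HaltsWithin noOracle [List.ofFn x, unary i] T) (hi : i ≤ M)
    (h8 : (s.stack 8).length = M) (h9 : s.stack 9 = []) (h10 : s.stack 10 = [])
    (h12 : s.stack 12 = if found then [true] else []) (hs : Idle b (n + M + T) s) :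
    Sem (oracleOf μ) [attempt E b] s (attemptTime b n M T) (attemptDist E μ M T (i, found))
      fun a s' => Idle b (n + M + T) s' ∧ s'.stack 9 = [] ∧ s'.stack 10 = [] ∧
        s'.stack 4 = unary a.1 ∧ a.1 ≤ i + 1 ∧ s'.stack 8 = s.stack 8 ∧
        s'.stack 11 = s.stack 11 ∧ s'.stack 12 = if a.2 then [true] else [] := by
  have hS : ∀ {w}, s.stack 7 = w → w = [] → Det (oracleOf μ) [clear 7] s 1 s := by
    rintro w h rfl
    refine (det_clear h).conv (by simp) (Store.set_self h)
  cases found with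
  | true =>
    refine (Sem.branch_cons (w := []) (by simpa using h12)
      ((hS hs.h7 rfl).append (k' := []) (T' := 0) (Sem.nil ?_))).mono ?_
    · exact ⟨hs, h9, h10, h4, Nat.le_succ i, rfl, rfl, h12⟩
    · unfold attemptTime; omega
  | false =>
    have h12' : s.stack 12 = [] := by simpa using h12
    have d1 := det_copy (O := oracleOf μ) (s := s) (i := 8) (t := 7) (j := 9) (by decide) (by decide)
      (by decide) hs.h7
    rw [h9, List.append_nil, h8] at d1
    have d2 := sem_test (μ := μ) hE hb hb2 (T := T) (M := M) (s := s.set 9 (s.stack 8))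
      (w := unary i) (by simp [Store.set_stack, h4]) hT (by simpa [unary] using hi)
      (by simp [Store.set_stack, h8]) (by simp [Store.set_stack, h8])
      (by simp [Store.set_stack, h10])
      (hs.set (by decide) (by decide) (by decide) (by decide) (by decide) _)
    refine (Sem.branch_nil h12' (Sem.seq (d1.cons (Sem.seq (Sem.cons (T' := 6)
      (ν' := fun ok : Bool => PMF.pure (if ok then (i, true) else (i + 1, false))) d2 ?_))))).mono ?_
    · rintro ok - s' ⟨ki, k9, k10, k4, k8, k11, k12⟩
      simp only [Store.set_stack] at k4 k8 k11 k12
      have k4 : s'.stack 4 = unary i := k4.trans h4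
      have k12 : s'.stack 12 = [] := k12.trans h12'
      cases ok with
      | true =>
        refine (Sem.branch_nil k10 (Sem.push (Sem.nil (T := 0) ?_))).mono (by omega)
        refine ⟨ki.set (by decide) (by decide) (by decide) (by decide) (by decide) _, ?_⟩
        simp [Store.set_stack, k9, k10, k4, k8, k11, k12, flag]
      | false =>
        have c := det_clear (O := oracleOf μ) k10
        refine (Sem.branch_cons k10 (Sem.seq (c.cons (Sem.push (Sem.nil (T := 0) ?_))))).mono
          (by simp [flag])
        refine ⟨(ki.set (by decide) (by decide) (by decide) (by decide) (by decide) _).set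
          (by decide) (by decide) (by decide) (by decide) (by decide) _, ?_⟩
        simp [Store.set_stack, k9, k4, k8, k11, k12, unary, List.replicate_succ]
    · unfold attemptTime; omega

/-- The length of the list of concepts is not available to the program, which simply allows for `M`
attempts. Termination is therefore required for all numbers up to `M`, including those that name no
concept. -/
theorem sem_search {E : Prog} (hE : E.All fun a => ¬ a.IsQuery) {b : ℕ} (hb : E.Stacks (· < b))
    (hb2 : 2 ≤ b) {M T : ℕ} {s : Store} (h4 : s.stack 4 = [])
    (hT : ∀ (x : BitStr n), ∀ i ≤ M, E.HaltsWithin noOracle [List.ofFn x, unary i] T)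
    (h8 : (s.stack 8).length = M) (h9 : s.stack 9 = []) (h10 : s.stack 10 = [])
    (h11 : (s.stack 11).length = M) (h12 : s.stack 12 = []) (hs : Idle b (n + M + T) s) :
    Sem (oracleOf μ) [search E b] s (M * (attemptTime b n M T + 3) + 1) (searchDist E μ M T)
      fun i s' => s'.stack 4 = unary i ∧ i ≤ M := by
  have main := Sem.loop (O := oracleOf μ) (i := 11) (p := .seq (.instr (.pop 11)) (attempt E b))
    (f := attemptDist E μ M T)
    -- The number grows by at most one per attempt, so `a.1 + j ≤ M` keeps it in the range where `E`
    -- is known to halt.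
    (R := fun j a s' => (s'.stack 11).length = j ∧ a.1 + j ≤ M ∧ Idle b (n + M + T) s' ∧
      s'.stack 9 = [] ∧ s'.stack 10 = [] ∧ s'.stack 4 = unary a.1 ∧
      s'.stack 8 = s.stack 8 ∧ s'.stack 12 = if a.2 then [true] else [])
    (T := attemptTime b n M T + 2)
    (fun a s' h => List.length_eq_zero_iff.1 h.1)
    (by
      rintro j ⟨i, found⟩ s' ⟨g11, gM, gi, g9, g10, g4, g8, g12⟩
      simp only at gM g4 g12
      refine ⟨by rintro h; simp [h] at g11, Sem.seq (Sem.pop ?_)⟩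
      refine (sem_attempt (μ := μ) hE hb hb2 (T := T) (M := M) (i := i) (found := found)
        (s := s'.set 11 (s'.stack 11).tail) ?_
        (fun x => hT x i (by omega)) (by omega) ?_ ?_ ?_ ?_
        (gi.set (by decide) (by decide) (by decide) (by decide) (by decide) _)).conseq ?_
      · simp [Store.set_stack, g4]
      · simp [Store.set_stack, g8, h8]
      · simp [Store.set_stack, g9]
      · simp [Store.set_stack, g10]
      · simp [Store.set_stack, g12]
      · rintro a - s'' ⟨k1, k2, k3, k4, k5, k6, k7, k8⟩
        simp only [Store.set_stack] at k6 k7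
        refine ⟨by simp [k7, g11], by omega, k1, k2, k3, k4, k6.trans g8, k8⟩)
    M (0, false) s ⟨h11, by simp, hs, h9, h10, h4, rfl, h12⟩
  refine main.map Prod.fst ?_
  rintro a - s' ⟨-, h, -, -, -, h', -⟩
  exact ⟨h', by omega⟩

end

/-! ## Unary arithmetic and the complete learner -/

section
variable {O : PMF (List Bool)}

/-- The stacks stand for unary numbers, so only the length of the resulting string is recorded. -/
theorem exists_det_copies {u : List Bool} : ∀ {s : Store}, s.stack 9 = u → s.stack 7 = [] →
    ∃ w : List Bool, w.length = u.length * (s.stack 13).length + (s.stack 8).length ∧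
      Det O [.loop 9 (.seq (.instr (.pop 9)) (copy 13 7 8))] s
        (u.length * (12 * (s.stack 13).length + 6) + 1) ((s.set 9 []).set 8 w) := by
  induction u with
  | nil =>
    intro s h9 h7
    refine ⟨s.stack 8, by simp, Sem.loop_nil h9 ?_⟩
    rw [Store.set_self h9, Store.set_self rfl]
    exact Det.nil
  | cons a u ih =>
    intro s h9 h7
    have d := det_copy (O := O) (s := s.set 9 u) (i := 13) (t := 7) (j := 8) (by decide) (by decide)
      (by decide) (by simp [Store.set_stack, h7])
    obtain ⟨w, hw, hd⟩ := ih (s := (s.set 9 u).set 8 (s.stack 13 ++ s.stack 8))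
      (by simp [Store.set_stack]) (by simp [Store.set_stack, h7])
    simp only [Store.set_stack] at hw hd d
    refine ⟨w, by rw [hw]; simp; ring, Det.conv (Sem.loop_cons (by simp [h9])
      (Sem.seq (Sem.pop ?_))) (T := 12 * (s.stack 13).length + 3 + (u.length *
        (12 * (s.stack 13).length + 6) + 1) + 3) ?_ rfl⟩
    · rw [h9]
      refine Det.conv (d.cons hd) (by simp) ?_
      refine Store.ext' (fun l => ?_) rfl
      simp only [Store.set_stack]
      split_ifs <;> simp_all
    · simp only [List.length_cons]; ring_nf; omega

/-- Multiply the length of stack 8 by the length of stack 13. -/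
def mul : Prog := .seq (moveRev 8 9) (.loop 9 (.seq (.instr (.pop 9)) (copy 13 7 8)))

/-- Put a string on stack 8 whose length is the `c`-th power of the length of stack 13. -/
def power : ℕ → Prog
  | 0 => .instr (.push false 8)
  | c + 1 => .seq (power c) mul

/-- Running time of `power`. -/
def powerTime (S : ℕ) : ℕ → ℕ
  | 0 => 1
  | c + 1 => powerTime S c + S ^ c * (12 * S + 11) + 4

theorem exists_det_power {s : Store} (h7 : s.stack 7 = []) (h8 : s.stack 8 = [])
    (h9 : s.stack 9 = []) (c : ℕ) : ∃ w : List Bool, w.length = (s.stack 13).length ^ c ∧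
      Det O [power c] s (powerTime (s.stack 13).length c) (s.set 8 w) := by
  induction c with
  | zero =>
    refine ⟨[false], by simp, Sem.push (T := 0) ?_⟩
    rw [h8]; exact Det.nil
  | succ c ih =>
    obtain ⟨w, hw, hd⟩ := ih
    have d1 := det_moveRev (O := O) (i := 8) (j := 9) (by decide) (s := s.set 8 w) rfl
    obtain ⟨w', hw', hd'⟩ := exists_det_copies (O := O)
      (s := ((s.set 8 w).set 8 []).set 9 (((s.set 8 w).stack 8).reverse ++ (s.set 8 w).stack 9))
      rfl (by simp [Store.set_stack, h7])
    refine ⟨w', ?_, Det.conv (Sem.seq (hd.cons (Sem.seq (d1.cons hd')))) ?_ ?_⟩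
    · simp [hw', Store.set_stack, h9, hw, pow_succ]
    · simp [Store.set_stack, h9, hw, powerTime]
      ring_nf; omega
    · refine Store.ext' (fun l => ?_) rfl
      simp only [Store.set_stack]
      split_ifs <;> simp_all

end

/-! ### Stacks touched by the search, and the complete learner -/

theorem stacks_clearRange {S : ℕ → Prop} {K : ℕ} (h : ∀ j, K ≤ j → S j) :
    ∀ b, (clearRange K b).Stacks S
  | 0 => ⟨h _ le_rfl, h _ le_rfl⟩
  | b + 1 => ⟨stacks_clearRange h b, h _ (by omega), h _ (by omega)⟩

theorem stacks_majority {S : ℕ → Prop} (h : ∀ j ∈ [3, 4, 5, 6, 7], S j) (h' : ∀ j, 16 ≤ j → S j)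
    {E : Prog} {b : ℕ} : (majority E b).Stacks S := by
  have h1 := stacks_clearRange h' b
  have h2 := (E.stacks_shift 16).mono h'
  have h16 := h' 16 le_rfl
  have h17 := h' 17 (by decide)
  simp only [List.mem_cons, List.not_mem_nil, or_false, forall_eq_or_imp, forall_eq] at h
  simp [majority, ballot, copy, moveRev, mv, spread, castVote, Prog.Stacks, Instr.Stacks, *]

theorem stacks_search {S : ℕ → Prop} (h : ∀ j ∈ [3, 4, 5, 6, 7, 8, 9, 10, 11, 12, 14], S j)
    (h' : ∀ j, 16 ≤ j → S j) {E : Prog} {b : ℕ} : (search E b).Stacks S := by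
  have h1 := stacks_majority (S := S) (fun j hj => h j (by
    simp only [List.mem_cons, List.not_mem_nil, or_false] at hj ⊢; omega)) h' (E := E) (b := b)
  simp only [List.mem_cons, List.not_mem_nil, or_false, forall_eq_or_imp, forall_eq] at h
  simp [search, attempt, test, trial, compareWith, raise, clear, copy, moveRev, mv, spread,
    Prog.Stacks, Instr.Stacks, *]

/-- A frame rule: stacks that the program does not mention need not be carried through its
specification. -/
theorem Sem.frame {O : PMF (List Bool)} {k : List Prog} {s : Store} {T : ℕ} {α : Type} {ν : PMF α}
    {R : α → Store → Prop} (h : Sem O k s T ν R) {S : ℕ → Prop} (hk : ∀ P ∈ k, P.Stacks S)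
    {j : ℕ} (hj : ¬ S j) : Sem O k s T ν fun a s' => R a s' ∧ s'.stack j = s.stack j := by
  obtain ⟨κ, h1, h2, h3⟩ := h
  refine ⟨κ, h1, fun p hp => ⟨h2 p hp, ?_⟩, h3⟩
  refine run_stack_eq (O := O) (c := (k, s)) hk (T := T) (c' := ([], p.2)) ?_ hj
  rw [h3, PMF.mem_support_map_iff]
  exact ⟨p, hp, rfl⟩

/-- The learner built from the evaluator `E`. -/
def learner (E : Prog) (b c : ℕ) : Prog :=
  .seq (moveRev 0 13) <| .seq (moveRev 1 13) <| .seq (moveRev 2 13) <|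
    -- Two extra bits make the base of the power at least 2, as `exists_eval_le_pow` requires.
    .seq (.instr (.push false 13)) <| .seq (.instr (.push false 13)) <| .seq (power c) <|
    .seq (copy 8 7 11) <| .seq (search E b) (moveRev 4 0)

/-- Running time of the learner. -/
def learnerTime (b c S T : ℕ) : ℕ :=
  powerTime S c + S ^ c * (attemptTime b S (S ^ c) T + 20) + 5 * S + 20

theorem attemptTime_mono {b n n' M T T' : ℕ} (hn : n ≤ n') (hT : T ≤ T') :
    attemptTime b n M T ≤ attemptTime b n' M T' := by
  unfold attemptTime; gcongr

/-- The single number `S ^ c` serves as number of attempts, of examples per attempt and of votes per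
example. The source `μ` is arbitrary because the time bound must hold for every source of examples.
-/
theorem sem_learner {n e d : ℕ} {μ : PMF (BitStr n × Bool)} {E : Prog}
    (hE : E.All fun a => ¬ a.IsQuery) {b : ℕ} (hb : E.Stacks (· < b)) (hb2 : 2 ≤ b) {c S T : ℕ}
    (hS : n + e + d + 2 = S)
    (hT : ∀ (x : BitStr n), ∀ i ≤ S ^ c, E.HaltsWithin noOracle [List.ofFn x, unary i] T) :
    Sem (oracleOf μ) [learner E b c] (Store.init [unary n, unary e, unary d])
      (learnerTime b c S T) (searchDist E μ (S ^ c) T) fun i s' => s'.stack 0 = unary i := by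
  set s := Store.init [unary n, unary e, unary d] with hs
  have h0 : s.stack 0 = unary n := rfl
  have h1 : s.stack 1 = unary e := rfl
  have h2 : s.stack 2 = unary d := rfl
  have hj : ∀ j, 3 ≤ j → s.stack j = [] := by
    intro j hj
    obtain ⟨k, rfl⟩ := Nat.exists_eq_add_of_le hj
    simp [hs, Store.init, add_comm 3 k]
  have d1 := det_moveRev (O := oracleOf μ) (i := 0) (j := 13) (by decide) h0
  set s1 := (s.set 0 []).set 13 ((unary n).reverse ++ s.stack 13) with hs1
  have d2 := det_moveRev (O := oracleOf μ) (i := 1) (j := 13) (by decide) (s := s1) (w := unary e)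
    (by simp [hs1, Store.set_stack, h1])
  set s2 := (s1.set 1 []).set 13 ((unary e).reverse ++ s1.stack 13) with hs2
  have d3 := det_moveRev (O := oracleOf μ) (i := 2) (j := 13) (by decide) (s := s2) (w := unary d)
    (by simp [hs2, hs1, Store.set_stack, h2])
  set s3 := (s2.set 2 []).set 13 ((unary d).reverse ++ s2.stack 13) with hs3
  set s4 := s3.set 13 (false :: s3.stack 13) with hs4
  set s5 := s4.set 13 (false :: s4.stack 13) with hs5
  have e13 : (s5.stack 13).length = S := by
    simp [hs5, hs4, hs3, hs2, hs1, Store.set_stack, hj, unary]; omega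
  have ej : ∀ j, 3 ≤ j → j ≠ 13 → s5.stack j = [] := by
    intro j h3 h13
    simp [hs5, hs4, hs3, hs2, hs1, Store.set_stack, hj j h3, h13]
  have e0 : s5.stack 0 = [] := by simp [hs5, hs4, hs3, hs2, hs1, Store.set_stack]
  obtain ⟨w, hw, d6⟩ := exists_det_power (O := oracleOf μ) (ej 7 (by decide) (by decide))
    (ej 8 (by decide) (by decide)) (ej 9 (by decide) (by decide)) c
  rw [e13] at hw d6
  have d7 := det_copy (O := oracleOf μ) (s := s5.set 8 w) (i := 8) (t := 7) (j := 11) (by decide)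
    (by decide) (by decide) (by simp [Store.set_stack, ej])
  set s7 := (s5.set 8 w).set 11 ((s5.set 8 w).stack 8 ++ (s5.set 8 w).stack 11) with hs7
  have f0 : s7.stack 0 = [] := by simp [hs7, Store.set_stack, e0]
  have fj : ∀ j, 3 ≤ j → j ≠ 13 → j ≠ 8 → j ≠ 11 → s7.stack j = [] := by
    intro j h3 h13 h8 h11
    simp [hs7, Store.set_stack, h8, h11, ej j h3 h13]
  have d8 := sem_search (μ := μ) hE hb hb2 (M := S ^ c) (T := T) (s := s7)
    (fj _ (by decide) (by decide) (by decide) (by decide)) hT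
    (by simp [hs7, Store.set_stack, hw]) (fj _ (by decide) (by decide) (by decide) (by decide))
    (fj _ (by decide) (by decide) (by decide) (by decide))
    (by simp [hs7, Store.set_stack, hw, ej]) (fj _ (by decide) (by decide) (by decide) (by decide))
    ⟨fj _ (by decide) (by decide) (by decide) (by decide),
      fj _ (by decide) (by decide) (by decide) (by decide),
      fj _ (by decide) (by decide) (by decide) (by decide),
      fj _ (by decide) (by decide) (by decide) (by decide),
      fun j => by rw [fj _ (by omega) (by omega) (by omega) (by omega)]; simp,
      fun j _ => fj _ (by omega) (by omega) (by omega) (by omega)⟩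
  have d9 : ∀ i s', (s'.stack 4 = unary i ∧ i ≤ S ^ c) ∧ s'.stack 0 = s7.stack 0 →
      Sem (oracleOf μ) [moveRev 4 0] s' (5 * S ^ c + 1) (PMF.pure i)
        fun i s' => s'.stack 0 = unary i := by
    rintro i s' ⟨⟨g4, gi⟩, g0⟩
    refine ((det_moveRev (by decide) g4).append (k' := []) (T' := 0) (Sem.nil ?_)).mono ?_
    · simp [Store.set_stack, g0, f0, unary]
    · simp [unary]; omega
  -- Stack 0 was emptied when the inputs were collected and is not mentioned by the search, so the
  -- output is exactly the number found.
  have d89 := Sem.cons (T' := 5 * S ^ c + 1) (k' := [moveRev 4 0]) (ν' := PMF.pure)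
    (d8.frame (j := 0) (S := (· ≠ 0)) (by simpa using stacks_search (by simp) (by intros; omega))
      (by simp)) fun i _ s' h => d9 i s' h
  rw [PMF.bind_pure] at d89
  refine (Sem.seq (d1.cons (Sem.seq (d2.cons (Sem.seq (d3.cons (Sem.seq (Sem.push (Sem.seq
    (Sem.push (Sem.seq (d6.cons (Sem.seq (d7.cons (Sem.seq d89))))))))))))))).mono ?_
  have hA := attemptTime_mono (b := b) (M := S ^ c) (show n ≤ S by omega) (le_refl T)
  have hA' := Nat.mul_le_mul_left (S ^ c) hA
  have hw8 : ((s5.set 8 w).stack 8).length = S ^ c := by simp [Store.set_stack, hw]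
  rw [hw8]
  simp only [unary, List.length_replicate, learnerTime]
  ring_nf at hA' ⊢
  omega

/-! ## Error probabilities -/

theorem _root_.PMF.toOuterMeasure_le_one {α : Type} (p : PMF α) (s : Set α) :
    p.toOuterMeasure s ≤ 1 := by
  rw [PMF.toOuterMeasure_apply]
  calc ∑' x, s.indicator p x ≤ ∑' x, p x := ENNReal.tsum_le_tsum fun x =>
        Set.indicator_le_self _ _ _
    _ = 1 := p.tsum_coe

theorem Bool.pmf_add (π : PMF Bool) (c : Bool) : π c + π (!c) = 1 := by
  have := π.tsum_coe
  rw [tsum_bool] at this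
  cases c
  · exact this
  · rw [add_comm]; exact this

theorem Bool.pmf_toReal_add (π : PMF Bool) (c : Bool) : (π c).toReal + (π (!c)).toReal = 1 := by
  rw [← ENNReal.toReal_add (π.apply_ne_top _) (π.apply_ne_top _), Bool.pmf_add, ENNReal.toReal_one]

theorem toReal_bind_bool {α : Type} (π : PMF Bool) (f : Bool → PMF α) (a : α) (c : Bool) :
    ((π.bind f) a).toReal =
      (π c).toReal * (f c a).toReal + (π (!c)).toReal * (f (!c) a).toReal := by
  rw [PMF.bind_apply, tsum_bool, ENNReal.toReal_add, ENNReal.toReal_mul, ENNReal.toReal_mul]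
  · cases c
    · rfl
    · rw [add_comm]; rfl
  · exact ENNReal.mul_ne_top (π.apply_ne_top _) ((f _).apply_ne_top _)
  · exact ENNReal.mul_ne_top (π.apply_ne_top _) ((f _).apply_ne_top _)

/-- An exponential moment bound. Read the counter as a signed height, positive when it favours `c`,
and take `2/3` to the power of this height as potential. With probability `q ≤ 1/3` of a wrong vote,
one vote multiplies the mean potential by `(1 - q) * (2/3) + q * (3/2) = 2/3 + (5/6) q ≤ 17/18`, and
the potential dominates the indicator of a wrong final answer. The height is arbitrary for the sake
of the induction. -/
theorem majority_potential {π : PMF Bool} {c : Bool} (hπ : (π (!c)).toReal ≤ 1 / 3) :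
    ∀ (j m : ℕ) (a : Bool),
      (((iter (fun v => π.map fun a => voteStep a v) j (List.replicate m a)).map answer)
        (!c)).toReal ≤ (17 / 18) ^ j * (if a = c then (2 / 3 : ℝ) ^ m else (3 / 2) ^ m) := by
  intro j
  have h1 := Bool.pmf_toReal_add π c
  have h0 : 0 ≤ (π (!c)).toReal := ENNReal.toReal_nonneg
  have h0' : 0 ≤ (π c).toReal := ENNReal.toReal_nonneg
  induction j with
  | zero =>
    intro m a
    simp only [iter, PMF.pure_map, PMF.pure_apply, pow_zero, one_mul]
    split_ifs with h h'
    -- At height 0 the answer is the default `false`, which may be wrong; the potential is 1 there,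
    -- so the bound is trivial.
    · subst h'
      cases m with
      | zero => simp
      | succ m => cases a <;> simp [answer, List.replicate_succ] at h
    · simpa using one_le_pow₀ (M₀ := ℝ) (by norm_num : (1 : ℝ) ≤ 3 / 2)
    · simp; positivity
    · simp; positivity
  | succ j ih =>
    intro m a
    simp only [iter, PMF.bind_map, PMF.map_bind]
    rw [toReal_bind_bool _ _ _ c]
    simp only [Function.comp_apply]
    have key : ∀ (P P' : ℝ) (V : ℝ), 0 ≤ V → P ≤ (17 / 18) ^ j * (2 / 3 * V) →
        P' ≤ (17 / 18) ^ j * (3 / 2 * V) →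
        (π c).toReal * P + (π (!c)).toReal * P' ≤ (17 / 18) ^ (j + 1) * V := by
      intro P P' V hV hP hP'
      have hc : (π c).toReal = 1 - (π (!c)).toReal := by linarith
      calc (π c).toReal * P + (π (!c)).toReal * P'
          ≤ (π c).toReal * ((17 / 18) ^ j * (2 / 3 * V)) +
            (π (!c)).toReal * ((17 / 18) ^ j * (3 / 2 * V)) := by gcongr
        _ = (17 / 18) ^ j * V * (2 / 3 + 5 / 6 * (π (!c)).toReal) := by rw [hc]; ring
        _ ≤ (17 / 18) ^ j * V * (17 / 18) := by gcongr; linarith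
        _ = _ := by ring
    refine key _ _ _ (by positivity) ?_ ?_
    · by_cases hac : a = c
      · subst hac
        have : voteStep a (List.replicate m a) = List.replicate (m + 1) a := by
          cases m <;> simp [voteStep, List.replicate_succ]
        rw [this, if_pos rfl]
        refine (ih (m + 1) a).trans (le_of_eq ?_)
        rw [if_pos rfl, pow_succ]; ring
      · rw [if_neg hac]
        cases m with
        | zero =>
          refine (ih 1 c).trans (le_of_eq ?_)
          rw [if_pos rfl]; ring
        | succ m =>
          have : voteStep c (List.replicate (m + 1) a) = List.replicate m a := by
            simp [voteStep, List.replicate_succ, hac]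
          rw [this]
          refine (ih m a).trans (le_of_eq ?_)
          rw [if_neg hac, pow_succ]; ring
    · by_cases hac : a = c
      · subst hac
        rw [if_pos rfl]
        cases m with
        | zero =>
          refine (ih 1 (!a)).trans (le_of_eq ?_)
          rw [if_neg (by cases a <;> simp)]; ring
        | succ m =>
          have : voteStep (!a) (List.replicate (m + 1) a) = List.replicate m a := by
            cases a <;> simp [voteStep, List.replicate_succ]
          rw [this]
          refine (ih m a).trans (le_of_eq ?_)
          rw [if_pos rfl, pow_succ]; ring
      · have hac' : a = !c := by cases a <;> cases c <;> simp_all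
        subst hac'
        have : voteStep (!c) (List.replicate m (!c)) = List.replicate (m + 1) (!c) := by
          cases m <;> simp [voteStep, List.replicate_succ]
        rw [this, if_neg hac]
        refine (ih (m + 1) (!c)).trans (le_of_eq ?_)
        rw [if_neg hac, pow_succ]; ring

theorem majDist_error {π : PMF Bool} {c : Bool} (hπ : (π (!c)).toReal ≤ 1 / 3) (k : ℕ) :
    (majDist π k (!c)).toReal ≤ (17 / 18) ^ k := by
  simpa [majDist] using majority_potential hπ k 0 c

/-! ### Agreement of noisy labels with a concept -/

section
variable {n : ℕ} (D : PMF (BitStr n)) (c : Concept n) (A : BitStr n → PMF Bool)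

/-- The distribution of agreement between the random labels `A` and the concept `c`. -/
def agreeDist : PMF Bool := D.bind fun x => (A x).map fun a => a == c x

theorem agreeDist_false :
    (agreeDist D c A false).toReal = ∑ x, (D x).toReal * (A x (!c x)).toReal := by
  rw [agreeDist, PMF.bind_apply, tsum_fintype, ENNReal.toReal_sum]
  · refine Finset.sum_congr rfl fun x _ => ?_
    rw [ENNReal.toReal_mul]
    congr 2
    rw [PMF.map_apply, tsum_bool]
    cases c x <;> simp
  · exact fun x _ => ENNReal.mul_ne_top (D.apply_ne_top _) (PMF.apply_ne_top _ _)

theorem sum_toReal_eq_one : ∑ x, (D x).toReal = 1 := by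
  rw [← ENNReal.toReal_sum fun x _ => D.apply_ne_top x, ← tsum_fintype (L := .unconditional _),
    D.tsum_coe, ENNReal.toReal_one]

theorem agreeDist_false_le {η : ℝ} (hη : ∀ x, (A x (!c x)).toReal ≤ η) :
    (agreeDist D c A false).toReal ≤ η := by
  rw [agreeDist_false]
  calc ∑ x, (D x).toReal * (A x (!c x)).toReal ≤ ∑ x, (D x).toReal * η :=
        Finset.sum_le_sum fun x _ => mul_le_mul_of_nonneg_left (hη x) ENNReal.toReal_nonneg
    _ = η := by rw [← Finset.sum_mul, sum_toReal_eq_one, one_mul]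

/-- Where `h` and `c` differ, a label that follows `h` contradicts `c`, and this happens with
probability at least `1 - η`. These points have total mass at least `ε`. -/
theorem le_agreeDist_false {h : Concept n} {η ε : ℝ} (hη0 : η ≤ 1)
    (hη : ∀ x, (A x (!h x)).toReal ≤ η)
    (hε : ENNReal.ofReal ε ≤ Pr D {x | h x ≠ c x}) : ε * (1 - η) ≤ (agreeDist D c A false).toReal := by
  have herr : ε ≤ ∑ x, if h x ≠ c x then (D x).toReal else 0 := by
    have hne : Pr D {x | h x ≠ c x} = ∑ x, if h x ≠ c x then D x else 0 := by
      rw [Pr, PMF.toOuterMeasure_apply_fintype]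
      refine Finset.sum_congr rfl fun x _ => ?_
      simp only [Set.indicator_apply, Set.mem_ofPred_eq]
    rw [hne] at hε
    have := (ENNReal.ofReal_le_iff_le_toReal ?_).1 hε
    · refine this.trans (le_of_eq ?_)
      rw [ENNReal.toReal_sum]
      · exact Finset.sum_congr rfl fun x _ => by split_ifs <;> simp
      · exact fun x _ => by split_ifs <;> simp [D.apply_ne_top]
    · exact ENNReal.sum_ne_top.2 fun x _ => by split_ifs <;> simp [D.apply_ne_top]
  rw [agreeDist_false]
  calc ε * (1 - η) ≤ (∑ x, if h x ≠ c x then (D x).toReal else 0) * (1 - η) :=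
        mul_le_mul_of_nonneg_right herr (by linarith)
    _ = ∑ x, (if h x ≠ c x then (D x).toReal else 0) * (1 - η) := Finset.sum_mul _ _ _
    _ ≤ _ := by
      refine Finset.sum_le_sum fun x _ => ?_
      split_ifs with hx
      · have h1 : (!c x) = h x := by revert hx; cases h x <;> cases c x <;> simp
        rw [h1]
        have := Bool.pmf_toReal_add (A x) (h x)
        exact mul_le_mul_of_nonneg_left (by linarith [hη x]) ENNReal.toReal_nonneg
      · rw [zero_mul]; positivity

end

/-- All of `M` trials succeed with the `M`-th power of the probability of one success. -/
theorem iter_and_true {f : Bool → PMF Bool} (hf : f false = PMF.pure false) (M : ℕ) :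
    (iter f M true true).toReal = (f true true).toReal ^ M := by
  have h0 : ∀ M, iter f M false = PMF.pure false := by
    intro M
    induction M with
    | zero => rfl
    | succ M ih => rw [iter, hf, PMF.pure_bind, ih]
  induction M with
  | zero => simp [iter]
  | succ M ih =>
    rw [iter, toReal_bind_bool _ _ _ true, ih, Bool.not_true, h0]
    simp [pow_succ']

/-- The distribution of labelled examples. -/
def labelled {n : ℕ} (c : Concept n) (D : PMF (BitStr n)) : PMF (BitStr n × Bool) :=
  D.map fun x => (x, c x)

theorem exampleOracle_eq {n : ℕ} (c : Concept n) (D : PMF (BitStr n)) :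
    exampleOracle c D = oracleOf (labelled c D) := by
  rw [oracleOf, labelled, PMF.map_comp]; rfl

/-- A raised flag is absorbing and every trial draws a fresh example, so acceptance means success in
`M` independent trials. -/
theorem testDist_true {n : ℕ} (E : Prog) (c : Concept n) (D : PMF (BitStr n)) (M T : ℕ)
    (w : List Bool) :
    (testDist E (labelled c D) M T w true).toReal =
      (1 - (agreeDist D c (fun x => majDist (answerDist E [List.ofFn x, w] T) M) false).toReal) ^ M
    := by
  rw [testDist, iter_and_true]
  · have := Bool.pmf_toReal_add
      (agreeDist D c (fun x => majDist (answerDist E [List.ofFn x, w] T) M)) true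
    rw [← this, Bool.not_true, add_sub_cancel_right, agreeDist, labelled, PMF.bind_map]
    rfl
  · exact (PMF.bind_congr_support _ fun z _ => PMF.map_const _ false).trans (PMF.bind_const _ _)

/-- Failure probability of the search when concept `t` is good and bad concepts are rarely
accepted. -/
theorem iter_attempt_le {n : ℕ} {E : Prog} {μ : PMF (BitStr n × Bool)} {M T t : ℕ} {G : Set ℕ}
    (ht : t ∈ G) {β γ : ENNReal} (hβ : ∀ i < t, i ∉ G → testDist E μ M T (unary i) true ≤ β)
    (hγ : testDist E μ M T (unary t) false ≤ γ) :
    ∀ (j i : ℕ), i ≤ t → t < i + j →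
      (iter (attemptDist E μ M T) j (i, false)).toOuterMeasure {a | a.1 ∉ G} ≤ (t - i : ℕ) * β + γ
    := by
  have hacc : ∀ j i, (iter (attemptDist E μ M T) j (i, true)) = PMF.pure (i, true) := by
    intro j i
    induction j with
    | zero => rfl
    | succ j ih => rw [iter, attemptDist, PMF.pure_bind, ih]
  intro j
  induction j with
  | zero => intro i hi hj; omega
  | succ j ih =>
    intro i hi hj
    rw [iter, attemptDist, PMF.bind_map, PMF.toOuterMeasure_bind_apply, tsum_bool]
    simp only [Function.comp_apply, if_true, Bool.false_eq_true, if_false, hacc]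
    -- Before `t`, accepting `i` does no harm if `i ∈ G` and costs at most `β` otherwise, while
    -- rejection leads to the induction hypothesis. At `t`, acceptance is a success, so failure
    -- needs a rejection, of probability at most `γ`.
    rcases hi.lt_or_eq with hi | rfl
    · have h1 := ih (i + 1) hi (by omega)
      have h2 : testDist E μ M T (unary i) false ≤ 1 := PMF.coe_le_one _ _
      have h3 : testDist E μ M T (unary i) true *
          (PMF.pure (i, true)).toOuterMeasure {a | a.1 ∉ G} ≤ β := by
        by_cases hG : i ∈ G
        · simp [PMF.toOuterMeasure_pure_apply, hG]
        · calc _ ≤ β * 1 := mul_le_mul' (hβ i hi hG) (PMF.toOuterMeasure_le_one _ _)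
            _ = β := mul_one β
      calc _ ≤ 1 * (((t - (i + 1) : ℕ) : ENNReal) * β + γ) + β := by gcongr
        _ = ((t - (i + 1) + 1 : ℕ) : ENNReal) * β + γ := by push_cast; ring
        _ = _ := by congr 3; omega
    · rw [PMF.toOuterMeasure_pure_apply, if_neg (by simpa using ht), mul_zero, add_zero]
      calc _ ≤ γ * 1 := mul_le_mul' hγ (PMF.toOuterMeasure_le_one _ _)
        _ = γ := mul_one γ
        _ ≤ _ := le_add_self

/-! ## Output probabilities -/

section
variable {O : PMF (List Bool)}

theorem run_halted_mono (c : Cfg) (W : Set (List Bool)) :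
    Monotone fun T => (run O c T).toOuterMeasure {c | c.1 = [] ∧ c.2.stack 0 ∈ W} := by
  refine monotone_nat_of_le_succ fun T => ?_
  rw [run, PMF.toOuterMeasure_bind_apply, PMF.toOuterMeasure_apply]
  refine ENNReal.tsum_le_tsum fun c' => ?_
  classical
  rw [Set.indicator_apply]
  split_ifs with h
  · obtain ⟨k, s⟩ := c'
    obtain ⟨rfl, h⟩ : k = [] ∧ _ := h
    rw [step, PMF.toOuterMeasure_pure_apply, if_pos (by exact ⟨rfl, h⟩), mul_one]
  · exact zero_le

theorem Prog.HaltsWithin.prob_eq {P : Prog} {ins : List (List Bool)} {T : ℕ}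
    (h : P.HaltsWithin O ins T) (W : Set (List Bool)) :
    P.prob O ins W =
      (run O ([P], Store.init ins) T).toOuterMeasure {c | c.1 = [] ∧ c.2.stack 0 ∈ W} := by
  refine le_antisymm (iSup_le fun T' => ?_) (le_iSup (fun T => (run O ([P], Store.init
    ins) T).toOuterMeasure {c | c.1 = [] ∧ c.2.stack 0 ∈ W}) T)
  rcases le_total T' T with hT | hT
  · exact run_halted_mono _ _ hT
  · rw [Halts.run_eq (O := O) h hT]

theorem Sem.le_prob {P : Prog} {ins : List (List Bool)} {T : ℕ} {α : Type} {ν : PMF α}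
    {R : α → Store → Prop} (h : Sem O [P] (Store.init ins) T ν R) {A : Set α} {W : Set (List Bool)}
    (hW : ∀ a ∈ A, ∀ s, R a s → s.stack 0 ∈ W) : ν.toOuterMeasure A ≤ P.prob O ins W := by
  rw [Prog.HaltsWithin.prob_eq h.halts]
  obtain ⟨κ, rfl, h2, h3⟩ := h
  rw [h3, PMF.toOuterMeasure_map_apply, PMF.toOuterMeasure_map_apply]
  refine PMF.toOuterMeasure_mono _ ?_
  rintro p ⟨hp, hp'⟩
  exact ⟨rfl, hW _ hp _ (h2 _ hp')⟩

/-- `answer` reads only the top bit. This enlarges the event of the output being exactly `[f x]`, so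
the success probability stays at least `2/3`. -/
theorem answerDist_error {E : Prog} {n : ℕ} {w : List Bool} {f : Concept n} (h : E.Evaluates w f)
    (x : BitStr n) {T : ℕ} (hT : E.HaltsWithin noOracle [List.ofFn x, w] T) :
    (answerDist E [List.ofFn x, w] T (!f x)).toReal ≤ 1 / 3 := by
  have h1 := h x
  rw [hT.prob_eq] at h1
  have h2 : 2 / 3 ≤ answerDist E [List.ofFn x, w] T (f x) := by
    rw [← PMF.toOuterMeasure_apply_singleton, answerDist, PMF.toOuterMeasure_map_apply]
    refine h1.trans (MeasureTheory.measure_mono ?_)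
    rintro c ⟨-, hc⟩
    simp only [Set.mem_singleton_iff] at hc
    simp [hc, answer]
  have h3 := Bool.pmf_toReal_add (answerDist E [List.ofFn x, w] T) (f x)
  have h4 := ENNReal.toReal_mono (PMF.apply_ne_top _ _) h2
  rw [ENNReal.toReal_div] at h4
  norm_num at h4
  linarith

end

/-! ## Polynomial bounds -/

theorem eval_mono_nat (p : Polynomial ℕ) : Monotone fun x => p.eval x := by
  intro x y h
  simp only [Polynomial.eval_eq_sum, Polynomial.sum]
  gcongr

/-- The program `power` computes powers only, so polynomial sample sizes are replaced by powers. A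
base of at least 2 absorbs coefficients: `a ≤ 2 ^ a ≤ S ^ a`. -/
theorem exists_eval_le_pow (p : Polynomial ℕ) : ∃ c : ℕ, ∀ S, 2 ≤ S → p.eval S ≤ S ^ c := by
  induction p using Polynomial.induction_on' with
  | add p q hp hq =>
    obtain ⟨a, ha⟩ := hp
    obtain ⟨b, hb⟩ := hq
    refine ⟨a + b + 1, fun S hS => ?_⟩
    have h1 : S ^ a ≤ S ^ (a + b) := Nat.pow_le_pow_right (by omega) (by omega)
    have h2 : S ^ b ≤ S ^ (a + b) := Nat.pow_le_pow_right (by omega) (by omega)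
    rw [Polynomial.eval_add, pow_succ]
    have := ha S hS
    have := hb S hS
    nlinarith
  | monomial k a =>
    refine ⟨a + k, fun S hS => ?_⟩
    rw [Polynomial.eval_monomial, pow_add]
    refine Nat.mul_le_mul_right _ ?_
    exact (Nat.lt_two_pow_self).le.trans (Nat.pow_le_pow_left hS a)

/-- Functions bounded by a polynomial. -/
def PolyBdd (f : ℕ → ℕ) : Prop := ∃ p : Polynomial ℕ, ∀ x, f x ≤ p.eval x

theorem PolyBdd.eval (p : Polynomial ℕ) : PolyBdd fun x => p.eval x := ⟨p, fun _ => le_rfl⟩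

theorem PolyBdd.id : PolyBdd fun x => x := ⟨Polynomial.X, by simp⟩

theorem PolyBdd.const (a : ℕ) : PolyBdd fun _ => a := ⟨Polynomial.C a, by simp⟩

theorem PolyBdd.add {f g : ℕ → ℕ} (hf : PolyBdd f) (hg : PolyBdd g) :
    PolyBdd fun x => f x + g x := by
  obtain ⟨p, hp⟩ := hf
  obtain ⟨q, hq⟩ := hg
  exact ⟨p + q, fun x => by rw [Polynomial.eval_add]; exact add_le_add (hp x) (hq x)⟩

theorem PolyBdd.mul {f g : ℕ → ℕ} (hf : PolyBdd f) (hg : PolyBdd g) :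
    PolyBdd fun x => f x * g x := by
  obtain ⟨p, hp⟩ := hf
  obtain ⟨q, hq⟩ := hg
  exact ⟨p * q, fun x => by rw [Polynomial.eval_mul]; exact Nat.mul_le_mul (hp x) (hq x)⟩

theorem PolyBdd.pow {f : ℕ → ℕ} (hf : PolyBdd f) (c : ℕ) : PolyBdd fun x => f x ^ c := by
  obtain ⟨p, hp⟩ := hf
  exact ⟨p ^ c, fun x => by rw [Polynomial.eval_pow]; exact Nat.pow_le_pow_left (hp x) c⟩

theorem PolyBdd.comp (q : Polynomial ℕ) {f : ℕ → ℕ} (hf : PolyBdd f) :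
    PolyBdd fun x => q.eval (f x) := by
  obtain ⟨p, hp⟩ := hf
  exact ⟨q.comp p, fun x => by rw [Polynomial.eval_comp]; exact eval_mono_nat q (hp x)⟩

/-! ## Quantum learnability -/

theorem Prog.all_of_forall {S : Instr → Prop} (h : ∀ a, S a) : ∀ P : Prog, P.All S
  | .instr a => h a
  | .seq p q => ⟨all_of_forall h p, all_of_forall h q⟩
  | .branch _ e f t => ⟨all_of_forall h e, all_of_forall h f, all_of_forall h t⟩
  | .loop _ p => all_of_forall (S := S) h p

/-- Bernoulli's inequality gives `M x ≤ (1 + x)^M`, and `(1 - x)(1 + x) ≤ 1`. Decay of order `1/M`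
is enough because `M` can be any power of `S`. -/
theorem one_sub_pow_le {x : ℝ} (hx0 : 0 < x) (hx : x ≤ 1) {M : ℕ} (hM : 0 < M) :
    (1 - x) ^ M ≤ 1 / (M * x) := by
  have hMx : 0 < M * x := by positivity
  rw [le_div_iff₀ hMx]
  have h1 : (M : ℝ) * x ≤ (1 + x) ^ M := by
    have := one_add_mul_le_pow (by linarith : (-2 : ℝ) ≤ x) M
    linarith
  calc (1 - x) ^ M * (M * x) ≤ (1 - x) ^ M * (1 + x) ^ M :=
        mul_le_mul_of_nonneg_left h1 (pow_nonneg (by linarith) _)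
    _ = (1 - x ^ 2) ^ M := by rw [← mul_pow]; ring
    _ ≤ 1 := pow_le_one₀ (by nlinarith) (by nlinarith)

/-- Since `17/18 ≤ (35/36)^2`, the previous bound applies twice and beats the factor `M`: the result
is `M * (36/M)^2`, with `36^2 = 1296`. -/
theorem mul_pow_majority_le {M : ℕ} (hM : 0 < M) : M * (17 / 18 : ℝ) ^ M ≤ 1296 / M := by
  have h := one_sub_pow_le (x := 1 / 36) (by norm_num) (by norm_num) hM
  have hM' : (0 : ℝ) < M := by exact_mod_cast hM
  calc M * (17 / 18 : ℝ) ^ M ≤ M * ((1 - 1 / 36) ^ M * (1 - 1 / 36) ^ M) := by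
        rw [← mul_pow]
        gcongr
        norm_num
    _ ≤ M * (1 / (M * (1 / 36)) * (1 / (M * (1 / 36)))) := by
        have : (0 : ℝ) ≤ (1 - 1 / 36) ^ M := by positivity
        gcongr
    _ = 1296 / M := by field_simp; norm_num

/-- Half of `δ` goes to each kind of failure: `hM` gives `t * (2/(Mε)) ≤ δ/2` for bad concepts
before `t`, and `hM'` gives `1296/M ≤ δ/2` for the rejection of `t`. By `htM` the search gets as far
as `t`. -/
theorem searchDist_failure {n : ℕ} {E : Prog} {D : PMF (BitStr n)} {M T t : ℕ} {G : Set ℕ}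
    {ε δ : ℝ} (hε : 0 < ε) (hε1 : ε < 1 / 2) (hδ : 0 < δ) (hδ1 : δ < 1 / 2) {e : ℕ → Concept n}
    (hM : 4 * t ≤ M * ε * δ) (hM' : 2592 ≤ M * δ) (htM : t < M)
    (hE : ∀ i ≤ t, E.Evaluates (unary i) (e i))
    (hT : ∀ i ≤ t, ∀ x : BitStr n, E.HaltsWithin noOracle [List.ofFn x, unary i] T)
    (hG : ∀ i < t, i ∉ G → ENNReal.ofReal ε ≤ Pr D {x | e i x ≠ e t x}) (ht : t ∈ G) :
    ENNReal.ofReal (1 - δ) ≤ (searchDist E (labelled (e t) D) M T).toOuterMeasure G := by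
  have hM0 : 0 < M := by omega
  have hMr : (0 : ℝ) < M := by exact_mod_cast hM0
  have hη := mul_pow_majority_le hM0
  have hηδ : (1296 : ℝ) / M ≤ δ / 2 := by rw [div_le_iff₀ hMr]; linarith
  set η : ℝ := (17 / 18) ^ M with hηdef
  have hη0 : 0 ≤ η := by positivity
  have hη1 : η ≤ 1 / 2 := by
    have : (1 : ℝ) ≤ M := by exact_mod_cast hM0
    nlinarith
  have herr : ∀ i ≤ t, ∀ x, (majDist (answerDist E [List.ofFn x, unary i] T) M (!e i x)).toReal ≤ η :=
    fun i hi x => majDist_error (answerDist_error (hE i hi) x (hT i hi x)) M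
  have hβ : ∀ i < t, i ∉ G → testDist E (labelled (e t) D) M T (unary i) true ≤
      ENNReal.ofReal (2 / (M * ε)) := by
    intro i hi hiG
    rw [← ENNReal.ofReal_toReal (PMF.apply_ne_top _ true), testDist_true]
    refine ENNReal.ofReal_le_ofReal ?_
    have h1 := le_agreeDist_false D (e t)
      (fun x => majDist (answerDist E [List.ofFn x, unary i] T) M) (by linarith)
      (herr i hi.le) (hG i hi hiG)
    set qf := (agreeDist D (e t) (fun x => majDist (answerDist E [List.ofFn x, unary i] T) M)
      false).toReal
    have hq1 : qf ≤ 1 := by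
      have := Bool.pmf_toReal_add (agreeDist D (e t)
        (fun x => majDist (answerDist E [List.ofFn x, unary i] T) M)) false
      have h0 : 0 ≤ (agreeDist D (e t)
        (fun x => majDist (answerDist E [List.ofFn x, unary i] T) M) (!false)).toReal :=
        ENNReal.toReal_nonneg
      simp only [qf]; linarith
    -- From `ε * (1 - η) ≤ qf` and `η ≤ 1/2`: noise in the votes costs at most half of the
    -- detectable error.
    have h2 : ε / 2 ≤ qf := by nlinarith
    calc (1 - qf) ^ M ≤ (1 - ε / 2) ^ M := pow_le_pow_left₀ (by linarith) (by linarith) _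
      _ ≤ 1 / (M * (ε / 2)) := one_sub_pow_le (by linarith) (by linarith) hM0
      _ = 2 / (M * ε) := by field_simp
  have hγ : testDist E (labelled (e t) D) M T (unary t) false ≤ ENNReal.ofReal (δ / 2) := by
    rw [← ENNReal.ofReal_toReal (PMF.apply_ne_top _ false)]
    refine ENNReal.ofReal_le_ofReal ?_
    have h1 := agreeDist_false_le D (e t)
      (fun x => majDist (answerDist E [List.ofFn x, unary t] T) M) (herr t le_rfl)
    have h2 := testDist_true E (e t) D M T (unary t)
    have h3 := Bool.pmf_toReal_add (testDist E (labelled (e t) D) M T (unary t)) true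
    set qf := (agreeDist D (e t) (fun x => majDist (answerDist E [List.ofFn x, unary t] T) M)
      false).toReal
    have h4 := one_add_mul_le_pow (by linarith : (-2 : ℝ) ≤ -qf) M
    rw [← sub_eq_add_neg] at h4
    simp only [Bool.not_true] at h3
    have : (M : ℝ) * qf ≤ M * η := by gcongr
    linarith
  have key := iter_attempt_le (M := M) (T := T) ht hβ hγ M 0 (Nat.zero_le _) (by omega)
  have hsum : ((t - 0 : ℕ) : ENNReal) * ENNReal.ofReal (2 / (M * ε)) + ENNReal.ofReal (δ / 2) ≤
      ENNReal.ofReal δ := by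
    rw [← ENNReal.ofReal_natCast, ← ENNReal.ofReal_mul (by positivity),
      ← ENNReal.ofReal_add (by positivity) (by positivity)]
    refine ENNReal.ofReal_le_ofReal ?_
    have : (t : ℝ) * (2 / (M * ε)) ≤ δ / 2 := by
      rw [← mul_div_assoc, div_le_iff₀ (by positivity)]
      linarith
    simp only [Nat.sub_zero]
    linarith
  rw [searchDist, PMF.toOuterMeasure_map_apply, ENNReal.ofReal_sub _ hδ.le, ENNReal.ofReal_one,
    tsub_le_iff_right]
  set p := iter (attemptDist E (labelled (e t) D) M T) M (0, false)
  calc (1 : ENNReal) = p.toOuterMeasure Set.univ := by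
        rw [PMF.toOuterMeasure_apply, Set.indicator_univ, p.tsum_coe]
    _ ≤ p.toOuterMeasure (Prod.fst ⁻¹' G ∪ {a | a.1 ∉ G}) :=
        MeasureTheory.measure_mono fun a _ => em (a.1 ∈ G)
    _ ≤ _ := MeasureTheory.measure_union_le _ _
    _ ≤ _ := by gcongr; exact key.trans hsum

theorem polyBdd_powerTime (c : ℕ) : PolyBdd fun S => powerTime S c := by
  induction c with
  | zero => exact PolyBdd.const 1
  | succ c ih =>
    exact (ih.add ((PolyBdd.id.pow c).mul (((PolyBdd.const 12).mul PolyBdd.id).add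
      (PolyBdd.const 11)))).add (PolyBdd.const 4)

theorem polyBdd_attemptTime (b : ℕ) {n M T : ℕ → ℕ} (hn : PolyBdd n) (hM : PolyBdd M)
    (hT : PolyBdd T) : PolyBdd fun x => attemptTime b (n x) (M x) (T x) := by
  have k := PolyBdd.const
  exact ((hM.mul (((hM.add (k 1)).mul (((k (b + 20)).mul (((k 2).mul ((hn.add hM).add hT)).add
    (k 2))).add (k 37))).add (k 3))).add ((k 12).mul hM)).add (k 20)

theorem polyBdd_learnerTime (b c : ℕ) {T : ℕ → ℕ} (hT : PolyBdd T) :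
    PolyBdd fun S => learnerTime b c S (T S) := by
  have k := PolyBdd.const
  exact (((polyBdd_powerTime c).add ((PolyBdd.id.pow c).mul ((polyBdd_attemptTime b PolyBdd.id
    (PolyBdd.id.pow c) hT).add (k 20)))).add ((k 5).mul PolyBdd.id)).add (k 20)

/-! ### Hypotheses given by their numbers, and membership in `QQ` -/

open Classical in
/-- The concepts of a list, specified by their numbers in unary. -/
def listHypotheses (m : ℕ → ℕ) (e : ∀ n, ℕ → Concept n) : HypothesisClass := fun n σ =>
  if σ = unary σ.length ∧ σ.length < m n then some (e n σ.length) else none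

theorem listHypotheses_eq_some {m : ℕ → ℕ} {e : ∀ n, ℕ → Concept n} {n : ℕ} {σ : List Bool}
    {h : Concept n} (hσ : listHypotheses m e n σ = some h) :
    ∃ i < m n, σ = unary i ∧ h = e n i := by
  unfold listHypotheses at hσ
  split_ifs at hσ with hc
  exact ⟨σ.length, hc.2, hc.1, (Option.some.inj hσ).symm⟩

theorem listHypotheses_unary {m : ℕ → ℕ} {e : ∀ n, ℕ → Concept n} {n i : ℕ} (hi : i < m n) :
    listHypotheses m e n (unary i) = some (e n i) := by
  simp [listHypotheses, unary, hi]

theorem qq_of_quantumEvaluable {C : ∀ n, Set (Concept n)} {D : ∀ n, PMF (BitStr n)}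
    (ha : QuantumEvaluable C) (hb : ∃ p : Polynomial ℕ, ∀ n : ℕ, (C n).ncard ≤ p.eval n) :
    QQ C D := by
  obtain ⟨E, m, e, q, ⟨hEq, t, hEt⟩, hE⟩ := ha
  obtain ⟨p, hp⟩ := hb
  refine ⟨listHypotheses m e, ⟨E, Prog.all_of_forall (fun _ => trivial) E, ⟨hEq, t, hEt⟩, ?_⟩, ?_⟩
  · intro n σ h hσ
    obtain ⟨i, hi, rfl, rfl⟩ := listHypotheses_eq_some hσ
    exact (hE n).2.2 i hi
  obtain ⟨b, hb⟩ := E.exists_bound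
  -- Two more stacks, so that both inputs of the evaluator surely lie inside its workspace.
  have hb := hb.mono (S' := (· < b + 2)) fun i hi => by omega
  -- `B` bounds the length of the list, since `m n ≤ q (n + |C n|)` and `|C n| ≤ p n`.
  set B : Polynomial ℕ := q.comp (Polynomial.X + p) with hB
  -- One summand for each demand of `searchDist_failure`: as `1/ε, 1/δ ≤ S`, the term `4 * B * X ^
  -- 2` gives `4 t ≤ M ε δ`, the term `2592 * X` gives `2592 ≤ M δ`, and `B + 1` lets the search
  -- reach the target.
  obtain ⟨c, hc⟩ := exists_eval_le_pow
    (4 * B * Polynomial.X ^ 2 + 2592 * Polynomial.X + B + 1 : Polynomial ℕ)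
  obtain ⟨P, hP⟩ := polyBdd_learnerTime (b + 2) c
    (PolyBdd.comp t (PolyBdd.id.add (PolyBdd.id.pow c)))
  refine ⟨learner E (b + 2) c, P.comp (Polynomial.X + 2), Prog.all_of_forall (fun _ => trivial) _,
    fun n ε δ hε hε1 hδ hδ1 => ?_⟩
  set S := n + ⌊1 / ε⌋₊ + ⌊1 / δ⌋₊ + 2 with hS
  set T := t.eval (S + S ^ c) with hT
  have hhalt : ∀ (x : BitStr n), ∀ i ≤ S ^ c,
      E.HaltsWithin noOracle [List.ofFn x, unary i] T := by
    intro x i hi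
    refine Halts.mono (hEt [List.ofFn x, unary i] rfl) (eval_mono_nat t ?_)
    simp [unary]; omega
  have sem := fun μ : PMF (BitStr n × Bool) =>
    sem_learner (μ := μ) hEq hb (by omega) (c := c) hS.symm hhalt
  have hSP : learnerTime (b + 2) c S T ≤
      (P.comp (Polynomial.X + 2)).eval (n + ⌊1 / ε⌋₊ + ⌊1 / δ⌋₊) := by
    have hX : (Polynomial.X + 2 : Polynomial ℕ).eval (n + ⌊1 / ε⌋₊ + ⌊1 / δ⌋₊) = S := by
      rw [Polynomial.eval_add, Polynomial.eval_X, Polynomial.eval_ofNat]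
    rw [Polynomial.eval_comp, hX]
    exact hP S
  refine ⟨fun μ => (sem μ).halts.mono hSP, fun c' hc' => ?_⟩
  rw [(hE n).1] at hc'
  obtain ⟨i, hi, rfl⟩ := hc'
  replace hi : i < m n := hi
  rw [exampleOracle_eq]
  refine le_trans ?_ ((sem _).le_prob (A := {j | unary j ∈ goodSpecs (listHypotheses m e) (e n i)
    (D n) ε}) fun j hj s hs => by rw [hs]; exact hj)
  have hiB : i < B.eval S := by
    refine lt_of_lt_of_le hi ((hE n).2.1.trans ?_)
    rw [hB, Polynomial.eval_comp]
    refine eval_mono_nat q ?_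
    rw [Polynomial.eval_add, Polynomial.eval_X]
    exact add_le_add (by omega) ((hp n).trans (eval_mono_nat p (by omega)))
  have hcS := hc S (by omega)
  simp only [Polynomial.eval_add, Polynomial.eval_mul, Polynomial.eval_pow, Polynomial.eval_X,
    Polynomial.eval_ofNat, Polynomial.eval_one] at hcS
  have hcSr : 4 * ((B.eval S : ℕ) : ℝ) * (S : ℝ) ^ 2 + 2592 * S + ((B.eval S : ℕ) : ℝ) + 1 ≤ ((S ^ c : ℕ) : ℝ) := by
    exact_mod_cast hcS
  have hiBr : (i : ℝ) ≤ B.eval S := by exact_mod_cast hiB.le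
  -- The floor loses less than 1, which the summand 2 in `S` makes up for.
  have hinv : ∀ y : ℝ, 0 < y → ⌊1 / y⌋₊ + 1 ≤ S → 1 ≤ S * y := by
    intro y hy hyS
    have h1 := Nat.lt_floor_add_one (1 / y)
    have h2 : ((⌊1 / y⌋₊ : ℝ)) + 1 ≤ S := by exact_mod_cast hyS
    have h3 := (div_lt_iff₀ hy).1 (h1.trans_le h2)
    exact h3.le
  have hSε := hinv ε hε (by omega)
  have hSδ := hinv δ hδ (by omega)
  have hS0 : (0 : ℝ) ≤ S := Nat.cast_nonneg _
  refine searchDist_failure hε hε1 hδ hδ1 (M := S ^ c) ?_ ?_ ?_ (fun j hj => (hE n).2.2 j (by omega))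
    (fun j hj x => hhalt x j ?_) ?_ ?_
  · have h1 : (1 : ℝ) ≤ (S * ε) * (S * δ) := by nlinarith
    calc 4 * (i : ℝ) ≤ 4 * B.eval S * ((S * ε) * (S * δ)) := by
          have : (0 : ℝ) ≤ B.eval S := Nat.cast_nonneg _
          nlinarith
      _ = 4 * B.eval S * (S : ℝ) ^ 2 * ε * δ := by ring
      _ ≤ ((S ^ c : ℕ) : ℝ) * ε * δ := by
          have : (0 : ℝ) ≤ B.eval S := Nat.cast_nonneg _
          gcongr
          linarith
  · calc (2592 : ℝ) ≤ 2592 * (S * δ) := by linarith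
      _ = 2592 * S * δ := by ring
      _ ≤ ((S ^ c : ℕ) : ℝ) * δ := by
          have : (0 : ℝ) ≤ 4 * B.eval S * (S : ℝ) ^ 2 := by positivity
          have : (0 : ℝ) ≤ B.eval S := Nat.cast_nonneg _
          gcongr
          linarith
  · have : 0 ≤ 4 * B.eval S * S ^ 2 := Nat.zero_le _
    omega
  · have : 0 ≤ 4 * B.eval S * S ^ 2 := Nat.zero_le _
    omega
  · intro j hj hjG
    by_contra hlt
    exact hjG ⟨e n j, listHypotheses_unary (by omega), (not_le.1 hlt).le⟩
  · refine ⟨e n i, listHypotheses_unary hi, ?_⟩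
    simp [Pr]

/-! ## Derandomization: coins read from a tape -/

section
variable {O : PMF (List Bool)}

/-- Stack operations, coins and preparations of the quantum register. -/
def Instr.IsRandomized : Instr → Prop
  | .push _ _ => True
  | .pop _ => True
  | .coin _ => True
  | .qinit => True
  | _ => False

/-- One step of computation with the coins taken from a tape. -/
def tapeStep : Cfg → List Bool → Cfg × List Bool
  | ([], s), r => (([], s), r)
  | (.instr (.push b i) :: k, s), r => ((k, s.set i (b :: s.stack i)), r)
  | (.instr (.pop i) :: k, s), r => ((k, s.set i (s.stack i).tail), r)
  | (.instr (.coin i) :: k, s), r => ((k, s.set i (r.headD false :: s.stack i)), r.tail)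
  | (.instr .qinit :: k, s), r => ((k, { s with reg := QState.zero }), r)
  | (.instr _ :: k, s), r => ((k, s), r)
  | (.seq p q :: k, s), r => ((p :: q :: k, s), r)
  | (.branch i e f t :: k, s), r =>
      match s.stack i with
      | [] => ((e :: k, s), r)
      | false :: _ => ((f :: k, s), r)
      | true :: _ => ((t :: k, s), r)
  | (.loop i p :: k, s), r =>
      match s.stack i with
      | [] => ((k, s), r)
      | _ :: _ => ((p :: .loop i p :: k, s), r)

/-- `T` steps of computation with the coins taken from a tape. -/
def tapeRun : ℕ → Cfg → List Bool → Cfg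
  | 0, c, _ => c
  | T + 1, c, r => tapeRun T (tapeStep c r).1 (tapeStep c r).2

/-- Uniformly random bit strings. -/
def tapeDist : ℕ → PMF (List Bool)
  | 0 => PMF.pure []
  | L + 1 => (PMF.uniformOfFintype Bool).bind fun b => (tapeDist L).map (b :: ·)

theorem length_of_mem_tapeDist : ∀ {L : ℕ} {r : List Bool}, r ∈ (tapeDist L).support → r.length = L
  | 0, r, h => by
    simp only [tapeDist, PMF.support_pure, Set.mem_singleton_iff] at h
    simp [h]
  | L + 1, r, h => by
    obtain ⟨b, -, h⟩ := (PMF.mem_support_bind_iff _ _ _).1 h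
    obtain ⟨r', hr', rfl⟩ := (PMF.mem_support_map_iff _ _ _).1 h
    simp [length_of_mem_tapeDist hr']

/-- The step consumes no coin and is deterministic, or it consumes one. -/
theorem step_cases {c : Cfg} (hc : ∀ P ∈ c.1, P.All Instr.IsRandomized) :
    (∃ c', step O c = PMF.pure c' ∧ ∀ r, tapeStep c r = (c', r)) ∨
    ∃ g : Bool → Cfg, step O c = (PMF.uniformOfFintype Bool).map g ∧
      ∀ r, tapeStep c r = (g (r.headD false), r.tail) := by
  obtain ⟨k, s⟩ := c
  cases k with
  | nil => exact Or.inl ⟨([], s), rfl, fun _ => rfl⟩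
  | cons P k =>
    have hP := hc P List.mem_cons_self
    cases P with
    | instr a =>
      cases a
      case push b i =>
        exact Or.inl ⟨_, by simp only [step, Instr.exec, PMF.pure_map], fun _ => rfl⟩
      case pop i =>
        exact Or.inl ⟨_, by simp only [step, Instr.exec, PMF.pure_map], fun _ => rfl⟩
      case qinit =>
        exact Or.inl ⟨_, by simp only [step, Instr.exec, PMF.pure_map], fun _ => rfl⟩
      case coin i =>
        refine Or.inr ⟨fun b => (k, s.set i (b :: s.stack i)), ?_, fun _ => rfl⟩
        simp only [step, Instr.exec, PMF.map_comp]; rfl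
      all_goals exact hP.elim
    | seq p q => exact Or.inl ⟨(p :: q :: k, s), rfl, fun _ => rfl⟩
    | branch i e f t =>
      left
      rcases hi : s.stack i with _ | ⟨_ | _, w⟩
      · exact ⟨(e :: k, s), by simp only [step, hi], fun r => by simp only [tapeStep, hi]⟩
      · exact ⟨(f :: k, s), by simp only [step, hi], fun r => by simp only [tapeStep, hi]⟩
      · exact ⟨(t :: k, s), by simp only [step, hi], fun r => by simp only [tapeStep, hi]⟩
    | loop i p =>
      left
      rcases hi : s.stack i with _ | ⟨b, w⟩
      · exact ⟨(k, s), by simp only [step, hi], fun r => by simp only [tapeStep, hi]⟩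
      · exact ⟨(p :: .loop i p :: k, s), by simp only [step, hi],
          fun r => by simp only [tapeStep, hi]⟩

/-- A step uses at most one coin, so `T` random bits suffice for `T` steps and the unread rest of a
longer tape is irrelevant. -/
theorem run_eq_tapeRun (T : ℕ) : ∀ {c : Cfg}, (∀ P ∈ c.1, P.All Instr.IsRandomized) →
    ∀ {L : ℕ}, T ≤ L → run O c T = (tapeDist L).map (tapeRun T c) := by
  induction T with
  | zero =>
    intro c _ L _
    exact (PMF.map_const _ c).symm
  | succ T ih =>
    intro c hc L hL
    have hered := fun c' => (hereditary_all _).step (O := O) (c := c) (c' := c') hc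
    rw [run_succ']
    rcases step_cases (O := O) hc with ⟨c', h, h'⟩ | ⟨g, h, h'⟩
    · rw [h, PMF.pure_bind, ih (hered c' (by simp [h])) (L := L) (by omega)]
      congr 1
      funext r
      rw [tapeRun, h']
    · obtain ⟨L, rfl⟩ := Nat.exists_eq_add_of_le' (show 1 ≤ L by omega)
      rw [h, PMF.bind_map, tapeDist, PMF.map_bind]
      refine PMF.bind_congr_support _ fun b _ => ?_
      rw [Function.comp_apply, ih (hered (g b) (by
        rw [h, PMF.mem_support_map_iff]; exact ⟨b, by simp, rfl⟩)) (L := L) (by omega),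
        PMF.map_comp]
      congr 1
      funext r
      simp only [Function.comp_apply]
      rw [tapeRun, h']
      rfl

/-- Whatever surely holds of the random computation, halting in particular, holds for every tape.
Short tapes are included, since missing bits are read as `false`; so tapes from meaningless advice
are covered. -/
theorem tapeRun_mem_support (T : ℕ) : ∀ {c : Cfg}, (∀ P ∈ c.1, P.All Instr.IsRandomized) →
    ∀ r, tapeRun T c r ∈ (run O c T).support := by
  induction T with
  | zero => intro c _ r; simp [run, tapeRun]
  | succ T ih =>
    intro c hc r
    have hmem : (tapeStep c r).1 ∈ (step O c).support := by
      rcases step_cases (O := O) hc with ⟨c', h, h'⟩ | ⟨g, h, h'⟩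
      · rw [h, h']; simp
      · rw [h, h', PMF.mem_support_map_iff]; exact ⟨_, by simp, rfl⟩
    rw [run_succ', PMF.mem_support_bind_iff]
    exact ⟨_, hmem, ih ((hereditary_all _).step hc hmem) _⟩

/-- Take coins from stack `τ`. -/
def Instr.derand (τ : ℕ) : Instr → Prog
  | .push b i => .instr (.push b i)
  | .pop i => .instr (.pop i)
  | .coin i => .branch τ (.instr (.push false i)) (.seq (.instr (.pop τ)) (.instr (.push false i)))
      (.seq (.instr (.pop τ)) (.instr (.push true i)))
  -- A no-op. Among the instructions allowed by `IsRandomized` only `qinit` gets here, and it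
  -- affects no stack.
  | _ => .seq (.instr (.push false τ)) (.instr (.pop τ))

/-- Take coins from stack `τ`. -/
def Prog.derand (τ : ℕ) : Prog → Prog
  | .instr a => a.derand τ
  | .seq p q => .seq (p.derand τ) (q.derand τ)
  | .branch i e f t => .branch i (e.derand τ) (f.derand τ) (t.derand τ)
  | .loop i p => .loop i (p.derand τ)

theorem Prog.derand_isDeterministic (τ : ℕ) : ∀ P : Prog, (P.derand τ).All Instr.IsDeterministic
  | .instr a => by cases a <;> simp [Prog.derand, Instr.derand, Prog.All, Instr.IsDeterministic]
  | .seq p q => ⟨p.derand_isDeterministic τ, q.derand_isDeterministic τ⟩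
  | .branch _ e f t =>
    ⟨e.derand_isDeterministic τ, f.derand_isDeterministic τ, t.derand_isDeterministic τ⟩
  | .loop _ p => p.derand_isDeterministic τ

/-- The stacks of `s'` are those of `s`, with the tape `r` on stack `τ`. -/
def TapeOn (τ : ℕ) (s : Store) (r : List Bool) (s' : Store) : Prop :=
  (∀ j, j ≠ τ → s'.stack j = s.stack j) ∧ s'.stack τ = r

theorem TapeOn.set {τ : ℕ} {s s' : Store} {r : List Bool} (h : TapeOn τ s r s') {i : ℕ}
    (hi : i ≠ τ) (w : List Bool) : TapeOn τ (s.set i w) r (s'.set i w) := by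
  refine ⟨fun j hj => ?_, ?_⟩
  · simp only [Store.set_stack, h.1 j hj]
  · rw [Store.set_stack, if_neg hi.symm, h.2]

theorem TapeOn.set_tape {τ : ℕ} {s s' : Store} {r : List Bool} (h : TapeOn τ s r s')
    (r' : List Bool) : TapeOn τ s r' (s'.set τ r') :=
  ⟨fun j hj => by rw [Store.set_stack, if_neg hj, h.1 j hj], by simp [Store.set_stack]⟩

theorem tapeRun_nil (T : ℕ) (s : Store) (r : List Bool) : tapeRun T ([], s) r = ([], s) := by
  induction T with
  | zero => rfl
  | succ T ih => exact ih

/-- The derandomized program follows the program with a tape. -/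
theorem exists_det_derand {τ : ℕ} (T : ℕ) : ∀ {k : List Prog} {s s' : Store} {r : List Bool},
    (∀ P ∈ k, P.All Instr.IsRandomized) → (∀ P ∈ k, P.Stacks (· ≠ τ)) → TapeOn τ s r s' →
    (tapeRun T (k, s) r).1 = [] →
    ∃ s'', Det O (k.map (Prog.derand τ)) s' (4 * T) s'' ∧
      ∀ j, j ≠ τ → s''.stack j = (tapeRun T (k, s) r).2.stack j := by
  induction T with
  | zero =>
    intro k s s' r _ _ hs hk
    obtain rfl : k = [] := hk
    exact ⟨s', Det.nil, fun j hj => hs.1 j hj⟩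
  | succ T ih =>
    intro k s s' r hR hτ hs hk
    cases k with
    | nil =>
      refine ⟨s', Sem.nil rfl, fun j hj => ?_⟩
      rw [tapeRun_nil]; exact hs.1 j hj
    | cons P k =>
      have hPR := hR P List.mem_cons_self
      have hPτ := hτ P List.mem_cons_self
      have hR' : ∀ P ∈ k, P.All Instr.IsRandomized := fun Q hQ => hR Q (List.mem_cons_of_mem _ hQ)
      have hτ' : ∀ P ∈ k, P.Stacks (· ≠ τ) := fun Q hQ => hτ Q (List.mem_cons_of_mem _ hQ)
      cases P with
      | instr a =>
        cases a
        case push b i =>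
          obtain ⟨s'', h1, h2⟩ := ih hR' hτ' (hs.set hPτ (b :: s.stack i)) hk
          refine ⟨s'', Sem.mono (Sem.push (T := 4 * T) ?_) (by omega), h2⟩
          rw [hs.1 i hPτ]; exact h1
        case pop i =>
          obtain ⟨s'', h1, h2⟩ := ih hR' hτ' (hs.set hPτ (s.stack i).tail) hk
          refine ⟨s'', Sem.mono (Sem.pop (T := 4 * T) ?_) (by omega), h2⟩
          rw [hs.1 i hPτ]; exact h1
        case qinit =>
          -- `TapeOn` ignores the register, so skipping `qinit` preserves it.
          have hs' : TapeOn τ { s with reg := QState.zero } r s' := hs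
          obtain ⟨s'', h1, h2⟩ := ih hR' hτ' hs' hk
          refine ⟨s'', Sem.mono (Sem.seq (Sem.push (Sem.pop (T := 4 * T) ?_))) (by omega), h2⟩
          have heq : (s'.set τ (false :: s'.stack τ)).set τ
              ((s'.set τ (false :: s'.stack τ)).stack τ).tail = s' := by
            refine Store.ext' (fun j => ?_) rfl
            simp only [Store.set_stack]
            split_ifs <;> simp_all
          rw [heq]; exact h1
        case coin i =>
          obtain ⟨s'', h1, h2⟩ := ih hR' hτ'
            ((hs.set_tape r.tail).set hPτ (r.headD false :: s.stack i)) hk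
          refine ⟨s'', ?_, h2⟩
          rw [← hs.1 i hPτ] at h1
          cases r with
          | nil =>
            refine Sem.mono (Sem.branch_nil hs.2 (Sem.push (T := 4 * T) ?_)) (by omega)
            rw [List.tail_nil, Store.set_self hs.2] at h1
            exact h1
          -- Reading a coin takes a branch, a `seq`, a pop and a push: this is the worst case and
          -- the source of the factor 4.
          | cons b r =>
            refine Sem.mono (Sem.branch_cons hs.2 (T := 4 * T + 3) ?_) (by omega)
            have hst : (s'.set τ r).stack i = s'.stack i := by
              rw [Store.set_stack, if_neg hPτ]
            have key : Sem O (.seq (.instr (.pop τ)) (.instr (.push b i)) :: k.map (Prog.derand τ))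
                s' (4 * T + 3) (PMF.pure ()) fun _ x => x = s'' := by
              refine Sem.seq (Sem.pop (Sem.push ?_))
              rw [hs.2, List.tail_cons, hst]
              exact h1
            cases b
            · exact key
            · exact key
        all_goals exact hPR.elim
      | seq p q =>
        obtain ⟨s'', h1, h2⟩ := ih (k := p :: q :: k) (by simpa using ⟨hPR.1, hPR.2, hR'⟩)
          (by simpa using ⟨hPτ.1, hPτ.2, hτ'⟩) hs hk
        exact ⟨s'', Sem.mono (Sem.seq (T := 4 * T) h1) (by omega), h2⟩
      | branch i e f t =>
        obtain ⟨hi, he, hf, ht⟩ := hPτ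
        obtain ⟨he', hf', ht'⟩ := hPR
        rcases hw : s.stack i with _ | ⟨_ | _, w⟩
        · simp only [tapeRun, tapeStep, hw] at hk ⊢
          obtain ⟨s'', h1, h2⟩ := ih (k := e :: k) (by simpa using ⟨he', hR'⟩)
            (by simpa using ⟨he, hτ'⟩) hs hk
          exact ⟨s'', Sem.mono (Sem.branch_nil (T := 4 * T) ((hs.1 i hi).trans hw) h1)
            (by omega), h2⟩
        · simp only [tapeRun, tapeStep, hw] at hk ⊢
          obtain ⟨s'', h1, h2⟩ := ih (k := f :: k) (by simpa using ⟨hf', hR'⟩)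
            (by simpa using ⟨hf, hτ'⟩) hs hk
          exact ⟨s'', Sem.mono (Sem.branch_cons (T := 4 * T) ((hs.1 i hi).trans hw) h1)
            (by omega), h2⟩
        · simp only [tapeRun, tapeStep, hw] at hk ⊢
          obtain ⟨s'', h1, h2⟩ := ih (k := t :: k) (by simpa using ⟨ht', hR'⟩)
            (by simpa using ⟨ht, hτ'⟩) hs hk
          exact ⟨s'', Sem.mono (Sem.branch_cons (T := 4 * T) ((hs.1 i hi).trans hw) h1)
            (by omega), h2⟩
      | loop i p =>
        obtain ⟨hi, hp⟩ := hPτ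
        rcases hw : s.stack i with _ | ⟨b, w⟩
        · simp only [tapeRun, tapeStep, hw] at hk ⊢
          obtain ⟨s'', h1, h2⟩ := ih hR' hτ' hs hk
          exact ⟨s'', Sem.mono (Sem.loop_nil (T := 4 * T) ((hs.1 i hi).trans hw) h1)
            (by omega), h2⟩
        · simp only [tapeRun, tapeStep, hw] at hk ⊢
          obtain ⟨s'', h1, h2⟩ := ih (k := p :: .loop i p :: k)
            (by simpa using ⟨hPR, hPR, hR'⟩) (by simpa using ⟨hp, ⟨hi, hp⟩, hτ'⟩) hs hk
          exact ⟨s'', Sem.mono (Sem.loop_cons (T := 4 * T)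
            (by rw [hs.1 i hi, hw]; simp) h1) (by omega), h2⟩

end

/-! ## Classical evaluation with advice -/

section
variable {O : PMF (List Bool)} {α : Type} {k : List Prog} {s : Store} {T : ℕ} {ν : PMF α}
  {R : α → Store → Prop}

theorem Sem.exists_of_mem (h : Sem O k s T ν R) {c : Cfg} (hc : c ∈ (run O (k, s) T).support) :
    c.1 = [] ∧ ∃ a, R a c.2 := by
  obtain ⟨κ, -, h2, h3⟩ := h
  rw [h3, PMF.mem_support_map_iff] at hc
  obtain ⟨p, hp, rfl⟩ := hc
  exact ⟨rfl, p.1, h2 p hp⟩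

theorem Sem.map_run (h : Sem O k s T ν R) {g : Store → α} (hg : ∀ a s, R a s → g s = a) :
    (run O (k, s) T).map (fun c => g c.2) = ν := by
  obtain ⟨κ, rfl, h2, h3⟩ := h
  rw [h3, PMF.map_comp]
  exact PMF.map_congr_support _ fun p hp => hg _ _ (h2 p hp)

end

/-! ### Majority votes with a fixed tape of coins -/

theorem Prog.All.mono {S S' : Instr → Prop} (h : ∀ a, S a → S' a) :
    ∀ {P : Prog}, P.All S → P.All S'
  | .instr _, hP => h _ hP
  | .seq _ _, hP => ⟨hP.1.mono h, hP.2.mono h⟩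
  | .branch _ _ _ _, hP => ⟨hP.1.mono h, hP.2.1.mono h, hP.2.2.mono h⟩
  | .loop _ p, hP => Prog.All.mono (P := p) h hP

theorem Prog.All.and {S S' : Instr → Prop} :
    ∀ {P : Prog}, P.All S → P.All S' → P.All fun a => S a ∧ S' a
  | .instr _, h, h' => ⟨h, h'⟩
  | .seq _ _, h, h' => ⟨h.1.and h'.1, h.2.and h'.2⟩
  | .branch _ _ _ _, h, h' => ⟨h.1.and h'.1, h.2.1.and h'.2.1, h.2.2.and h'.2.2⟩
  | .loop _ p, h, h' => Prog.All.and (P := p) h h'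

theorem clearRange_isRandomized (K : ℕ) : ∀ b, (clearRange K b).All Instr.IsRandomized
  | 0 => trivial
  | b + 1 => ⟨clearRange_isRandomized K b, trivial⟩

/-- `ballot` contains `qinit` even if `E` is classical; this is why `IsRandomized` admits that
instruction. -/
theorem majority_isRandomized {E : Prog} (hE : E.All Instr.IsRandomized) (b : ℕ) :
    (majority E b).All Instr.IsRandomized := by
  have h1 := clearRange_isRandomized 16 b
  have h2 := hE.shift (K := 16) fun a ha => by
    cases a <;> simp_all [Instr.shift, Instr.IsRandomized]
  simp [majority, ballot, copy, moveRev, mv, spread, castVote, Prog.All, Instr.IsRandomized, *]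

/-- Running time of `majority`. -/
def majorityTime (b L k : ℕ) : ℕ := k * ((b + 20) * (2 * L + 2) + 3) + 1

/-- Initial store of `majority` with `x`, `w` and the counter `k`. -/
def majorityStore (u x w k : List Bool) : Store := Store.init [[], u, [], x, w, k]

theorem sem_majorityStore {O : PMF (List Bool)} {E : Prog} (hE : E.All fun a => ¬ a.IsQuery) {b : ℕ}
    (hb : E.Stacks (· < b)) (hb2 : 2 ≤ b) {u x w k : List Bool} {T : ℕ}
    (hT : E.HaltsWithin noOracle [x, w] T) :
    Sem O [majority E b] (majorityStore u x w k)
      (majorityTime b (x.length + w.length + T) k.length)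
      (majDist (answerDist E [x, w] T) k.length) fun a s' => answer (s'.stack 6) = a ∧
        s'.stack 0 = [] := by
  have hj : ∀ j, 6 ≤ j → (majorityStore u x w k).stack j = [] := by
    intro j hj
    obtain ⟨i, rfl⟩ := Nat.exists_eq_add_of_le' hj
    rfl
  refine (sem_majority (s := majorityStore u x w k) hE hb hb2 hT le_rfl (hj 6 (by omega))
    (hj 7 (by omega)) ⟨fun j => by rw [hj _ (by omega)]; simp, fun j _ => hj _ (by omega)⟩).conseq ?_
  rintro a - s' ⟨h6, -, -, h, -⟩
  exact ⟨h6, h 0 (by decide) (by decide) (by decide)⟩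

/-- The answer of `majority` with coins from the tape `r`. -/
def tapeAnswer (E : Prog) (b T : ℕ) (u x w k r : List Bool) : Bool :=
  answer ((tapeRun T ([majority E b], majorityStore u x w k) r).2.stack 6)

/-- Eighteen votes halve the error bound, because `(17/18)^18 ≤ 1/2`; `n + 1` halvings beat the
`2^n` instances. -/
theorem two_pow_mul_majority_lt_one (n : ℕ) : (2 : ℝ) ^ n * (17 / 18) ^ (18 * (n + 1)) < 1 := by
  have h : ((17 : ℝ) / 18) ^ 18 ≤ 1 / 2 := by norm_num
  calc (2 : ℝ) ^ n * (17 / 18) ^ (18 * (n + 1)) = 2 ^ n * ((17 / 18) ^ 18) ^ (n + 1) := by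
        rw [pow_mul]
    _ ≤ 2 ^ n * (1 / 2) ^ (n + 1) := by gcongr
    _ = 1 / 2 := by rw [pow_succ, ← mul_assoc, ← mul_pow]; norm_num
    _ < 1 := by norm_num

/-- One tape of coins is good for all instances. -/
theorem exists_tape {E : Prog} (hE : E.All Instr.IsRandomized) (hE' : E.All fun a => ¬ a.IsQuery)
    {b : ℕ} (hb : E.Stacks (· < b)) (hb2 : 2 ≤ b) {n T : ℕ} {h : Concept n} {u w k : List Bool}
    (hT : ∀ x : BitStr n, E.HaltsWithin noOracle [List.ofFn x, w] T) (hh : E.Evaluates w h)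
    (hk : k.length = 18 * (n + 1)) :
    ∃ r : List Bool, r.length = majorityTime b (n + w.length + T) k.length ∧ ∀ x : BitStr n,
      tapeAnswer E b (majorityTime b (n + w.length + T) k.length) u (List.ofFn x) w k r = h x := by
  set L := majorityTime b (n + w.length + T) k.length with hL
  have hbad : ∀ x : BitStr n, (tapeDist L).toOuterMeasure
      {r | tapeAnswer E b L u (List.ofFn x) w k r = !h x} ≤
        ENNReal.ofReal ((17 / 18) ^ (18 * (n + 1))) := by
    intro x
    have hsem := sem_majorityStore (O := noOracle) hE' hb hb2 (u := u) (k := k) (hT x)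
    rw [List.length_ofFn, ← hL] at hsem
    have h1 := hsem.map_run (g := fun s => answer (s.stack 6)) fun a s h => h.1
    rw [run_eq_tapeRun L (by simpa using majority_isRandomized hE b) le_rfl, PMF.map_comp] at h1
    have h2 := majDist_error (answerDist_error hh x (hT x)) k.length
    rw [← h1, hk] at h2
    rw [← PMF.toOuterMeasure_apply_singleton, PMF.toOuterMeasure_map_apply] at h2
    refine (ENNReal.le_ofReal_iff_toReal_le ?_ (by positivity)).2 h2
    exact ne_top_of_le_ne_top ENNReal.one_ne_top (PMF.toOuterMeasure_le_one _ _)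
  -- If every tape of this length failed on some instance, the failure sets would cover the support
  -- of `tapeDist L` and have total mass at least 1, against the union bound.
  by_contra! hcon
  have hsub : (tapeDist L).support ⊆
      ⋃ x : BitStr n, {r | tapeAnswer E b L u (List.ofFn x) w k r = !h x} := by
    intro r hr
    obtain ⟨x, hx⟩ := hcon r (length_of_mem_tapeDist hr)
    refine Set.mem_iUnion.2 ⟨x, ?_⟩
    show _ = _
    revert hx
    cases h x <;> cases tapeAnswer E b L u (List.ofFn x) w k r <;> simp
  have h1 := (PMF.toOuterMeasure_apply_eq_one_iff _ _).2 hsub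
  have h2 : (1 : ENNReal) ≤ ENNReal.ofReal (2 ^ n * (17 / 18) ^ (18 * (n + 1))) := by
    rw [← h1]
    refine (MeasureTheory.measure_iUnion_fintype_le _ _).trans
      ((Finset.sum_le_sum fun x _ => hbad x).trans (le_of_eq ?_))
    rw [Finset.sum_const, Finset.card_univ, Fintype.card_fun, Fintype.card_bool, Fintype.card_fin,
      nsmul_eq_mul, ENNReal.ofReal_mul (by positivity)]
    congr 1
    rw [ENNReal.ofReal_pow (by norm_num)]
    simp
  rw [ENNReal.one_le_ofReal] at h2
  exact absurd (two_pow_mul_majority_lt_one n) (not_lt.2 h2)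

/-! ### A prefix code for the advice -/

/-- Decoding of the advice into a specification, a counter and a tape. -/
def decode : List Bool → List Bool → List Bool → List Bool → List Bool × List Bool × List Bool
  -- The code words `0b`, `10b` and `11` add a bit to the tape, a bit to the specification and a
  -- unit to the counter. A truncated code word ends the decoding, so every string is legal advice.
  | [], w, k, r => (w, k, r)
  | [false], w, k, r => (w, k, r)
  | false :: b :: α, w, k, r => decode α w k (b :: r)
  | [true], w, k, r => (w, k, r)
  | [true, false], w, k, r => (w, k, r)
  | true :: false :: b :: α, w, k, r => decode α (b :: w) k r
  | true :: true :: α, w, k, r => decode α w (false :: k) r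

/-- Encoding of a specification, a counter and a tape. -/
def encodeAdvice (w : List Bool) (k : ℕ) (r : List Bool) : List Bool :=
  -- Decoding pushes bits on top of a stack, hence the reversals.
  (r.reverse.flatMap fun b => [false, b]) ++ (w.reverse.flatMap fun b => [true, false, b]) ++
    (List.replicate k [true, true]).flatten

theorem decode_tape (α w k r : List Bool) : ∀ v : List Bool,
    decode ((v.flatMap fun b => [false, b]) ++ α) w k r = decode α w k (v.reverse ++ r) := by
  intro v
  induction v generalizing r with
  | nil => rfl
  | cons b v ih =>
    simp only [List.flatMap_cons, List.cons_append, List.nil_append, decode, ih, List.reverse_cons,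
      List.append_assoc]

theorem decode_spec (α w k r : List Bool) : ∀ v : List Bool,
    decode ((v.flatMap fun b => [true, false, b]) ++ α) w k r = decode α (v.reverse ++ w) k r := by
  intro v
  induction v generalizing w with
  | nil => rfl
  | cons b v ih =>
    simp only [List.flatMap_cons, List.cons_append, List.nil_append, decode, ih, List.reverse_cons,
      List.append_assoc]

theorem decode_counter (w k r : List Bool) : ∀ m,
    decode (List.replicate m [true, true]).flatten w k r = (w, List.replicate m false ++ k, r) := by
  intro m
  induction m generalizing k with
  | zero => rfl
  | succ m ih =>
    simp only [List.replicate_succ, List.flatten_cons, List.cons_append, List.nil_append, decode, ih]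
    congr 2
    rw [← List.singleton_append, ← List.append_assoc, ← List.replicate_succ', List.replicate_succ,
      List.cons_append]

theorem decode_encodeAdvice (w : List Bool) (k : ℕ) (r : List Bool) :
    decode (encodeAdvice w k r) [] [] [] = (w, List.replicate k false, r) := by
  rw [encodeAdvice, List.append_assoc, decode_tape, decode_spec, decode_counter]
  simp

theorem length_encodeAdvice (w : List Bool) (k : ℕ) (r : List Bool) :
    (encodeAdvice w k r).length = 2 * r.length + 3 * w.length + 2 * k := by
  simp [encodeAdvice, List.length_flatMap]
  ring

/-- Needed for the running time on arbitrary advice. The tape does not appear, since its length does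
not enter the bound on the time of the vote. -/
theorem decode_length_le (α w k r : List Bool) :
    (decode α w k r).1.length + (decode α w k r).2.1.length ≤
      w.length + k.length + α.length := by
  induction α, w, k, r using decode.induct <;> simp_all [decode] <;> omega

/-- Decode the advice on stack 2. -/
def decoder : Prog :=
  .loop 2 (.branch 2 (.instr (.pop 2)) (.seq (.instr (.pop 2)) (mv 2 15))
    (.seq (.instr (.pop 2)) (.branch 2 (.instr (.pop 2)) (.seq (.instr (.pop 2)) (mv 2 4))
      (.seq (.instr (.pop 2)) (.instr (.push false 5))))))

theorem sem_mv_nil {O : PMF (List Bool)} {i j : ℕ} {k : List Prog} {s : Store} {T : ℕ}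
    {α : Type} {ν : PMF α} {R : α → Store → Prop} (hi : s.stack i = []) (h : Sem O k s T ν R) :
    Sem O (mv i j :: k) s (T + 2) ν R := by
  refine Sem.branch_nil hi (Sem.pop ?_)
  rwa [hi, List.tail_nil, Store.set_self hi]

/-- The store after decoding. -/
def decoded (s : Store) (a : List Bool × List Bool × List Bool) : Store :=
  (((s.set 2 []).set 4 a.1).set 5 a.2.1).set 15 a.2.2

theorem decoded_congr {s s' : Store} (hr : s.reg = s'.reg)
    (h : ∀ j, j ≠ 2 → j ≠ 4 → j ≠ 5 → j ≠ 15 → s.stack j = s'.stack j)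
    (a : List Bool × List Bool × List Bool) : decoded s a = decoded s' a := by
  refine Store.ext' (fun j => ?_) hr
  simp only [decoded, Store.set_stack]
  split_ifs <;> simp_all

theorem decoded_self {s : Store} (h2 : s.stack 2 = []) :
    s = decoded s (s.stack 4, s.stack 5, s.stack 15) := by
  rw [decoded, Store.set_self h2, Store.set_self (i := 4) rfl, Store.set_self (i := 5) rfl,
    Store.set_self rfl]

theorem det_decoder {O : PMF (List Bool)} (α w k r : List Bool) : ∀ {s : Store}, s.stack 2 = α →
    s.stack 4 = w → s.stack 5 = k → s.stack 15 = r →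
    Det O [decoder] s (12 * α.length + 1) (decoded s (decode α w k r)) := by
  -- Covers regular and truncated endings alike: once the advice has been used up, the loop stops
  -- with stacks 4, 5 and 15 as they are.
  have hend : ∀ {s s' : Store}, s.stack 2 = [] → s.reg = s'.reg →
      (∀ j, j ≠ 2 → j ≠ 4 → j ≠ 5 → j ≠ 15 → s.stack j = s'.stack j) →
      Det O [decoder] s 1 (decoded s' (s.stack 4, s.stack 5, s.stack 15)) := by
    intro s s' h2 hr h
    refine Sem.loop_nil h2 (Sem.nil ?_)
    rw [← decoded_congr hr h]
    exact decoded_self h2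
  induction α, w, k, r using decode.induct with
  | case1 w k r =>
    rintro s h2 rfl rfl rfl
    exact hend h2 rfl fun _ _ _ _ _ => rfl
  | case2 w k r =>
    rintro s h2 rfl rfl rfl
    refine Sem.mono (Sem.loop_cons (by simp [h2]) (Sem.branch_cons h2 (Sem.seq (Sem.pop
      (sem_mv_nil ?_ (hend (s' := s) ?_ rfl ?_)))))) (by simp)
    · simp [Store.set_stack, h2]
    · simp [Store.set_stack, h2]
    · intro j h2 _ _ _; simp [Store.set_stack, h2]
  | case3 b α w k r ih =>
    rintro s h2 rfl rfl rfl
    refine Sem.mono (Sem.loop_cons (by simp [h2]) (Sem.branch_cons h2 (Sem.seq (Sem.pop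
      (sem_mv (by decide) (a := b) (w := α) ?_ (Det.conv (ih ?_ ?_ ?_ ?_) le_rfl
        (decoded_congr ?_ ?_ _))))))) ?_
    all_goals first
      | (simp [Store.set_stack, h2]; done)
      | rfl
      | (intro j j2 j4 j5 j15; simp [Store.set_stack, j2, j15])
      | (simp only [List.length_cons]; omega)
  | case4 w k r =>
    rintro s h2 rfl rfl rfl
    refine Sem.mono (Sem.loop_cons (by simp [h2]) (Sem.branch_cons h2 (Sem.seq (Sem.pop
      (Sem.branch_nil ?_ (Sem.pop (hend (s' := s) ?_ rfl ?_))))))) (by simp)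
    · simp [Store.set_stack, h2]
    · simp [Store.set_stack, h2]
    · intro j h2 _ _ _; simp [Store.set_stack, h2]
  | case5 w k r =>
    rintro s h2 rfl rfl rfl
    refine Sem.mono (Sem.loop_cons (by simp [h2]) (Sem.branch_cons h2 (Sem.seq (Sem.pop
      (Sem.branch_cons (b := false) (w := []) ?_ (Sem.seq (Sem.pop
        (sem_mv_nil ?_ (hend (s' := s) ?_ rfl ?_))))))))) (by simp)
    · simp [Store.set_stack, h2]
    · simp [Store.set_stack, h2]
    · simp [Store.set_stack, h2]
    · intro j h2 _ _ _; simp [Store.set_stack, h2]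
  | case6 b α w k r ih =>
    rintro s h2 rfl rfl rfl
    refine Sem.mono (Sem.loop_cons (by simp [h2]) (Sem.branch_cons h2 (Sem.seq (Sem.pop
      (Sem.branch_cons (b := false) (w := b :: α) ?_ (Sem.seq (Sem.pop
        (sem_mv (by decide) (a := b) (w := α) ?_ (Det.conv (ih ?_ ?_ ?_ ?_) le_rfl
        (decoded_congr ?_ ?_ _)))))))))) ?_
    all_goals first
      | (simp [Store.set_stack, h2]; done)
      | rfl
      | (intro j j2 j4 j5 j15; simp [Store.set_stack, j2, j4])
      | (simp only [List.length_cons]; omega)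
  | case7 α w k r ih =>
    rintro s h2 rfl rfl rfl
    refine Sem.mono (Sem.loop_cons (by simp [h2]) (Sem.branch_cons h2 (Sem.seq (Sem.pop
      (Sem.branch_cons (b := true) (w := α) ?_ (Sem.seq (Sem.pop (Sem.push
        (Det.conv (ih ?_ ?_ ?_ ?_) le_rfl (decoded_congr ?_ ?_ _)))))))))) ?_
    all_goals first
      | (simp [Store.set_stack, h2]; done)
      | rfl
      | (intro j j2 j4 j5 j15; simp [Store.set_stack, j2, j5])
      | (simp only [List.length_cons]; omega)

/-! ### The deterministic program with advice -/

/-- Evaluate the hypothesis specified by the advice on stack 2 on the instance on stack 0. -/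
def decider (E : Prog) (b : ℕ) : Prog :=
  .seq (moveRev 0 7) <| .seq (moveRev 7 3) <| .seq decoder <|
    .seq ((majority E b).derand 15) <|
    .branch 6 (.instr (.push false 0)) (.instr (.push false 0)) (.instr (.push true 0))

theorem decider_isDeterministic (E : Prog) (b : ℕ) :
    (decider E b).All Instr.IsDeterministic := by
  have := (majority E b).derand_isDeterministic 15
  simp [decider, decoder, moveRev, mv, Prog.All, Instr.IsDeterministic, *]

/-- The tape `r` is arbitrary here: the program halts in time with any tape, and the quality of the
tape matters only for the value of `tapeAnswer`. -/
theorem exists_det_decider {O : PMF (List Bool)} {E : Prog} (hE : E.All Instr.IsRandomized)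
    (hE' : E.All fun a => ¬ a.IsQuery) {b : ℕ} (hb : E.Stacks (· < b)) (hb2 : 2 ≤ b)
    {x u α w k r : List Bool} (hα : decode α [] [] [] = (w, k, r)) {T : ℕ}
    (hT : E.HaltsWithin noOracle [x, w] T) {Tm : ℕ}
    (hTm : Tm = majorityTime b (x.length + w.length + T) k.length) :
    ∃ s, Det O [decider E b] (Store.init [x, u, α]) (10 * x.length + 12 * α.length + 4 * Tm + 20) s ∧
      s.stack 0 = [tapeAnswer E b Tm u x w k r] := by
  set s0 := Store.init [x, u, α] with hs0
  have hj : ∀ j, 3 ≤ j → s0.stack j = [] := by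
    intro j hj
    obtain ⟨i, rfl⟩ := Nat.exists_eq_add_of_le' hj
    rfl
  -- Moving through stack 7 reverses the instance twice, and leaves stack 0 empty for the output.
  have d1 := det_moveRev (O := O) (i := 0) (j := 7) (by decide) (s := s0) (w := x) rfl
  rw [hj 7 (by decide), List.append_nil] at d1
  set s1 := (s0.set 0 []).set 7 x.reverse with hs1
  have d2 := det_moveRev (O := O) (i := 7) (j := 3) (by decide) (s := s1) (w := x.reverse)
    (by simp [hs1, Store.set_stack])
  have e3 : s1.stack 3 = [] := by simp [hs1, Store.set_stack, hj]
  rw [e3, List.append_nil, List.reverse_reverse] at d2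
  set s2 := (s1.set 7 []).set 3 x with hs2
  have d3 := det_decoder (O := O) α [] [] [] (s := s2) (by simp [hs2, hs1, Store.set_stack]; rfl)
    (by simp [hs2, hs1, Store.set_stack, hj]) (by simp [hs2, hs1, Store.set_stack, hj])
    (by simp [hs2, hs1, Store.set_stack, hj])
  rw [hα] at d3
  have hon : TapeOn 15 (majorityStore u x w k) r (decoded s2 (w, k, r)) := by
    refine ⟨fun j hj15 => ?_, by simp [decoded, Store.set_stack]⟩
    rcases Nat.lt_or_ge j 8 with h | h
    · interval_cases j <;> simp [decoded, hs2, hs1, Store.set_stack, majorityStore, Store.init, hs0]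
    · have : (majorityStore u x w k).stack j = [] := by
        obtain ⟨i, rfl⟩ := Nat.exists_eq_add_of_le' h
        rfl
      rw [this]
      simp only [decoded, hs2, hs1, Store.set_stack]
      simp [hj15, show j ≠ 5 by omega, show j ≠ 4 by omega, show j ≠ 2 by omega,
        show j ≠ 3 by omega, show j ≠ 7 by omega, show j ≠ 0 by omega, hj j (by omega)]
  have hR : ∀ P ∈ [majority E b], P.All Instr.IsRandomized := by
    simpa using majority_isRandomized hE b
  have hsem := sem_majorityStore (O := O) hE' hb hb2 (u := u) (k := k) hT
  rw [← hTm] at hsem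
  have hfin := hsem.exists_of_mem (tapeRun_mem_support Tm (c := ([majority E b], majorityStore u x w k))
    hR r)
  -- The tape lies on stack 15 because `majority` uses stacks 3 to 7 and those from 16 on.
  obtain ⟨s4, d4, h4⟩ := exists_det_derand (O := O) (τ := 15) Tm hR (by
    simpa using stacks_majority (S := (· ≠ 15)) (by simp) (by intros; omega)) hon hfin.1
  obtain ⟨-, a, -, f0⟩ := hfin
  have g0 : s4.stack 0 = [] := (h4 0 (by decide)).trans f0
  have g6 := h4 6 (by decide)
  have d5 : Det O [.branch 6 (.instr (.push false 0)) (.instr (.push false 0))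
      (.instr (.push true 0))] s4 2 (s4.set 0 [tapeAnswer E b Tm u x w k r]) := by
    have hans : tapeAnswer E b Tm u x w k r = answer (s4.stack 6) := by rw [tapeAnswer, g6]
    rw [hans]
    rcases h6 : s4.stack 6 with _ | ⟨c, v⟩
    · refine Sem.branch_nil h6 (Sem.push (T := 0) (Sem.nil ?_))
      rw [g0]; rfl
    · refine Sem.branch_cons h6 ?_
      cases c <;> refine Sem.push (T := 0) (Sem.nil ?_) <;> rw [g0] <;> rfl
  refine ⟨s4.set 0 [tapeAnswer E b Tm u x w k r], Sem.mono (Sem.seq (d1.cons (Sem.seq (d2.cons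
    (Sem.seq (d3.cons (Sem.seq (Det.cons d4 d5)))))))) ?_, by simp [Store.set_stack]⟩
  simp only [List.length_reverse]
  omega

/-! ## Classical learnability implies heuristic solvability with advice -/

/-- Only positive success probability matters: some halting run ends with a good specification. Its
length is at most the initial bound plus `T`, where the 1 accounts for the label in an answer of the
oracle. -/
theorem exists_short_goodSpec {R : HypothesisClass} {A : Prog} {n : ℕ} {c : Concept n}
    {D : PMF (BitStr n)} {ε δ : ℝ} (hδ1 : δ < 1) {T : ℕ}
    (hT : A.HaltsWithin (exampleOracle c D) (learnerInput n ε δ) T)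
    (hp : ENNReal.ofReal (1 - δ) ≤
      A.prob (exampleOracle c D) (learnerInput n ε δ) (goodSpecs R c D ε)) :
    ∃ σ ∈ goodSpecs R c D ε, σ.length ≤ n + ⌊1 / ε⌋₊ + ⌊1 / δ⌋₊ + 1 + T := by
  rw [hT.prob_eq] at hp
  have hpos := (ENNReal.ofReal_pos.2 (by linarith : 0 < 1 - δ)).trans_le hp
  obtain ⟨a, ha, -, haW⟩ : ((run (exampleOracle c D) ([A], Store.init (learnerInput n ε δ))
      T).support ∩ {c' | c'.1 = [] ∧ c'.2.stack 0 ∈ goodSpecs R c D ε}).Nonempty := by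
    rw [Set.nonempty_iff_ne_empty]
    exact fun h => hpos.ne' ((PMF.toOuterMeasure_apply_eq_zero_iff _ _).2
      (Set.disjoint_iff_inter_eq_empty.2 h))
  refine ⟨a.2.stack 0, haW, run_length_le (fun w hw => ?_) (fun j => ?_) ha 0⟩
  · obtain ⟨x, -, rfl⟩ := (PMF.mem_support_map_iff _ _ _).1 hw
    simp [encodeExample]
    omega
  · refine (Store.init_length_le _ j).trans ?_
    simp [learnerInput, unary]
    omega

/-- The bound must hold for all input strings, malformed advice and bad tapes included. It works
because decoded specification and counter are no longer than the advice. -/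
theorem decider_isPolyTime {E : Prog} (hE : E.All Instr.IsRandomized) (hE' : E.IsPolyTime 2) {b : ℕ}
    (hb : E.Stacks (· < b)) (hb2 : 2 ≤ b) : (decider E b).IsPolyTime 3 := by
  refine ⟨(decider_isDeterministic E b).mono fun a ha hq => by
    cases a <;> first | exact ha | exact hq, ?_⟩
  obtain ⟨hEq, t, hEt⟩ := hE'
  have k := PolyBdd.const
  have hN := PolyBdd.id
  -- With total input length `N`, moving and decoding cost at most `(10 + 12) N`, and there are at
  -- most `N` votes, each on inputs of total length at most `N`.
  obtain ⟨p, hp⟩ : PolyBdd fun N => 22 * N + 4 * (N * ((b + 20) * (2 * (N + t.eval N) + 2) + 3) + 1)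
      + 20 :=
    (((k 22).mul hN).add ((k 4).mul ((hN.mul (((k (b + 20)).mul (((k 2).mul (hN.add
      (PolyBdd.eval t))).add (k 2))).add (k 3))).add (k 1)))).add (k 20)
  refine ⟨p, fun ins hins => ?_⟩
  obtain ⟨x, u, α, rfl⟩ := List.length_eq_three.1 hins
  rcases hα : decode α [] [] [] with ⟨w, v, r⟩
  have hlen := decode_length_le α [] [] []
  rw [hα] at hlen
  simp only [List.length_nil, add_zero, zero_add] at hlen
  obtain ⟨s, hdet, -⟩ := exists_det_decider (O := noOracle) hE hEq hb hb2 (u := u) hα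
    (T := t.eval (x.length + w.length)) (by simpa using hEt [x, w] rfl) rfl
  refine hdet.halts.mono (le_trans ?_ (hp _))
  simp only [List.map_cons, List.map_nil, List.sum_cons, List.sum_nil, add_zero]
  set N := x.length + (u.length + α.length)
  have hT : t.eval (x.length + w.length) ≤ t.eval N := eval_mono_nat t (by omega)
  have hm : majorityTime b (x.length + w.length + t.eval (x.length + w.length)) v.length ≤
      N * ((b + 20) * (2 * (N + t.eval N) + 2) + 3) + 1 := by
    unfold majorityTime
    gcongr <;> omega
  omega

/-- The learner is used only to prove that short good advice exists, for each `n` and `ε`. The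
program itself runs the evaluator on this advice and never learns. -/
theorem heurPPoly_of_cc {C : ∀ n, Set (Concept n)} {D : ∀ n, PMF (BitStr n)} (h : CC C D)
    {c : ∀ n, Concept n} (hc : ∀ n, c n ∈ C n) : HeurPPoly c D := by
  obtain ⟨R, ⟨E, hEc, hEp, hE⟩, A, tA, -, hA⟩ := h
  have hEr : E.All Instr.IsRandomized := (hEc.and hEp.1).mono fun a ha => by
    cases a <;> simp_all [Instr.AllowedOn, Instr.IsQuantum, Instr.IsQuery, Instr.IsRandomized]
  obtain ⟨b, hb⟩ := E.exists_bound
  have hb := hb.mono (S' := (· < b + 2)) fun i hi => by omega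
  have hpoly := decider_isPolyTime hEr hEp hb (by omega)
  obtain ⟨hEq, t, hEt⟩ := hEp
  have k := PolyBdd.const
  have hX := PolyBdd.id
  -- Bounds the length of the specification: with `⌊1/ε'⌋ ≤ ⌊1/ε⌋ + 4` and `⌊1/δ⌋ = 4`, the
  -- learner's parameters add up to at most `X + 8`, and the example label adds one more.
  have hℓ : PolyBdd fun X => X + 9 + tA.eval (X + 8) :=
    (hX.add (k 9)).add (PolyBdd.comp tA (hX.add (k 8)))
  have hXℓ := hX.add hℓ
  -- The code spends 2 bits per bit of the tape, 3 per bit of the specification and 2 per vote; `36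
  -- = 2 * 18`.
  obtain ⟨q, hq⟩ := (((k 2).mul ((((k 18).mul (hX.add (k 1))).mul (((k (b + 2 + 20)).mul
    (((k 2).mul (hXℓ.add (PolyBdd.comp t hXℓ))).add (k 2))).add (k 3))).add (k 1))).add
    ((k 3).mul hℓ)).add ((k 36).mul (hX.add (k 1)))
  refine ⟨decider E (b + 2), q, decider_isDeterministic _ _, hpoly, fun n ε hε => ?_⟩
  set X := n + ⌊1 / ε⌋₊ with hXdef
  -- The heuristic class allows every positive `ε`, the learner only `ε < 1/2`.
  set ε' := min ε (1 / 4) with hε'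
  have hε'0 : 0 < ε' := lt_min hε (by norm_num)
  have hε'1 : ε' < 1 / 2 := (min_le_right _ _).trans_lt (by norm_num)
  have hfl : ⌊1 / ε'⌋₊ ≤ ⌊1 / ε⌋₊ + 4 := by
    rcases min_choice ε (1 / 4) with h | h
    · rw [hε', h]; omega
    · rw [hε', h]; norm_num
  have hfl4 : ⌊1 / (1 / 4 : ℝ)⌋₊ = 4 := by norm_num
  obtain ⟨hhalt, hlearn⟩ := hA n ε' (1 / 4) hε'0 hε'1 (by norm_num) (by norm_num)
  have hhalt := hhalt (labelled (c n) (D n))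
  rw [← oracleOf, ← exampleOracle_eq] at hhalt
  obtain ⟨σ, ⟨h, hσ, herr⟩, hlen⟩ := exists_short_goodSpec (by norm_num) hhalt (hlearn _ (hc n))
  rw [hfl4] at hlen
  have hlen' : σ.length ≤ X + 9 + tA.eval (X + 8) := by
    refine hlen.trans (add_le_add (by omega) (eval_mono_nat tA (by omega)))
  set T := t.eval (n + σ.length) with hT
  have hTx : ∀ x : BitStr n, E.HaltsWithin noOracle [List.ofFn x, σ] T := fun x => by
    simpa [hT] using hEt [List.ofFn x, σ] rfl
  obtain ⟨r, hr, hgood⟩ := exists_tape hEr hEq hb (by omega) (u := unary ⌊1 / ε⌋₊) hTx (hE n σ h hσ)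
    (k := List.replicate (18 * (n + 1)) false) (by simp)
  rw [List.length_replicate] at hr hgood
  refine ⟨encodeAdvice σ (18 * (n + 1)) r, ?_, ?_⟩
  · rw [length_encodeAdvice, hr]
    refine le_trans ?_ (hq X)
    have hTX : T ≤ t.eval (X + (X + 9 + tA.eval (X + 8))) := eval_mono_nat t (by omega)
    have hm : majorityTime (b + 2) (n + σ.length + T) (18 * (n + 1)) ≤
        18 * (X + 1) * ((b + 2 + 20) * (2 * (X + (X + 9 + tA.eval (X + 8)) +
          t.eval (X + (X + 9 + tA.eval (X + 8)))) + 2) + 3) + 1 := by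
      unfold majorityTime
      gcongr <;> omega
    simp only
    omega
  · have hprob : ∀ x : BitStr n, h x = c n x → (decider E (b + 2)).prob noOracle
        [List.ofFn x, unary ⌊1 / ε⌋₊, encodeAdvice σ (18 * (n + 1)) r] {[c n x]} = 1 := by
      intro x hx
      obtain ⟨s, hdet, hs⟩ := exists_det_decider (O := noOracle) hEr hEq hb (by omega)
        (u := unary ⌊1 / ε⌋₊) (decode_encodeAdvice σ (18 * (n + 1)) r) (hTx x) rfl
      rw [List.length_ofFn, List.length_replicate, hgood x] at hs
      refine le_antisymm ?_ ?_
      · rw [Prog.HaltsWithin.prob_eq hdet.halts]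
        exact PMF.toOuterMeasure_le_one _ _
      · refine le_trans ?_ (Sem.le_prob hdet (A := Set.univ) fun _ _ s' hs' => ?_)
        · rw [(PMF.toOuterMeasure_apply_eq_one_iff _ _).2 (Set.subset_univ _)]
        · rw [hs', hs, hx]; rfl
    rw [ENNReal.ofReal_sub _ hε.le, ENNReal.ofReal_one, tsub_le_iff_right]
    -- The tape is right on every instance, so the program can err only where the hypothesis does.
    calc (1 : ENNReal) = Pr (D n) Set.univ :=
          ((PMF.toOuterMeasure_apply_eq_one_iff _ _).2 (Set.subset_univ _)).symm
      _ ≤ Pr (D n) ({x | (decider E (b + 2)).prob noOracle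
            [List.ofFn x, unary ⌊1 / ε⌋₊, encodeAdvice σ (18 * (n + 1)) r] {[c n x]} = 1} ∪
            {x | h x ≠ c n x}) :=
          MeasureTheory.measure_mono fun x _ => by
            by_cases hx : h x = c n x
            · exact Or.inl (hprob x hx)
            · exact Or.inr hx
      _ ≤ _ := MeasureTheory.measure_union_le _ _
      _ ≤ _ := by
        refine add_le_add le_rfl (herr.trans (ENNReal.ofReal_le_ofReal (min_le_left _ _)))

end PAC

end

/-! ### The separation -/

theorem theorem5 (C : ∀ n : ℕ, Set (PAC.Concept n)) (D : ∀ n : ℕ, PMF (PAC.BitStr n))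
    (ha : PAC.QuantumEvaluable C)
    (hb : ∃ p : Polynomial ℕ, ∀ n : ℕ, (C n).ncard ≤ p.eval n)
    (hc : ∃ c : ∀ n : ℕ, PAC.Concept n, (∀ n : ℕ, c n ∈ C n) ∧ ¬ PAC.HeurPPoly c D) :
    PAC.SeparationCCQQ C D := by
  obtain ⟨c, hcC, hc⟩ := hc
  exact ⟨PAC.qq_of_quantumEvaluable ha hb, fun h => hc (PAC.heurPPoly_of_cc h hcC)⟩
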